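/- **Setting.** Let $n\in\{2,3\}$, let $G$ be a compact Lie group (realised as a closed subgroup of some $U(N)$) with Lie algebra $\mathfrak g$, fix an $\mathrm{Ad}$-invariant scalar product on $\mathfrak g$ and an orthonormal basis $T_1,\dots,T_d$, and let $f^{PQR}$ be the structure constants, $[u,v]^P=f^{PQR}u^Qv^R$. Repeated indices are summed. Fix a real $s>n/2$. The space $\mathcal A$ of connections, and each of its tangent spaces, consists of the one-forms $A=(A_1,\dots,A_n)$ on $\mathbb R^n$ with values in $\mathfrak g$ and with components in $H^s(\mathbb R^n)$. A gauge transformation $\varphi$, a $C^1$ map $\mathbb R^n\to G$, acts by $A\mapsto\varphi A\varphi^{-1}+\varphi\,d\varphi^{-1}$. All derivatives of non-smooth functions are weak, and test functions are $C^1$ with compact support. For a connection $(A_0,A)$ on $\mathbb R^{1+n}$ let $F_{\alpha\beta}=\partial_\alpha A_\beta-\partial_\beta A_\alpha+[A_\alpha,A_\beta]$, and let $I=-\frac14\int\langle F_{\alpha\beta},F^{\alpha\beta}\rangle$ (Minkowski metric $\mathrm{diag}(-1,1,\dots,1)$) be the Yang–Mills action. Thus $I=\int L\,dt$ with $L=-\frac14\int_{\mathbb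 R^n}\langle F_{\alpha\beta},F^{\alpha\beta}\rangle dx=\frac12\int F_{0i}^PF_{0i}^P\,dx-\frac14\int F^P_{ij}F^P_{ij}\,dx$, and $L$ depends only on $A_0$, $A$ and $V=\partial_tA$. Let $D_iu=\partial_iu+[A_i,u]$ and $\Delta_A=D_iD_i$. The *energy space* of $A$ is the set of the weakly differentiable $u\in L^2_{loc}(\mathbb R^n;\mathfrak g)$ for which there are test functions $\psi_k$ with $\psi_k\to u$ in $L^2_{loc}$ and $D_i\psi_k\to D_iu$ in $L^2(\mathbb R^n)$. The Gauss law $D_iF_{0i}=0$ and the equation $u=\Delta_A^{-1}h$ (i.e. $\Delta_Au=h$) are understood weakly, with $A_0$, respectively $u$, in the energy space. *The induced metric.* For $A,V\in H^s$ let $T_A(V)=\frac12\int F_{0i}^PF_{0i}^P\,dx$, where $\partial_tA=V$ and $A_0$ is a solution of the Gauss law (set $T_A(V)=0$ if there is none). The metric induced by the action is $\mathfrak G[A](X,Y)=T_A(X+Y)-T_A(X)-T_A(Y)$. **Lemma.** 1. $\mathfrak G$ lives on the orbit space: for all $A,X,Y\in H^s$ and all $\xi$ in the energy space of $A$ with $D\xi\in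 H^s$, $\mathfrak G[A](X+D\xi,Y)=\mathfrak G[A](X,Y)=\mathfrak G[A](X,Y+D\xi)$; and $\mathfrak G[A'](\varphi X\varphi^{-1},\varphi Y\varphi^{-1})=\mathfrak G[A](X,Y)$ whenever $A'=\varphi A\varphi^{-1}+\varphi\,d\varphi^{-1}$ for a gauge transformation $\varphi$ (all forms being in $H^s$). 2. There is $\varepsilon>0$ such that the following holds for all $A\in\mathcal A$ in Coulomb gauge, $\partial_iA_i=0$, with $\|A_i^P\|_{H^s}<\varepsilon$ for all $i,P$. (a) For each $V\in H^s$ the Gauss law has a solution $A_0$; any two solutions have the same covariant derivatives $D_iA_0$ almost everywhere; and for every solution $L=\frac12\mathfrak G[A](V,V)-\frac14\int F^P_{ij}F^P_{ij}\,dx$. (b) If moreover $\partial_iV_i=0$, the Gauss law is equivalent to $A_0=\Delta_A^{-1}\big([A_i,V_i]\big)$. (c) The metric on the Coulomb slice is given by the distributional kernel $$\mathfrak G[A]_{A_i^P(x)A_j^Q(x')}=\delta_{ij}\delta_{PQ}\delta(x-x')+f^{PRV}A_i^V(x)\,(\Delta_A^{-1})^{RR'}(x,x')\,f^{R'UQ}A_j^U(x').$$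 That is, for all $X,Y\in H^s$ with $\partial_iX_i=\partial_iY_i=0$, and for each $u=\Delta_A^{-1}h$ with $h^R=f^{RUQ}A^U_jY^Q_j$, $$\mathfrak G[A](X,Y)=\int_{\mathbb R^n}\delta_{ij}\delta_{PQ}X_i^PY_j^Q\,dx+\int_{\mathbb R^n}X_i^P f^{PRV}A_i^V u^R\,dx,$$ the last integrand being integrable. If $K(x,x')$ is an integral kernel of $\Delta_A^{-1}$ (it suffices: on the functions $h=[A_j,Y_j]$ with $Y\in H^s$, $\partial_jY_j=0$; the integrals $\int K(x,x')h(x')dx'$ converging absolutely, in each component, for almost every $x$), then $$\mathfrak G[A](X,Y)=\int\delta_{ij}\delta_{PQ}X_i^PY_j^Q\,dx+\int\!\!\int X_i^P(x)f^{PRV}A_i^V(x)K^{RR'}(x,x')f^{R'UQ}A_j^U(x')Y_j^Q(x')\,dx'\,dx.$$ (d) Consequently, if $A(t)$ is a time-differentiable family of such connections, with $\partial_tA(t)\in H^s$ and $\partial_i\partial_tA_i=0$, and $A_0(t)$ solves the Gauss law for each $t\in\mathbb R$, then for every set $J$ of times the action over $J\times\mathbb R^n$ is $I=\int_J\big(\frac12\mathfrak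 G[A](\partial_tA,\partial_tA)-\frac14\int F^P_{ij}F^P_{ij}\,dx\big)dt$. -/

import Mathlib

open MeasureTheory Filter Topology
open scoped ENNReal FourierTransform

noncomputable section

namespace YM

/-- Physical space `ℝⁿ`, Euclidean. -/
abbrev Sp (n : ℕ) := EuclideanSpace ℝ (Fin n)

/-- The Lie algebra `𝔤 ≅ ℝᵈ`, in coordinates with respect to a chosen orthonormal basis. -/
abbrev Alg (d : ℕ) := EuclideanSpace ℝ (Fin d)

/-- A `𝔤`-valued function on space. -/
abbrev Section' (n d : ℕ) := Sp n → Alg d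

/-- A spatial `𝔤`-valued one-form `A = (A_1, …, A_n)`, with components `A_i^P(x) = A i x P`. -/
abbrev Form (n d : ℕ) := Fin n → Sp n → Alg d

/-- A compact Lie group, realised as a closed subgroup `G` of a unitary group `U(N)`, together with
a basis `T_1, …, T_d` of its (real) Lie algebra
`𝔤 = {X | exp (t X) ∈ G for all real t}` which is orthonormal for an adjoint-invariant scalar
product on `𝔤`. The scalar product is the one whose value on `(∑ u_P T_P, ∑ v_P T_P)` is
`∑ u_P v_P`, so that its adjoint invariance says that `Ad_g` preserves the Euclidean length of
coordinate vectors. -/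
structure GaugeGroup (N d : ℕ) where
  G : Subgroup (Matrix.unitaryGroup (Fin N) ℂ)
  isClosed : IsClosed (G : Set (Matrix.unitaryGroup (Fin N) ℂ))
  T : Fin d → Matrix (Fin N) (Fin N) ℂ
  linearIndependent : LinearIndependent ℝ T
  mem_span_iff : ∀ X : Matrix (Fin N) (Fin N) ℂ, X ∈ Submodule.span ℝ (Set.range T) ↔
    ∀ t : ℝ, ∃ g ∈ G, (g : Matrix (Fin N) (Fin N) ℂ) = NormedSpace.exp (t • X)
  ad_invariant : ∀ g ∈ G, ∀ u v : Alg d,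
    (g : Matrix (Fin N) (Fin N) ℂ) * (∑ P, u P • T P) * (g : Matrix (Fin N) (Fin N) ℂ)⁻¹
      = ∑ P, v P • T P → ‖u‖ = ‖v‖
  /-- The structure constants `f^{PQR}` of the basis (they are determined by `T`):
  `[T_Q, T_R] = ∑_P f^{PQR} T_P`, so that `[u, v]^P = f^{PQR} u^Q v^R`. -/
  f : Fin d → Fin d → Fin d → ℝ
  commutator : ∀ Q R, T Q * T R - T R * T Q = ∑ P, f P Q R • T P

variable {N d n : ℕ}

/-- The matrix with coordinates `u`. -/
def GaugeGroup.toMat (S : GaugeGroup N d) (u : Alg d) : Matrix (Fin N) (Fin N) ℂ :=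
  ∑ P, u P • S.T P

/-- The Lie bracket in coordinates: `[u, v]^P = f^{PQR} u^Q v^R`. -/
def GaugeGroup.br (S : GaugeGroup N d) (u v : Alg d) : Alg d :=
  WithLp.toLp 2 fun P => ∑ Q, ∑ R, S.f P Q R * u Q * v R

/-! ### Sobolev spaces, weak derivatives -/

/-- The unit vector `e_i`. -/
def e (i : Fin n) : Sp n := EuclideanSpace.single i 1

/-- The `H^s` norm `‖(1 + |ξ|²)^{s/2} f̂(ξ)‖_{L²}` of a real function, with `f̂` the `L²` Fourier
transform; it is `∞` if `f` is not in `L²`. -/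
def sobolevNorm (s : ℝ) (f : Sp n → ℝ) : ℝ≥0∞ :=
  open Classical in
  if hf : MemLp (fun x => (f x : ℂ)) 2 (volume : Measure (Sp n)) then
    eLpNorm (fun ξ : Sp n => (((1 + ‖ξ‖ ^ 2) ^ (s / 2) : ℝ) : ℂ) *
      (𝓕 (hf.toLp (fun x => (f x : ℂ))) : Lp ℂ 2 (volume : Measure (Sp n))) ξ) 2 volume
  else ⊤

/-- The space of `H^s` one-forms (the space `𝒜` of connections, and also its tangent spaces). -/
def InHs (s : ℝ) (A : Form n d) : Prop := ∀ i P, sobolevNorm s (fun x => A i x P) < ⊤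

/-- The open neighbourhood of radius `ε` of the flat connection `A = 0` in `H^s`. -/
def NearFlat (s ε : ℝ) (A : Form n d) : Prop :=
  ∀ i P, sobolevNorm s (fun x => A i x P) < ENNReal.ofReal ε

/-- Compactly supported `C¹` functions, used as test functions. -/
def IsTest {V : Type*} [NormedAddCommGroup V] [NormedSpace ℝ V] (ψ : Sp n → V) : Prop :=
  ContDiff ℝ 1 ψ ∧ HasCompactSupport ψ

/-- `v = ∂_i u` in the weak sense. -/
def HasWeakDeriv (i : Fin n) (u v : Section' n d) : Prop :=
  LocallyIntegrable u ∧ LocallyIntegrable v ∧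
    ∀ ψ : Sp n → ℝ, IsTest ψ → ∫ x, (fderiv ℝ ψ x (e i)) • u x = -∫ x, ψ x • v x

/-- The weak derivative `∂_i u` (unique almost everywhere; `0` if there is none). -/
def weakDeriv (i : Fin n) (u : Section' n d) : Section' n d :=
  open Classical in if h : ∃ v, HasWeakDeriv i u v then h.choose else 0

/-- The Coulomb condition `∑_i ∂_i A_i = 0`, weakly. -/
def IsCoulomb (A : Form n d) : Prop :=
  ∀ ψ : Sp n → ℝ, IsTest ψ → ∑ i, ∫ x, (fderiv ℝ ψ x (e i)) • A i x = 0

/-! ### Curvature, Lagrangian, action -/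

/-- The electric field `F_{0j} = ∂_t A_j - ∂_j A_0 + [A_0, A_j]`, where `V = ∂_t A`. -/
def electric (S : GaugeGroup N d) (A₀ : Section' n d) (A V : Form n d) : Form n d :=
  fun j x => V j x - weakDeriv j A₀ x + S.br (A₀ x) (A j x)

/-- The spatial curvature `F_{ij} = ∂_i A_j - ∂_j A_i + [A_i, A_j]`. -/
def magnetic (S : GaugeGroup N d) (A : Form n d) (i j : Fin n) : Section' n d :=
  fun x => weakDeriv i (A j) x - weakDeriv j (A i) x + S.br (A i x) (A j x)

/-- The curvature `F_{αβ} = ∂_α A_β - ∂_β A_α + [A_α, A_β]` on `ℝ^{1+n}`, restricted to an instant of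
time at which the connection is `(A₀, A)` and `∂_t A = V`. Index `0` is time. -/
def curvature (S : GaugeGroup N d) (A₀ : Section' n d) (A V : Form n d) :
    Fin (n + 1) → Fin (n + 1) → Section' n d :=
  Fin.cases (Fin.cases 0 fun j => electric S A₀ A V j)
    fun i => Fin.cases (-electric S A₀ A V i) fun j => magnetic S A i j

/-- The diagonal entries of the Minkowski metric `diag (-1, 1, …, 1)`. -/
def minkowski : Fin (n + 1) → ℝ := Fin.cons (-1) fun _ => 1

/-- The Lagrangian `L = -1/4 ∫_{ℝⁿ} ⟨F_{αβ}, F^{αβ}⟩ dx` at an instant of time. -/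
def lagrangian (S : GaugeGroup N d) (A₀ : Section' n d) (A V : Form n d) : ℝ :=
  -(1 / 4) * ∫ x, ∑ α, ∑ β, minkowski α * minkowski β *
    inner ℝ (curvature S A₀ A V α β x) (curvature S A₀ A V α β x)

/-- The velocity `∂_t A` at time `t`. -/
def velocity (A : ℝ → Form n d) (t : ℝ) : Form n d := fun i x => deriv (fun τ => A τ i x) t

/-- The Yang-Mills action `I = -1/4 ∫ ⟨F_{αβ}, F^{αβ}⟩` of a connection `(A₀, A)` over `J × ℝⁿ`. -/
def ymAction (S : GaugeGroup N d) (J : Set ℝ) (A₀ : ℝ → Section' n d) (A : ℝ → Form n d) : ℝ :=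
  ∫ t in J, lagrangian S (A₀ t) (A t) (velocity A t)

/-- The potential energy `1/4 ∫ F_{ij} F_{ij}`. -/
def potential (S : GaugeGroup N d) (A : Form n d) : ℝ :=
  (1 / 4) * ∫ x, ∑ i, ∑ j, inner ℝ (magnetic S A i j x) (magnetic S A i j x)

/-- The kinetic energy `1/2 ∫ F_{0i} F_{0i}`. -/
def kinetic (S : GaugeGroup N d) (A₀ : Section' n d) (A V : Form n d) : ℝ :=
  (1 / 2) * ∫ x, ∑ i, inner ℝ (electric S A₀ A V i x) (electric S A₀ A V i x)

/-! ### The gauge-covariant Laplacian and the Gauss law -/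

/-- The covariant derivative `∂_i u + [A_i, u]`, with a weak derivative. -/
def covD (S : GaugeGroup N d) (A : Form n d) (u : Section' n d) : Form n d :=
  fun i x => weakDeriv i u x + S.br (A i x) (u x)

/-- The covariant derivative `∂_i ψ + [A_i, ψ]` of a `C¹` function. -/
def covDC (S : GaugeGroup N d) (A : Form n d) (ψ : Section' n d) : Form n d :=
  fun i x => fderiv ℝ ψ x (e i) + S.br (A i x) (ψ x)

/-- The energy space of `Δ_A`: the functional completion of the compactly supported functions in the
norm `‖D_A u‖_{L²}`. Its elements are the functions `u`, weakly differentiable and locally square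
integrable, that are limits in `L²_loc` of compactly supported `ψ_k` with `D_A ψ_k → D_A u`
in `L²(ℝⁿ)`. -/
def FiniteEnergy (S : GaugeGroup N d) (A : Form n d) (u : Section' n d) : Prop :=
  (∀ r : ℝ, MemLp u 2 (volume.restrict (Metric.ball 0 r))) ∧
  (∀ i, ∃ v, HasWeakDeriv i u v) ∧
  ∃ ψ : ℕ → Section' n d, (∀ k, IsTest (ψ k)) ∧
    (∀ r : ℝ, Tendsto (fun k => eLpNorm (fun x => ψ k x - u x) 2
      (volume.restrict (Metric.ball 0 r))) atTop (𝓝 0)) ∧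
    ∀ i, Tendsto (fun k => eLpNorm (fun x => covDC S A (ψ k) i x - covD S A u i x) 2 volume)
      atTop (𝓝 0)

/-- `A₀` solves the Gauss law `∑_i D_i F_{0i} = 0` (weakly, in the energy space), for the connection
`A` and the velocity `V = ∂_t A`. -/
def SolvesGauss (S : GaugeGroup N d) (A V : Form n d) (A₀ : Section' n d) : Prop :=
  FiniteEnergy S A A₀ ∧
    ∀ ψ : Section' n d, IsTest ψ →
      ∑ i, ∫ x, inner ℝ (electric S A₀ A V i x) (covDC S A ψ i x) = 0

/-- `u = Δ_A⁻¹ h`, where `Δ_A = ∑_i D_i D_i`: `u` lies in the energy space and `Δ_A u = h`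
weakly. -/
def IsInvLap (S : GaugeGroup N d) (A : Form n d) (h u : Section' n d) : Prop :=
  FiniteEnergy S A u ∧
    ∀ ψ : Section' n d, IsTest ψ →
      ∑ i, ∫ x, inner ℝ (covD S A u i x) (covDC S A ψ i x) = -∫ x, inner ℝ (h x) (ψ x)

/-- The function `f^{RUQ} A_j^U Y_j^Q`, that is `∑_j [A_j, Y_j]`. -/
def source (S : GaugeGroup N d) (A Y : Form n d) : Section' n d :=
  fun x => WithLp.toLp 2 fun R => ∑ j, ∑ U, ∑ Q, S.f R U Q * A j x U * Y j x Q

/-- The function `x ↦ ∫ K(x,x') h(x') dx'` for a matrix-valued kernel `K`. -/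
def applyKernel (K : Sp n → Sp n → Matrix (Fin d) (Fin d) ℝ) (h : Section' n d) : Section' n d :=
  fun x => WithLp.toLp 2 fun R => ∫ x', ∑ Q, K x x' R Q * h x' Q

/-- `K(x,x')` is an integral kernel `Δ_A⁻¹(x,x')` for `Δ_A⁻¹`, at least on the functions
`∑_j [A_j, Y_j]` with `Y` tangent to the Coulomb slice. -/
def IsInvLapKernel (S : GaugeGroup N d) (s : ℝ) (A : Form n d)
    (K : Sp n → Sp n → Matrix (Fin d) (Fin d) ℝ) : Prop :=
  ∀ Y : Form n d, InHs s Y → IsCoulomb Y →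
    (∀ᵐ x, ∀ R, Integrable fun x' => ∑ Q, K x x' R Q * source S A Y x' Q) ∧
    IsInvLap S A (source S A Y) (applyKernel K (source S A Y))

/-! ### The metric on the orbit space -/

/-- The kinetic energy of the velocity `V` at `A` after elimination of `A₀` by the Gauss law. -/
def reducedKinetic (S : GaugeGroup N d) (A V : Form n d) : ℝ :=
  open Classical in if h : ∃ A₀, SolvesGauss S A V A₀ then kinetic S h.choose A V else 0

/-- The metric induced by the action: the polarisation of twice the reduced kinetic energy. -/
def inducedMetric (S : GaugeGroup N d) (A X Y : Form n d) : ℝ :=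
  reducedKinetic S A (X + Y) - reducedKinetic S A X - reducedKinetic S A Y

/-- A gauge transformation: a `C¹` map from space to `G`. -/
def IsGaugeTransf (S : GaugeGroup N d) (φ : Sp n → Matrix (Fin N) (Fin N) ℂ) : Prop :=
  (∀ x, ∃ g ∈ S.G, (g : Matrix (Fin N) (Fin N) ℂ) = φ x) ∧
    ∀ a b, ContDiff ℝ 1 fun x => φ x a b

/-- The entrywise partial derivative of a matrix-valued function. -/
def matDeriv (i : Fin n) (M : Sp n → Matrix (Fin N) (Fin N) ℂ) (x : Sp n) :
    Matrix (Fin N) (Fin N) ℂ :=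
  Matrix.of fun a b => fderiv ℝ (fun y => M y a b) x (e i)

/-- `A' = φ A φ⁻¹ + φ d φ⁻¹`. -/
def IsTransform (S : GaugeGroup N d) (φ : Sp n → Matrix (Fin N) (Fin N) ℂ) (A A' : Form n d) :
    Prop :=
  ∀ i, ∀ᵐ x, S.toMat (A' i x) =
    φ x * S.toMat (A i x) * (φ x)⁻¹ + φ x * matDeriv i (fun y => (φ y)⁻¹) x

/-- `X' = φ X φ⁻¹`, the action of `φ` on tangent vectors. -/
def IsTangentTransform (S : GaugeGroup N d) (φ : Sp n → Matrix (Fin N) (Fin N) ℂ)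
    (X X' : Form n d) : Prop :=
  ∀ i, ∀ᵐ x, S.toMat (X' i x) = φ x * S.toMat (X i x) * (φ x)⁻¹

/-- The Kronecker symbol. -/
def delta {m : ℕ} (i j : Fin m) : ℝ := if i = j then 1 else 0

end YM

end

/-! The Gauss law is a statement about orthogonal projection. Since `[A₀, A_j] = -[A_j, A₀]`, the
electric field is `V - D A₀`. The Gauss law says that it is orthogonal in `L²` to `Dψ` for all test
functions `ψ`, while the energy space is made so that `D A₀` lies in the closure of these `Dψ`.
Hence `D A₀ = P V`, with `P` the orthogonal projection onto that closure (`solvesGauss_iff`). The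
kinetic energy is then `1/2 ‖(1 - P) V‖²`, whichever solution is taken, and where the Gauss law is
solvable the metric is `⟨(1 - P) X, (1 - P) Y⟩ = ⟨X, Y⟩ - ⟨X, D v⟩`, with `v` a solution for `Y`.

Part 1 follows: `Dξ` lies in the range of `P`, and the adjoint action of a gauge transformation is a
pointwise isometry that intertwines the covariant derivatives (`IsGaugeTransf.exists_solvesGauss`).

In part 2 the point is existence: every element of the closure must be a covariant derivative. This
rests on the coercive bound `‖∇ψ‖² + ‖[A, ψ]‖² ≤ 2 ‖Dψ‖²` (`exists_coercive`), for which the cross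
term `⟨∇ψ, [A, ψ]⟩` must be small compared with `‖∇ψ‖²`. In dimension two `‖∇ψ‖` controls no `L^p`
norm of `ψ`, so the Coulomb condition is used. On the Fourier side the cross term contains `Â(ζ)·η`,
which for divergence free `A` equals `-Â(ζ)·(ζ - η)` up to conjugation, so `|η|` may be replaced by
`min(|η|, |ζ - η|)`. A weighted Cauchy-Schwarz argument using `s > n/2` and `n ≥ 2` then gives
`exists_trilinear_bound`.

A Cauchy sequence `Dψ_k` thus has Cauchy gradients, and `exists_poincare` gives `L²_loc` convergence
once the means over the unit ball converge. The means need not converge, but they lie in a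
finite-dimensional space, so the sequence can be chosen with convergent means
(`exists_seq_of_mem_covClosure`). The limit has the required covariant derivative
(`Coercive.exists_finiteEnergy`).

Finally, a divergence free `X` is orthogonal to gradients, so `⟨X, Dψ⟩ = ⟨X, [A, ψ]⟩`. This turns
the Gauss law into `Δ_A A₀ = [A_i, V_i]` and, after a limit justified by the coercive bound
(`Coercive.tendsto_brLin`), turns `⟨X, D v⟩` into the integral of the kernel formula. -/

namespace YM

variable {N d n : ℕ}

/-! ### The bracket in coordinates and the skewness of the adjoint representation. -/

section Algebra

variable (S : GaugeGroup N d)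

theorem GaugeGroup.br_apply (u v : Alg d) (P : Fin d) :
    S.br u v P = ∑ Q, ∑ R, S.f P Q R * u Q * v R := rfl

/-- The bracket as a continuous bilinear map. -/
noncomputable def GaugeGroup.brL : Alg d →L[ℝ] Alg d →L[ℝ] Alg d :=
  LinearMap.toContinuousBilinearMap <| LinearMap.mk₂ ℝ S.br
    (fun u u' v => by
      ext P
      simp only [GaugeGroup.br_apply, PiLp.add_apply, ← Finset.sum_add_distrib]
      exact Finset.sum_congr rfl fun _ _ => Finset.sum_congr rfl fun _ _ => by ring)
    (fun c u v => by
      ext P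
      simp only [GaugeGroup.br_apply, PiLp.smul_apply, smul_eq_mul, Finset.mul_sum]
      exact Finset.sum_congr rfl fun _ _ => Finset.sum_congr rfl fun _ _ => by ring)
    (fun u v v' => by
      ext P
      simp only [GaugeGroup.br_apply, PiLp.add_apply, ← Finset.sum_add_distrib]
      exact Finset.sum_congr rfl fun _ _ => Finset.sum_congr rfl fun _ _ => by ring)
    (fun c u v => by
      ext P
      simp only [GaugeGroup.br_apply, PiLp.smul_apply, smul_eq_mul, Finset.mul_sum]
      exact Finset.sum_congr rfl fun _ _ => Finset.sum_congr rfl fun _ _ => by ring)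

theorem GaugeGroup.brL_apply (u v : Alg d) : S.brL u v = S.br u v := rfl

/-- Coordinates to matrices, as a linear map. -/
noncomputable def GaugeGroup.matL : Alg d →ₗ[ℝ] Matrix (Fin N) (Fin N) ℂ where
  toFun := S.toMat
  map_add' u v := by simp [GaugeGroup.toMat, add_smul, Finset.sum_add_distrib]
  map_smul' c u := by simp [GaugeGroup.toMat, mul_smul, Finset.smul_sum]

theorem GaugeGroup.matL_apply (u : Alg d) : S.matL u = S.toMat u := rfl

theorem GaugeGroup.matL_injective : Function.Injective S.matL := by
  rw [injective_iff_map_eq_zero]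
  intro u hu
  have := Fintype.linearIndependent_iff.1 S.linearIndependent (fun P => u P) hu
  ext P
  exact this P

theorem GaugeGroup.toMat_br (u v : Alg d) :
    S.toMat (S.br u v) = S.toMat u * S.toMat v - S.toMat v * S.toMat u := by
  simp only [GaugeGroup.toMat, Finset.sum_mul_sum]
  rw [Finset.sum_comm (s := Finset.univ) (t := Finset.univ)
    (f := fun i j => v i • S.T i * u j • S.T j)]
  simp only [← Finset.sum_sub_distrib, GaugeGroup.br_apply, Finset.sum_smul]
  rw [Finset.sum_comm]
  refine Finset.sum_congr rfl fun Q _ => ?_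
  rw [Finset.sum_comm]
  refine Finset.sum_congr rfl fun R _ => ?_
  rw [smul_mul_smul_comm, smul_mul_smul_comm, mul_comm (v R), ← smul_sub, S.commutator,
    Finset.smul_sum]
  refine Finset.sum_congr rfl fun P _ => ?_
  rw [smul_smul]
  congr 1
  ring

/-- Antisymmetry is not imposed on `f`. It is inherited from the matrix commutator, because
coordinates map injectively to matrices. -/
theorem GaugeGroup.br_antisymm (u v : Alg d) : S.br u v = -S.br v u := by
  apply S.matL_injective
  rw [map_neg, S.matL_apply, S.matL_apply, S.toMat_br, S.toMat_br, neg_sub]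

theorem GaugeGroup.range_matL : LinearMap.range S.matL = Submodule.span ℝ (Set.range S.T) := by
  ext X
  rw [Submodule.mem_span_range_iff_exists_fun]
  constructor
  · rintro ⟨u, rfl⟩
    exact ⟨fun P => u P, rfl⟩
  · rintro ⟨c, rfl⟩
    exact ⟨WithLp.toLp 2 c, rfl⟩

theorem GaugeGroup.unitary_inv (g : Matrix.unitaryGroup (Fin N) ℂ) :
    (g : Matrix (Fin N) (Fin N) ℂ)⁻¹ = star (g : Matrix (Fin N) (Fin N) ℂ) :=
  Matrix.inv_eq_left_inv (Unitary.coe_star_mul_self g)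

section
attribute [local instance] Matrix.linftyOpNormedRing Matrix.linftyOpNormedAlgebra

/-- Since `exp (t g X g⁻¹) = g exp (t X) g⁻¹` stays in the group for all `t`, conjugation by `g`
preserves the Lie algebra, which `mem_span_iff` identifies with the span of `T`. -/
theorem GaugeGroup.exists_conj {g : Matrix.unitaryGroup (Fin N) ℂ} (hg : g ∈ S.G) (u : Alg d) :
    ∃ v : Alg d, S.toMat v = (g : Matrix (Fin N) (Fin N) ℂ) * S.toMat u *
      (g : Matrix (Fin N) (Fin N) ℂ)⁻¹ := by
  have hu : S.toMat u ∈ Submodule.span ℝ (Set.range S.T) := by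
    rw [← S.range_matL]; exact ⟨u, rfl⟩
  have : (g : Matrix (Fin N) (Fin N) ℂ) * S.toMat u * (g : Matrix (Fin N) (Fin N) ℂ)⁻¹ ∈
      Submodule.span ℝ (Set.range S.T) := by
    rw [S.mem_span_iff] at hu ⊢
    intro t
    obtain ⟨h, hh, he⟩ := hu t
    refine ⟨g * h * g⁻¹, S.G.mul_mem (S.G.mul_mem hg hh) (S.G.inv_mem hg), ?_⟩
    have hu' : IsUnit (g : Matrix (Fin N) (Fin N) ℂ) :=
      ⟨Unitary.toUnits g, rfl⟩
    rw [← smul_mul_assoc, ← mul_smul_comm, Matrix.exp_conj _ _ hu', ← he,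
      GaugeGroup.unitary_inv]
    rfl
  rw [← S.range_matL] at this
  exact this

/-- Conjugation by `exp (tW)` preserves the length of coordinate vectors. The derivative of the
squared length at `t = 0` is `2 ⟨u, [w, u]⟩`, which must vanish. -/
theorem GaugeGroup.inner_br_self (w u : Alg d) : inner ℝ u (S.br w u) = 0 := by
  obtain ⟨L, hL⟩ := S.matL.exists_leftInverse_of_injective
    (LinearMap.ker_eq_bot.2 S.matL_injective)
  have hL' : ∀ u, L (S.toMat u) = u := fun u => LinearMap.congr_fun hL u
  let Lc : Matrix (Fin N) (Fin N) ℂ →L[ℝ] Alg d := LinearMap.toContinuousLinearMap L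
  -- The left inverse `L` reads off coordinates, and being linear in finite dimension it is
  -- continuous, so the curve of conjugates can be differentiated in coordinates.
  set W := S.toMat w
  set M := S.toMat u
  let γ : ℝ → Matrix (Fin N) (Fin N) ℂ :=
    fun t => NormedSpace.exp (t • W) * M * NormedSpace.exp (t • (-W))
  have hγ : HasDerivAt γ (W * M - M * W) 0 := by
    have h1 := hasDerivAt_exp_smul_const (𝕂 := ℝ) W (0 : ℝ)
    have h2 := hasDerivAt_exp_smul_const (𝕂 := ℝ) (-W) (0 : ℝ)
    exact ((h1.mul_const M).mul h2).congr_deriv (by simp [sub_eq_add_neg])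
  have hv : HasDerivAt (fun t => Lc (γ t)) (S.br w u) 0 := by
    have := Lc.hasFDerivAt.comp_hasDerivAt (0 : ℝ) hγ
    convert! this using 1
    rw [← S.toMat_br]
    exact (hL' _).symm
  have hconst : ∀ t, ‖Lc (γ t)‖ ^ 2 = ‖u‖ ^ 2 := by
    intro t
    have hW : W ∈ Submodule.span ℝ (Set.range S.T) := by
      rw [← S.range_matL]; exact ⟨w, rfl⟩
    obtain ⟨g, hg, he⟩ := (S.mem_span_iff W).1 hW t
    obtain ⟨v, hv⟩ := S.exists_conj hg u
    have h3 : γ t = S.toMat v := by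
      rw [hv, he, ← Matrix.exp_neg, ← smul_neg]
    have h4 : Lc (γ t) = v := by rw [h3]; exact hL' v
    rw [h4, S.ad_invariant g hg u v hv.symm]
  have h5 : HasDerivAt (fun t => ‖Lc (γ t)‖ ^ 2) (2 * inner ℝ (Lc (γ 0)) (S.br w u)) 0 :=
    hv.norm_sq
  have h6 : HasDerivAt (fun t => ‖Lc (γ t)‖ ^ 2) 0 0 := by
    simp_rw [hconst]; exact hasDerivAt_const _ _
  have h7 := h5.unique h6
  have h8 : Lc (γ 0) = u := by
    have : γ 0 = M := by simp [γ]
    rw [this]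
    exact hL' u
  rw [h8] at h7
  linarith

end

/-- Polarisation of `inner_br_self`. This is the only consequence of the invariance of the scalar
product that the Coulomb formulas need. -/
theorem GaugeGroup.inner_br_left (w u v : Alg d) :
    inner ℝ (S.br w u) v = -inner ℝ u (S.br w v) := by
  have h := S.inner_br_self w (u + v)
  have hu := S.inner_br_self w u
  have hv := S.inner_br_self w v
  rw [← S.brL_apply, map_add, inner_add_left, inner_add_right, inner_add_right, S.brL_apply,
    S.brL_apply, hu, hv] at h
  rw [real_inner_comm]
  linarith

end Algebra

/-! ### Integrals of bilinear expressions in square integrable functions. -/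

section Integration

/-- Convergence of bilinear integrals under convergence of one factor in `L²`. -/
theorem tendsto_integral_bilin {α E F G : Type*} [MeasurableSpace α] {μ : Measure α}
    [NormedAddCommGroup E] [NormedSpace ℝ E] [NormedAddCommGroup F] [NormedSpace ℝ F]
    [NormedAddCommGroup G] [NormedSpace ℝ G] [CompleteSpace G] (B : E →L[ℝ] F →L[ℝ] G)
    {f : α → E} (hf : MemLp f 2 μ) {g : ℕ → α → F} (hg : ∀ k, MemLp (g k) 2 μ)
    {g' : α → F} (hg' : MemLp g' 2 μ)
    (h : Tendsto (fun k => eLpNorm (fun x => g k x - g' x) 2 μ) atTop (𝓝 0)) :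
    Tendsto (fun k => ∫ x, B (f x) (g k x) ∂μ) atTop (𝓝 (∫ x, B (f x) (g' x) ∂μ)) := by
  have key : ∀ {w : α → F} (hw : MemLp w 2 μ),
      B.lpPairing μ 2 2 (hf.toLp f) (hw.toLp w) = ∫ x, B (f x) (w x) ∂μ := by
    intro w hw
    rw [ContinuousLinearMap.lpPairing_eq_integral]
    refine integral_congr_ae ?_
    filter_upwards [hf.coeFn_toLp, hw.coeFn_toLp] with x h1 h2
    rw [h1, h2]
  have h1 : Tendsto (fun k => (hg k).toLp (g k)) atTop (𝓝 (hg'.toLp g')) :=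
    (Lp.tendsto_Lp_iff_tendsto_eLpNorm'' _ hg _ hg').2 h
  have h2 := ((B.lpPairing μ 2 2 (hf.toLp f)).continuous.tendsto _).comp h1
  rw [key] at h2
  exact h2.congr fun k => key (hg k)

theorem integrable_bilin {α E F G : Type*} [MeasurableSpace α] {μ : Measure α}
    [NormedAddCommGroup E] [NormedSpace ℝ E] [NormedAddCommGroup F] [NormedSpace ℝ F]
    [NormedAddCommGroup G] [NormedSpace ℝ G] (B : E →L[ℝ] F →L[ℝ] G)
    {f : α → E} (hf : MemLp f 2 μ) {g : α → F} (hg : MemLp g 2 μ) :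
    Integrable (fun x => B (f x) (g x)) μ :=
  memLp_one_iff_integrable.1 (B.memLp_of_bilin 1 hf hg)

theorem integrable_inner {α E : Type*} [MeasurableSpace α] {μ : Measure α}
    [NormedAddCommGroup E] [InnerProductSpace ℝ E]
    {f : α → E} (hf : MemLp f 2 μ) {g : α → E} (hg : MemLp g 2 μ) :
    Integrable (fun x => inner ℝ (f x) (g x)) μ :=
  integrable_bilin (innerSL ℝ) hf hg

theorem locallyIntegrable_of_ball {F : Type*} [NormedAddCommGroup F] {u : Sp n → F}
    (h : ∀ r : ℝ, IntegrableOn u (Metric.ball 0 r)) : LocallyIntegrable u := by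
  intro x
  exact ⟨Metric.ball 0 (‖x‖ + 1), Metric.isOpen_ball.mem_nhds (by simp), h _⟩

theorem integrableOn_ball_of_memLp {F : Type*} [NormedAddCommGroup F] {u : Sp n → F} {r : ℝ}
    (h : MemLp u 2 (volume.restrict (Metric.ball 0 r))) : IntegrableOn u (Metric.ball 0 r) := by
  have : IsFiniteMeasure (volume.restrict (Metric.ball (0 : Sp n) r)) :=
    ⟨by rw [Measure.restrict_apply_univ]; exact measure_ball_lt_top⟩
  exact h.integrable (by norm_num)

theorem exists_ball_of_hasCompactSupport {F : Type*} [NormedAddCommGroup F] {η : Sp n → F}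
    (h : HasCompactSupport η) : ∃ r : ℝ, 0 < r ∧ tsupport η ⊆ Metric.ball 0 r := by
  obtain ⟨r, hr⟩ := h.isCompact.isBounded.subset_ball (0 : Sp n)
  exact ⟨max r 1, by positivity, hr.trans (Metric.ball_subset_ball (le_max_left _ _))⟩

end Integration

/-! ### Test functions and integration by parts. -/

section TestFunctions

variable {V : Type*} [NormedAddCommGroup V] [NormedSpace ℝ V]

theorem IsTest.memLp {ψ : Sp n → V} (h : IsTest ψ) (p : ℝ≥0∞) : MemLp ψ p volume :=
  h.1.continuous.memLp_of_hasCompactSupport h.2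

theorem IsTest.continuous_fderiv {ψ : Sp n → V} (h : IsTest ψ) (v : Sp n) :
    Continuous fun x => fderiv ℝ ψ x v :=
  (h.1.continuous_fderiv (by simp)).clm_apply continuous_const

theorem IsTest.hasCompactSupport_fderiv {ψ : Sp n → V} (h : IsTest ψ) (v : Sp n) :
    HasCompactSupport fun x => fderiv ℝ ψ x v :=
  h.2.fderiv_apply (𝕜 := ℝ) v

theorem IsTest.memLp_fderiv {ψ : Sp n → V} (h : IsTest ψ) (v : Sp n) (p : ℝ≥0∞) :
    MemLp (fun x => fderiv ℝ ψ x v) p volume :=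
  (h.continuous_fderiv v).memLp_of_hasCompactSupport (h.hasCompactSupport_fderiv v)

theorem IsTest.add {ψ ψ' : Sp n → V} (h : IsTest ψ) (h' : IsTest ψ') : IsTest (ψ + ψ') :=
  ⟨h.1.add h'.1, h.2.add h'.2⟩

theorem IsTest.const_smul {ψ : Sp n → V} (c : ℝ) (h : IsTest ψ) : IsTest (c • ψ) :=
  ⟨h.1.const_smul c, HasCompactSupport.smul_left (f := fun _ => c) h.2⟩

theorem IsTest.zero : IsTest (0 : Sp n → V) :=
  ⟨contDiff_const, HasCompactSupport.zero⟩

theorem IsTest.clm {W : Type*} [NormedAddCommGroup W] [NormedSpace ℝ W] (L : V →L[ℝ] W)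
    {ψ : Sp n → V} (h : IsTest ψ) : IsTest (fun x => L (ψ x)) :=
  ⟨L.contDiff.comp h.1, h.2.comp_left (map_zero L)⟩

theorem integral_smul_fderiv_eq_neg {η : Sp n → ℝ} (hη : IsTest η) {ψ : Sp n → V}
    (hψ : ContDiff ℝ 1 ψ) (v : Sp n) :
    ∫ x, fderiv ℝ η x v • ψ x = -∫ x, η x • fderiv ℝ ψ x v := by
  have hc : Continuous fun x => fderiv ℝ ψ x v :=
    (hψ.continuous_fderiv (by simp)).clm_apply continuous_const
  rw [integral_smul_fderiv_eq_neg_fderiv_smul_of_integrable, neg_neg]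
  · exact ((hη.continuous_fderiv v).smul hψ.continuous).integrable_of_hasCompactSupport
      (hη.hasCompactSupport_fderiv v).smul_right
  · exact (hη.1.continuous.smul hc).integrable_of_hasCompactSupport hη.2.smul_right
  · exact (hη.1.continuous.smul hψ.continuous).integrable_of_hasCompactSupport hη.2.smul_right
  · exact fun x _ => hη.1.differentiable (by simp) x
  · exact fun x _ => hψ.differentiable (by simp) x

end TestFunctions

/-! ### Weak derivatives: uniqueness and linearity. -/

section WeakDeriv

theorem integrable_test_smul {η : Sp n → ℝ} (hc : Continuous η) (hs : HasCompactSupport η)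
    {u : Section' n d} (hu : LocallyIntegrable u) : Integrable fun x => η x • u x :=
  hu.integrable_smul_left_of_hasCompactSupport hc hs

theorem HasWeakDeriv.unique {i : Fin n} {u u' v v' : Section' n d} (h : HasWeakDeriv i u v)
    (h' : HasWeakDeriv i u' v') (hu : u =ᵐ[volume] u') : v =ᵐ[volume] v' := by
  refine ae_eq_of_integral_contDiff_smul_eq h.2.1 h'.2.1 fun g hg hs => ?_
  have ht : IsTest g := ⟨hg.of_le (by simp), hs⟩
  have h1 := h.2.2 g ht
  have h2 := h'.2.2 g ht
  have : ∫ x, (fderiv ℝ g x (e i)) • u x = ∫ x, (fderiv ℝ g x (e i)) • u' x :=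
    integral_congr_ae (by filter_upwards [hu] with x hx; rw [hx])
  rw [this, h2] at h1
  exact (neg_injective h1).symm

theorem hasWeakDeriv_weakDeriv {i : Fin n} {u : Section' n d} (h : ∃ v, HasWeakDeriv i u v) :
    HasWeakDeriv i u (weakDeriv i u) := by
  rw [weakDeriv, dif_pos h]
  exact h.choose_spec

theorem HasWeakDeriv.weakDeriv_ae {i : Fin n} {u v : Section' n d} (h : HasWeakDeriv i u v) :
    weakDeriv i u =ᵐ[volume] v :=
  (hasWeakDeriv_weakDeriv ⟨v, h⟩).unique h EventuallyEq.rfl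

theorem HasWeakDeriv.add {i : Fin n} {u u' v v' : Section' n d} (h : HasWeakDeriv i u v)
    (h' : HasWeakDeriv i u' v') : HasWeakDeriv i (u + u') (v + v') := by
  refine ⟨h.1.add h'.1, h.2.1.add h'.2.1, fun ψ hψ => ?_⟩
  have h1 := h.2.2 ψ hψ
  have h2 := h'.2.2 ψ hψ
  simp only [Pi.add_apply, smul_add]
  rw [integral_add (integrable_test_smul (hψ.continuous_fderiv _) (hψ.hasCompactSupport_fderiv _)
    h.1) (integrable_test_smul (hψ.continuous_fderiv _) (hψ.hasCompactSupport_fderiv _) h'.1),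
    integral_add (integrable_test_smul hψ.1.continuous hψ.2 h.2.1)
      (integrable_test_smul hψ.1.continuous hψ.2 h'.2.1), h1, h2, neg_add]

theorem HasWeakDeriv.const_smul {i : Fin n} {u v : Section' n d} (c : ℝ)
    (h : HasWeakDeriv i u v) : HasWeakDeriv i (c • u) (c • v) := by
  refine ⟨h.1.smul c, h.2.1.smul c, fun ψ hψ => ?_⟩
  have h1 := h.2.2 ψ hψ
  simp only [Pi.smul_apply]
  simp_rw [smul_comm _ c, integral_smul, h1, smul_neg]

end WeakDeriv

/-! ### The Hilbert space of square integrable one-forms. -/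

section FormSpace

/-- Square integrable one-forms. -/
def FormL2 (X : Form n d) : Prop := ∀ i, MemLp (X i) 2 volume

/-- The Hilbert space of square integrable one-forms. -/
abbrev FormH (n d : ℕ) := PiLp 2 fun _ : Fin n => Lp (Alg d) 2 (volume : Measure (Sp n))

theorem InHs.formL2 {s : ℝ} {X : Form n d} (h : InHs s X) : FormL2 X := by
  intro i
  refine MemLp.of_eval_piLp fun P => ?_
  have h1 := h i P
  unfold sobolevNorm at h1
  split_ifs at h1 with h2
  · simpa using h2.re
  · exact absurd h1 (lt_irrefl _)

theorem FormL2.add {X Y : Form n d} (hX : FormL2 X) (hY : FormL2 Y) : FormL2 (X + Y) :=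
  fun i => (hX i).add (hY i)

theorem FormL2.sub {X Y : Form n d} (hX : FormL2 X) (hY : FormL2 Y) : FormL2 (X - Y) :=
  fun i => (hX i).sub (hY i)

theorem FormL2.const_smul {X : Form n d} (c : ℝ) (hX : FormL2 X) : FormL2 (c • X) :=
  fun i => (hX i).const_smul c

/-- The element of the Hilbert space defined by a square integrable one-form. -/
noncomputable def toH (X : Form n d) (hX : FormL2 X) : FormH n d :=
  WithLp.toLp 2 fun i => (hX i).toLp (X i)

theorem toH_add {X Y : Form n d} (hX : FormL2 X) (hY : FormL2 Y) :
    toH (X + Y) (hX.add hY) = toH X hX + toH Y hY := by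
  ext1 i
  exact MemLp.toLp_add (hX i) (hY i)

theorem toH_sub {X Y : Form n d} (hX : FormL2 X) (hY : FormL2 Y) :
    toH (X - Y) (hX.sub hY) = toH X hX - toH Y hY := by
  ext1 i
  exact MemLp.toLp_sub (hX i) (hY i)

theorem toH_const_smul {X : Form n d} (c : ℝ) (hX : FormL2 X) :
    toH (c • X) (hX.const_smul c) = c • toH X hX := by
  ext1 i
  exact MemLp.toLp_const_smul c (hX i)

theorem toH_eq_iff {X Y : Form n d} (hX : FormL2 X) (hY : FormL2 Y) :
    toH X hX = toH Y hY ↔ ∀ i, X i =ᵐ[volume] Y i := by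
  constructor
  · intro h i
    have : (hX i).toLp (X i) = (hY i).toLp (Y i) := congrArg (fun Z : FormH n d => Z i) h
    exact (MemLp.toLp_eq_toLp_iff _ _).1 this
  · intro h
    ext1 i
    exact (MemLp.toLp_eq_toLp_iff (hX i) (hY i)).2 (h i)

theorem inner_toH {X Y : Form n d} (hX : FormL2 X) (hY : FormL2 Y) :
    inner ℝ (toH X hX) (toH Y hY) = ∑ i, ∫ x, inner ℝ (X i x) (Y i x) := by
  rw [PiLp.inner_apply]
  refine Finset.sum_congr rfl fun i _ => ?_
  rw [L2.inner_def]
  refine integral_congr_ae ?_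
  filter_upwards [(hX i).coeFn_toLp, (hY i).coeFn_toLp] with x h1 h2
  change inner ℝ ((hX i).toLp (X i) x) ((hY i).toLp (Y i) x) = _
  rw [h1, h2]

theorem tendsto_toH {X : ℕ → Form n d} (hX : ∀ k, FormL2 (X k)) {Y : Form n d} (hY : FormL2 Y)
    (h : ∀ i, Tendsto (fun k => eLpNorm (fun x => X k i x - Y i x) 2 volume) atTop (𝓝 0)) :
    Tendsto (fun k => toH (X k) (hX k)) atTop (𝓝 (toH Y hY)) := by
  refine ((PiLp.continuous_toLp 2 _).tendsto _).comp (tendsto_pi_nhds.2 fun i => ?_)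
  exact (Lp.tendsto_Lp_iff_tendsto_eLpNorm'' _ (fun k => hX k i) _ (hY i)).2 (h i)

end FormSpace

/-! ### The energy space is a vector space with square integrable covariant derivatives. -/

section EnergySpace

variable (S : GaugeGroup N d) {A : Form n d}

theorem memLp_br {α : Type*} [MeasurableSpace α] {μ : Measure α} {f g : α → Alg d}
    {p q r : ℝ≥0∞} [p.HolderTriple q r] (hf : MemLp f p μ) (hg : MemLp g q μ) :
    MemLp (fun x => S.br (f x) (g x)) r μ :=
  S.brL.memLp_of_bilin r hf hg

theorem FormL2.covDC (hA : FormL2 A) {ψ : Section' n d} (hψ : IsTest ψ) :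
    FormL2 (covDC S A ψ) :=
  fun i => (hψ.memLp_fderiv (e i) 2).add (memLp_br S (hA i) (hψ.memLp ⊤))

variable {S}

theorem FiniteEnergy.locallyIntegrable {u : Section' n d} (hu : FiniteEnergy S A u) :
    LocallyIntegrable u :=
  locallyIntegrable_of_ball fun r => integrableOn_ball_of_memLp (hu.1 r)

theorem FiniteEnergy.covD (hA : FormL2 A) {u : Section' n d} (hu : FiniteEnergy S A u) :
    FormL2 (covD S A u) := by
  intro i
  obtain ⟨ψ, hψ, -, h⟩ := hu.2.2
  have hm : AEStronglyMeasurable (YM.covD S A u i) volume := by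
    have h1 := (hasWeakDeriv_weakDeriv (hu.2.1 i)).2.1.aestronglyMeasurable
    exact h1.add (S.brL.aestronglyMeasurable_comp₂ (hA i).1
      hu.locallyIntegrable.aestronglyMeasurable)
  -- One approximant at finite distance is enough: `Du = Dψ_k - (Dψ_k - Du)`, where both terms are
  -- square integrable.
  obtain ⟨k, hk⟩ := ((h i).eventually (gt_mem_nhds zero_lt_one)).exists
  have h2 : MemLp (fun x => YM.covDC S A (ψ k) i x - YM.covD S A u i x) 2 volume :=
    ⟨(hA.covDC S (hψ k) i).1.sub hm, hk.trans ENNReal.one_lt_top⟩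
  have := (hA.covDC S (hψ k) i).sub h2
  refine this.ae_eq (Eventually.of_forall fun x => ?_)
  simp

theorem FiniteEnergy.add (hA : FormL2 A) {u v : Section' n d} (hu : FiniteEnergy S A u)
    (hv : FiniteEnergy S A v) :
    FiniteEnergy S A (u + v) ∧ ∀ i, YM.covD S A (u + v) i =ᵐ[volume]
      (YM.covD S A u + YM.covD S A v) i := by
  have hd : ∀ i, YM.covD S A (u + v) i =ᵐ[volume] (YM.covD S A u + YM.covD S A v) i := by
    intro i
    have := ((hasWeakDeriv_weakDeriv (hu.2.1 i)).add
      (hasWeakDeriv_weakDeriv (hv.2.1 i))).weakDeriv_ae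
    filter_upwards [this] with x hx
    simp only [YM.covD, Pi.add_apply, hx, ← S.brL_apply, map_add]
    abel
  refine ⟨⟨fun r => (hu.1 r).add (hv.1 r), fun i => ⟨_, (hasWeakDeriv_weakDeriv (hu.2.1 i)).add
      (hasWeakDeriv_weakDeriv (hv.2.1 i))⟩, ?_⟩, hd⟩
  obtain ⟨ψ, hψ, h1, h2⟩ := hu.2.2
  obtain ⟨χ, hχ, h3, h4⟩ := hv.2.2
  refine ⟨fun k => ψ k + χ k, fun k => (hψ k).add (hχ k), fun r => ?_, fun i => ?_⟩
  · refine tendsto_of_tendsto_of_tendsto_of_le_of_le tendsto_const_nhds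
      (by simpa using (h1 r).add (h3 r)) (fun k => zero_le) fun k => ?_
    refine le_trans (le_of_eq ?_) (eLpNorm_add_le (((hψ k).memLp 2).restrict _ |>.sub (hu.1 r)).1
      (((hχ k).memLp 2).restrict _ |>.sub (hv.1 r)).1 (by norm_num))
    congr 1
    ext1 x
    simp only [Pi.add_apply]
    abel
  · refine tendsto_of_tendsto_of_tendsto_of_le_of_le tendsto_const_nhds
      (by simpa using (h2 i).add (h4 i)) (fun k => zero_le) fun k => ?_
    refine le_trans (le_of_eq ?_) (eLpNorm_add_le ((hA.covDC S (hψ k) i).sub (hu.covD hA i)).1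
      ((hA.covDC S (hχ k) i).sub (hv.covD hA i)).1 (by norm_num))
    refine eLpNorm_congr_ae ?_
    filter_upwards [hd i] with x hx
    have h5 : fderiv ℝ (ψ k + χ k) x = fderiv ℝ (ψ k) x + fderiv ℝ (χ k) x :=
      fderiv_add ((hψ k).1.differentiable (by simp) x) ((hχ k).1.differentiable (by simp) x)
    rw [hx]
    simp only [YM.covDC, Pi.add_apply, h5, ← S.brL_apply, map_add,
      add_apply]
    abel

theorem FiniteEnergy.const_smul {u : Section' n d} (c : ℝ) (hu : FiniteEnergy S A u) :
    FiniteEnergy S A (c • u) ∧ ∀ i, YM.covD S A (c • u) i =ᵐ[volume]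
      (c • YM.covD S A u) i := by
  have hd : ∀ i, YM.covD S A (c • u) i =ᵐ[volume] (c • YM.covD S A u) i := by
    intro i
    have := ((hasWeakDeriv_weakDeriv (hu.2.1 i)).const_smul c).weakDeriv_ae
    filter_upwards [this] with x hx
    simp only [YM.covD, Pi.smul_apply, hx, ← S.brL_apply, map_smul, smul_add]
  refine ⟨⟨fun r => (hu.1 r).const_smul c,
    fun i => ⟨_, (hasWeakDeriv_weakDeriv (hu.2.1 i)).const_smul c⟩, ?_⟩, hd⟩
  obtain ⟨ψ, hψ, h1, h2⟩ := hu.2.2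
  have hc : ∀ {f : ℕ → ℝ≥0∞}, Tendsto f atTop (𝓝 0) →
      Tendsto (fun k => ‖c‖ₑ * f k) atTop (𝓝 0) := by
    intro f hf
    simpa using ENNReal.Tendsto.const_mul hf (Or.inr enorm_ne_top)
  refine ⟨fun k => c • ψ k, fun k => (hψ k).const_smul c, fun r => ?_, fun i => ?_⟩
  · refine (hc (h1 r)).congr fun k => ?_
    rw [← eLpNorm_const_smul]
    congr 1
    ext1 x
    simp only [Pi.smul_apply, smul_sub]
  · refine (hc (h2 i)).congr fun k => ?_
    rw [← eLpNorm_const_smul]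
    refine eLpNorm_congr_ae ?_
    filter_upwards [hd i] with x hx
    have h5 : fderiv ℝ (c • ψ k) x = c • fderiv ℝ (ψ k) x :=
      fderiv_const_smul ((hψ k).1.differentiable (by simp) x) c
    rw [hx]
    simp only [YM.covDC, Pi.smul_apply, h5, ← S.brL_apply, map_smul, smul_sub, smul_add,
      smul_apply]

end EnergySpace

/-! ### The Gauss law as an orthogonal projection, and the induced metric. -/

section Projection

variable (S : GaugeGroup N d) {A : Form n d}

/-- The space of test functions. -/
def testSpace (n d : ℕ) : Submodule ℝ (Section' n d) where
  carrier := {ψ | IsTest ψ}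
  add_mem' := IsTest.add
  zero_mem' := IsTest.zero
  smul_mem' := fun c _ h => h.const_smul c

/-- The covariant derivative of test functions as a linear map into the Hilbert space of forms. -/
noncomputable def covLin (hA : FormL2 A) : testSpace n d →ₗ[ℝ] FormH n d where
  toFun ψ := toH (covDC S A ψ) (hA.covDC S ψ.2)
  map_add' ψ χ := by
    rw [← toH_add, toH_eq_iff]
    refine fun i => Eventually.of_forall fun x => ?_
    have h5 : fderiv ℝ ((ψ : Section' n d) + (χ : Section' n d)) x =
        fderiv ℝ (ψ : Section' n d) x + fderiv ℝ (χ : Section' n d) x :=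
      fderiv_add (ψ.2.1.differentiable (by simp) x) (χ.2.1.differentiable (by simp) x)
    simp only [covDC, Submodule.coe_add, Pi.add_apply, h5, ← S.brL_apply, map_add,
      add_apply]
    abel
  map_smul' c ψ := by
    rw [RingHom.id_apply, ← toH_const_smul, toH_eq_iff]
    refine fun i => Eventually.of_forall fun x => ?_
    have h5 : fderiv ℝ (c • (ψ : Section' n d)) x = c • fderiv ℝ (ψ : Section' n d) x :=
      fderiv_const_smul (ψ.2.1.differentiable (by simp) x) c
    simp only [covDC, Submodule.coe_smul, Pi.smul_apply, h5, ← S.brL_apply, map_smul, smul_add,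
      smul_apply]

/-- The closure of the space of covariant derivatives of test functions. -/
noncomputable def covClosure (hA : FormL2 A) : Submodule ℝ (FormH n d) :=
  (LinearMap.range (covLin S hA)).topologicalClosure

noncomputable instance (hA : FormL2 A) : (covClosure S hA).HasOrthogonalProjection :=
  haveI : CompleteSpace (covClosure S hA) :=
    (Submodule.isClosed_topologicalClosure _).completeSpace_coe
  inferInstance

variable {S}

theorem FiniteEnergy.mem_covClosure (hA : FormL2 A) {u : Section' n d}
    (hu : FiniteEnergy S A u) : toH (YM.covD S A u) (hu.covD hA) ∈ covClosure S hA := by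
  obtain ⟨ψ, hψ, -, h⟩ := hu.2.2
  refine mem_closure_of_tendsto
    (tendsto_toH (fun k => hA.covDC S (hψ k)) (hu.covD hA) h) (Eventually.of_forall fun k => ?_)
  exact ⟨⟨ψ k, hψ k⟩, rfl⟩

/-- Orthogonality to a closed span need only be tested on the spanning vectors, so the orthogonal
complement is the set of weak solutions of `D_i X_i = 0`. -/
theorem mem_orthogonal_covClosure_iff (hA : FormL2 A) {X : Form n d} (hX : FormL2 X) :
    toH X hX ∈ (covClosure S hA)ᗮ ↔
      ∀ ψ : Section' n d, IsTest ψ → ∑ i, ∫ x, inner ℝ (X i x) (covDC S A ψ i x) = 0 := by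
  rw [covClosure, Submodule.orthogonal_closure, Submodule.mem_orthogonal']
  constructor
  · intro h ψ hψ
    rw [← inner_toH hX (hA.covDC S hψ)]
    exact h _ ⟨⟨ψ, hψ⟩, rfl⟩
  · rintro h _ ⟨ψ, rfl⟩
    exact (inner_toH hX (hA.covDC S ψ.2)).trans (h ψ ψ.2)

theorem electric_eq (A₀ : Section' n d) (A V : Form n d) :
    electric S A₀ A V = V - covD S A A₀ := by
  funext j x
  simp only [electric, covD, Pi.sub_apply, S.br_antisymm (A₀ x)]
  abel

/-- The two characteristic properties of the projection of `V` are membership in the closure, which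
the energy space provides, and orthogonality of the remainder, which is the Gauss law. This reduces
everything about solutions to Hilbert space geometry. -/
theorem solvesGauss_iff (hA : FormL2 A) {V : Form n d} (hV : FormL2 V) {u : Section' n d}
    (hu : FiniteEnergy S A u) : SolvesGauss S A V u ↔
      toH (covD S A u) (hu.covD hA) = (covClosure S hA).starProjection (toH V hV) := by
  have h1 : SolvesGauss S A V u ↔
      toH V hV - toH (covD S A u) (hu.covD hA) ∈ (covClosure S hA)ᗮ := by
    rw [← toH_sub, mem_orthogonal_covClosure_iff, SolvesGauss, electric_eq]
    exact and_iff_right hu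
  rw [h1]
  constructor
  · intro h
    exact (Submodule.eq_starProjection_of_mem_orthogonal (hu.mem_covClosure hA) h).symm
  · intro h
    rw [h]
    exact Submodule.sub_starProjection_mem_orthogonal _

theorem kinetic_eq {A₀ : Section' n d} {V : Form n d} (hE : FormL2 (V - covD S A A₀)) :
    kinetic S A₀ A V = 1 / 2 * ‖toH (V - covD S A A₀) hE‖ ^ 2 := by
  rw [← real_inner_self_eq_norm_sq, inner_toH, kinetic, electric_eq, integral_finsetSum]
  exact fun i _ => integrable_inner (hE i) (hE i)

theorem SolvesGauss.kinetic_eq (hA : FormL2 A) {V : Form n d} (hV : FormL2 V) {u : Section' n d}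
    (hu : SolvesGauss S A V u) : kinetic S u A V =
      1 / 2 * ‖toH V hV - (covClosure S hA).starProjection (toH V hV)‖ ^ 2 := by
  rw [YM.kinetic_eq (hV.sub (hu.1.covD hA)), toH_sub hV (hu.1.covD hA),
    (solvesGauss_iff hA hV hu.1).1 hu]

/-- The solution picked by choice in the definition is harmless, since the energy depends only on
the projection of `V`. -/
theorem SolvesGauss.reducedKinetic_eq (hA : FormL2 A) {V : Form n d} (hV : FormL2 V)
    {u : Section' n d} (hu : SolvesGauss S A V u) : reducedKinetic S A V =
      1 / 2 * ‖toH V hV - (covClosure S hA).starProjection (toH V hV)‖ ^ 2 := by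
  have h : ∃ A₀, SolvesGauss S A V A₀ := ⟨u, hu⟩
  rw [reducedKinetic, dif_pos h]
  exact h.choose_spec.kinetic_eq hA hV

theorem SolvesGauss.kinetic_eq_reducedKinetic (hA : FormL2 A) {V : Form n d} (hV : FormL2 V)
    {u : Section' n d} (hu : SolvesGauss S A V u) : kinetic S u A V = reducedKinetic S A V := by
  rw [hu.kinetic_eq hA hV, hu.reducedKinetic_eq hA hV]

theorem SolvesGauss.covD_unique (hA : FormL2 A) {V : Form n d} (hV : FormL2 V)
    {u v : Section' n d} (hu : SolvesGauss S A V u) (hv : SolvesGauss S A V v) (i : Fin n) :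
    covD S A u i =ᵐ[volume] covD S A v i := by
  refine (toH_eq_iff (hu.1.covD hA) (hv.1.covD hA)).1 ?_ i
  rw [(solvesGauss_iff hA hV hu.1).1 hu, (solvesGauss_iff hA hV hv.1).1 hv]

theorem SolvesGauss.add (hA : FormL2 A) {V W : Form n d} (hV : FormL2 V) (hW : FormL2 W)
    {u v : Section' n d} (hu : SolvesGauss S A V u) (hv : SolvesGauss S A W v) :
    SolvesGauss S A (V + W) (u + v) := by
  obtain ⟨h1, h2⟩ := hu.1.add hA hv.1
  rw [solvesGauss_iff hA (hV.add hW) h1, toH_add hV hW, map_add, ← (solvesGauss_iff hA hV hu.1).1 hu,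
    ← (solvesGauss_iff hA hW hv.1).1 hv, ← toH_add, toH_eq_iff]
  exact h2

theorem SolvesGauss.const_smul (hA : FormL2 A) {V : Form n d} (hV : FormL2 V) (c : ℝ)
    {u : Section' n d} (hu : SolvesGauss S A V u) : SolvesGauss S A (c • V) (c • u) := by
  obtain ⟨h1, h2⟩ := hu.1.const_smul c
  rw [solvesGauss_iff hA (hV.const_smul c) h1, toH_const_smul c hV, map_smul,
    ← (solvesGauss_iff hA hV hu.1).1 hu, ← toH_const_smul, toH_eq_iff]
  exact h2

theorem FiniteEnergy.solvesGauss_covD (hA : FormL2 A) {ξ : Section' n d}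
    (hξ : FiniteEnergy S A ξ) : SolvesGauss S A (YM.covD S A ξ) ξ := by
  rw [solvesGauss_iff hA (hξ.covD hA) hξ]
  exact (Submodule.starProjection_eq_self_iff.2 (hξ.mem_covClosure hA)).symm

/-- The projection fixes `Dξ`, so `(1 - P)` annihilates it. No smallness of `A` is assumed, so
solvability of the Gauss law is not known here and must be shown to be the same for both velocities.
-/
theorem reducedKinetic_add_covD (hA : FormL2 A) {V : Form n d} (hV : FormL2 V)
    {ξ : Section' n d} (hξ : FiniteEnergy S A ξ) :
    reducedKinetic S A (V + covD S A ξ) = reducedKinetic S A V := by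
  have hD := hξ.covD hA
  by_cases h : ∃ u, SolvesGauss S A V u
  · obtain ⟨u, hu⟩ := h
    rw [hu.reducedKinetic_eq hA hV,
      (hu.add hA hV hD (hξ.solvesGauss_covD hA)).reducedKinetic_eq hA (hV.add hD), toH_add hV hD,
      map_add, Submodule.starProjection_eq_self_iff.2 (hξ.mem_covClosure hA),
      add_sub_add_right_eq_sub]
  -- Subtracting `ξ` from a solution for `V + Dξ` would give one for `V`. Hence neither exists and
  -- both energies take the default value `0`.
  · have h' : ¬ ∃ u, SolvesGauss S A (V + covD S A ξ) u := by
      rintro ⟨u, hu⟩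
      refine h ⟨u + (-1 : ℝ) • ξ, ?_⟩
      have := hu.add hA (hV.add hD) (hD.const_smul (-1))
        ((hξ.solvesGauss_covD hA).const_smul hA hD (-1))
      convert this using 1
      simp
    rw [reducedKinetic, reducedKinetic, dif_neg h, dif_neg h']

theorem inducedMetric_add_covD (hA : FormL2 A) {X Y : Form n d} (hX : FormL2 X) (hY : FormL2 Y)
    {ξ : Section' n d} (hξ : FiniteEnergy S A ξ) :
    inducedMetric S A (X + covD S A ξ) Y = inducedMetric S A X Y ∧
      inducedMetric S A X (Y + covD S A ξ) = inducedMetric S A X Y := by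
  constructor
  · rw [inducedMetric, inducedMetric, add_right_comm, reducedKinetic_add_covD hA (hX.add hY) hξ,
      reducedKinetic_add_covD hA hX hξ]
  · rw [inducedMetric, inducedMetric, ← add_assoc, reducedKinetic_add_covD hA (hX.add hY) hξ,
      reducedKinetic_add_covD hA hY hξ]

/-- The induced metric is the inner product of the parts orthogonal to the gauge directions. -/
theorem SolvesGauss.inducedMetric_eq (hA : FormL2 A) {X Y : Form n d} (hX : FormL2 X)
    (hY : FormL2 Y) {u v : Section' n d} (hu : SolvesGauss S A X u) (hv : SolvesGauss S A Y v) :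
    inducedMetric S A X Y =
      inner ℝ (toH X hX) (toH Y hY) - inner ℝ (toH X hX) (toH (covD S A v) (hv.1.covD hA)) := by
  rw [inducedMetric, (hu.add hA hX hY hv).reducedKinetic_eq hA (hX.add hY),
    hu.reducedKinetic_eq hA hX, hv.reducedKinetic_eq hA hY, (solvesGauss_iff hA hY hv.1).1 hv,
    toH_add hX hY, map_add, add_sub_add_comm, ← inner_sub_right]
  set P := (covClosure S hA).starProjection (toH X hX)
  set Q := (covClosure S hA).starProjection (toH Y hY)
  -- As `(1 - P)Y` is orthogonal to the range of the projection, projecting one factor is the same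
  -- as projecting both.
  have h1 : inner ℝ P (toH Y hY - Q) = 0 :=
    Submodule.sub_starProjection_mem_orthogonal (toH Y hY) P
      (Submodule.starProjection_apply_mem _ _)
  have h2 : inner ℝ (toH X hX) (toH Y hY - Q) = inner ℝ (toH X hX - P) (toH Y hY - Q) := by
    rw [inner_sub_left, h1, sub_zero]
  rw [h2, norm_add_sq_real]
  ring

end Projection

/-! ### A weighted convolution estimate of Schur type. -/

section SchurBound

/-- The weight `(1 + |ζ|²)^{s/2}` with values in `[0, ∞]`. -/
noncomputable def sobolevWeight (s : ℝ) (ζ : Sp n) : ℝ≥0∞ :=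
  ENNReal.ofReal ((1 + ‖ζ‖ ^ 2) ^ (s / 2))

theorem continuous_sobolevWeight (s : ℝ) : Continuous (sobolevWeight (n := n) s) := by
  refine ENNReal.continuous_ofReal.comp ?_
  refine Continuous.rpow_const (by fun_prop) fun x => Or.inl (by positivity)

theorem sobolevWeight_mul_inv (s : ℝ) (ζ : Sp n) :
    sobolevWeight s ζ * sobolevWeight (-s) ζ = 1 := by
  rw [sobolevWeight, sobolevWeight, ← ENNReal.ofReal_mul (by positivity),
    ← Real.rpow_add (by positivity)]
  simp [neg_div]

theorem sobolevWeight_neg_sq (s : ℝ) (ζ : Sp n) :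
    sobolevWeight (-s) ζ ^ 2 = ENNReal.ofReal ((1 + ‖ζ‖ ^ 2) ^ (-(2 * s) / 2)) := by
  rw [sobolevWeight, ← ENNReal.ofReal_pow (by positivity), ← Real.rpow_natCast,
    ← Real.rpow_mul (by positivity)]
  congr 2
  push_cast
  ring

theorem lintegral_sobolevWeight_lt_top {s : ℝ} (hs : (n : ℝ) / 2 < s) :
    ∫⁻ ζ : Sp n, sobolevWeight (-s) ζ ^ 2 < ⊤ := by
  simp_rw [sobolevWeight_neg_sq]
  exact (integrable_rpow_neg_one_add_norm_sq (E := Sp n) (r := 2 * s)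
    (by simp; linarith)).lintegral_lt_top

theorem sobolevWeight_neg_le_one {s : ℝ} (hs : 0 ≤ s) (ζ : Sp n) : sobolevWeight (-s) ζ ≤ 1 := by
  rw [sobolevWeight, ENNReal.ofReal_le_one]
  exact Real.rpow_le_one_of_one_le_of_nonpos (by nlinarith [sq_nonneg ‖ζ‖]) (by linarith)

/-- The weight integrates over the ball of radius `|η|` around `η` to at most `C |η|²`. -/
theorem exists_lintegral_ball_le (hn : 2 ≤ n) {s : ℝ} (hs : (n : ℝ) / 2 < s) :
    ∃ C : ℝ≥0∞, C ≠ ⊤ ∧ ∀ η : Sp n,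
      ∫⁻ ζ in Metric.closedBall η ‖η‖, sobolevWeight (-s) ζ ^ 2 ≤ C * ‖η‖ₑ ^ 2 := by
  have hs0 : 0 ≤ s := le_trans (by positivity) hs.le
  have : Nonempty (Fin n) := ⟨⟨0, by omega⟩⟩
  refine ⟨volume (Metric.ball (0 : Sp n) 1) + ∫⁻ ζ : Sp n, sobolevWeight (-s) ζ ^ 2,
    ENNReal.add_ne_top.2 ⟨measure_ball_lt_top.ne, (lintegral_sobolevWeight_lt_top hs).ne⟩,
    fun η => ?_⟩
  -- For small `η` the weight is at most `1` and the ball has volume of order `|η|ⁿ ≤ |η|²`, because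
  -- `n ≥ 2`. For large `η` the total integral of the weight, finite by `s > n/2`, is enough.
  rcases le_total ‖η‖ 1 with h | h
  · calc ∫⁻ ζ in Metric.closedBall η ‖η‖, sobolevWeight (-s) ζ ^ 2
        ≤ ∫⁻ ζ in Metric.closedBall η ‖η‖, 1 :=
          lintegral_mono fun ζ => pow_le_one' (sobolevWeight_neg_le_one hs0 ζ) 2
      _ = ENNReal.ofReal (‖η‖ ^ n) * volume (Metric.ball (0 : Sp n) 1) := by
          rw [setLIntegral_one, Measure.addHaar_closedBall _ _ (norm_nonneg _)]
          simp
      _ ≤ ENNReal.ofReal (‖η‖ ^ 2) * volume (Metric.ball (0 : Sp n) 1) := by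
          gcongr ?_ * _
          exact ENNReal.ofReal_le_ofReal (pow_le_pow_of_le_one (norm_nonneg _) h hn)
      _ ≤ _ := by
          rw [ENNReal.ofReal_pow (norm_nonneg _), ofReal_norm, mul_comm]
          gcongr
          exact le_self_add
  · have h1 : (1 : ℝ≥0∞) ≤ ‖η‖ₑ ^ 2 := by
      refine one_le_pow₀ ?_
      rw [← ofReal_norm, ENNReal.one_le_ofReal]
      exact h
    calc ∫⁻ ζ in Metric.closedBall η ‖η‖, sobolevWeight (-s) ζ ^ 2
        ≤ ∫⁻ ζ : Sp n, sobolevWeight (-s) ζ ^ 2 := setLIntegral_le_lintegral _ _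
      _ ≤ (volume (Metric.ball (0 : Sp n) 1) + ∫⁻ ζ : Sp n, sobolevWeight (-s) ζ ^ 2) * 1 := by
          rw [mul_one]; exact le_add_self
      _ ≤ _ := by gcongr

theorem lintegral_mul_le_sqrt {α : Type*} [MeasurableSpace α] (μ : Measure α) {f g : α → ℝ≥0∞}
    (hf : AEMeasurable f μ) (hg : AEMeasurable g μ) :
    ∫⁻ x, f x * g x ∂μ ≤ (∫⁻ x, f x ^ 2 ∂μ) ^ (1 / 2 : ℝ) * (∫⁻ x, g x ^ 2 ∂μ) ^ (1 / 2 : ℝ) := by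
  have := ENNReal.lintegral_mul_le_Lp_mul_Lq μ Real.HolderConjugate.two_two hf hg
  simpa using this

/-- Cauchy-Schwarz on the product space, with the weight `w_s` placed on `a` and its inverse on `q`.
The square integral of the first factor splits by translation invariance. That of the second is
controlled by integrating `w_{-s}²` over the ball, which supplies the factor `|η|²`. -/
theorem lintegral_lintegral_half_le {C : ℝ≥0∞} {s : ℝ}
    (hC : ∀ η : Sp n,
      ∫⁻ ζ in Metric.closedBall η ‖η‖, sobolevWeight (-s) ζ ^ 2 ≤ C * ‖η‖ₑ ^ 2)
    {a p q : Sp n → ℝ≥0∞} (ha : Measurable a) (hp : Measurable p) (hq : Measurable q) :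
    ∫⁻ ζ, ∫⁻ η, (Metric.closedBall η ‖η‖).indicator
        (fun ζ => a ζ * (‖ζ - η‖ₑ * p (ζ - η)) * q η) ζ ≤
      C ^ (1 / 2 : ℝ) * (∫⁻ ζ, (sobolevWeight s ζ * a ζ) ^ 2) ^ (1 / 2 : ℝ) *
        (∫⁻ ξ, (‖ξ‖ₑ * p ξ) ^ 2) ^ (1 / 2 : ℝ) * (∫⁻ ξ, (‖ξ‖ₑ * q ξ) ^ 2) ^ (1 / 2 : ℝ) := by
  have hw : ∀ t : ℝ, Measurable (sobolevWeight (n := n) t) := fun t =>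
    (continuous_sobolevWeight t).measurable
  have hB : MeasurableSet {z : Sp n × Sp n | z.1 ∈ Metric.closedBall z.2 ‖z.2‖} := by
    simp only [Metric.mem_closedBall]
    exact measurableSet_le (measurable_fst.dist measurable_snd) measurable_snd.norm
  let f : Sp n × Sp n → ℝ≥0∞ := fun z =>
    sobolevWeight s z.1 * a z.1 * (‖z.1 - z.2‖ₑ * p (z.1 - z.2))
  let g : Sp n × Sp n → ℝ≥0∞ := {z | z.1 ∈ Metric.closedBall z.2 ‖z.2‖}.indicator
    fun z => sobolevWeight (-s) z.1 * q z.2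
  have hf : Measurable f := by
    have h3 : Measurable fun z : Sp n × Sp n => ‖z.1 - z.2‖ₑ * p (z.1 - z.2) :=
      (measurable_fst.sub measurable_snd).enorm.mul (hp.comp (measurable_fst.sub measurable_snd))
    exact (((hw s).comp measurable_fst).mul (ha.comp measurable_fst)).mul h3
  have hg : Measurable g :=
    (((hw (-s)).comp measurable_fst).mul (hq.comp measurable_snd)).indicator hB
  have hfg : ∀ ζ η : Sp n, (Metric.closedBall η ‖η‖).indicator
        (fun ζ => a ζ * (‖ζ - η‖ₑ * p (ζ - η)) * q η) ζ = f (ζ, η) * g (ζ, η) := by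
    intro ζ η
    by_cases h : ζ ∈ Metric.closedBall η ‖η‖
    · have h' : (ζ, η) ∈ {z : Sp n × Sp n | z.1 ∈ Metric.closedBall z.2 ‖z.2‖} := h
      rw [Set.indicator_of_mem h]
      simp only [f, g, Set.indicator_of_mem h']
      rw [show sobolevWeight s ζ * a ζ * (‖ζ - η‖ₑ * p (ζ - η)) * (sobolevWeight (-s) ζ * q η) =
        (sobolevWeight s ζ * sobolevWeight (-s) ζ) * (a ζ * (‖ζ - η‖ₑ * p (ζ - η)) * q η) by ring,
        sobolevWeight_mul_inv, one_mul]
    · have h' : (ζ, η) ∉ {z : Sp n × Sp n | z.1 ∈ Metric.closedBall z.2 ‖z.2‖} := h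
      rw [Set.indicator_of_notMem h]
      simp only [g, Set.indicator_of_notMem h', mul_zero]
  have hf2 : ∫⁻ z, f z ^ 2 ∂(volume.prod volume) =
      (∫⁻ ζ, (sobolevWeight s ζ * a ζ) ^ 2) * ∫⁻ ξ, (‖ξ‖ₑ * p ξ) ^ 2 := by
    rw [lintegral_prod _ (hf.pow_const 2).aemeasurable]
    have hm : Measurable fun ζ => (sobolevWeight s ζ * a ζ) ^ 2 := ((hw s).mul ha).pow_const 2
    rw [← lintegral_mul_const _ hm]
    refine lintegral_congr fun ζ => ?_
    simp only [f, mul_pow _ (‖_‖ₑ * _)]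
    have hm' : Measurable fun η => (‖ζ - η‖ₑ * p (ζ - η)) ^ 2 :=
      ((measurable_const.sub measurable_id).enorm.mul
        (hp.comp (measurable_const.sub measurable_id))).pow_const 2
    rw [lintegral_const_mul _ hm']
    congr 1
    exact lintegral_sub_left_eq_self (fun ξ => (‖ξ‖ₑ * p ξ) ^ 2) ζ
  have hg2 : ∫⁻ z, g z ^ 2 ∂(volume.prod volume) ≤ C * ∫⁻ ξ, (‖ξ‖ₑ * q ξ) ^ 2 := by
    have hm : Measurable fun ξ => (‖ξ‖ₑ * q ξ) ^ 2 := (measurable_id.enorm.mul hq).pow_const 2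
    rw [lintegral_prod_symm _ (hg.pow_const 2).aemeasurable, ← lintegral_const_mul _ hm]
    refine lintegral_mono fun η => ?_
    have h1 : ∀ ζ, g (ζ, η) ^ 2 = (Metric.closedBall η ‖η‖).indicator
        (fun ζ => sobolevWeight (-s) ζ ^ 2 * q η ^ 2) ζ := by
      intro ζ
      by_cases h : ζ ∈ Metric.closedBall η ‖η‖
      · have h' : (ζ, η) ∈ {z : Sp n × Sp n | z.1 ∈ Metric.closedBall z.2 ‖z.2‖} := h
        rw [Set.indicator_of_mem h]
        simp only [g, Set.indicator_of_mem h', mul_pow]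
      · have h' : (ζ, η) ∉ {z : Sp n × Sp n | z.1 ∈ Metric.closedBall z.2 ‖z.2‖} := h
        rw [Set.indicator_of_notMem h]
        simp only [g, Set.indicator_of_notMem h']
        simp
    simp_rw [h1]
    rw [lintegral_indicator Metric.isClosed_closedBall.measurableSet,
      lintegral_mul_const _ ((hw (-s)).pow_const 2)]
    calc _ ≤ C * ‖η‖ₑ ^ 2 * q η ^ 2 := by gcongr; exact hC η
      _ = _ := by rw [mul_pow, mul_assoc]
  simp_rw [hfg]
  rw [← lintegral_prod (fun z => f z * g z) (hf.mul hg).aemeasurable]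
  refine (lintegral_mul_le_sqrt _ hf.aemeasurable hg.aemeasurable).trans ?_
  rw [hf2, ENNReal.mul_rpow_of_nonneg _ _ (by norm_num)]
  refine (mul_le_mul_right (ENNReal.rpow_le_rpow hg2 (by norm_num)) _).trans (le_of_eq ?_)
  rw [ENNReal.mul_rpow_of_nonneg _ _ (by norm_num)]
  ring

/-- The integrand of `lintegral_lintegral_half_le`. -/
noncomputable def schurKernel (a p q : Sp n → ℝ≥0∞) (ζ η : Sp n) : ℝ≥0∞ :=
  (Metric.closedBall η ‖η‖).indicator (fun ζ => a ζ * (‖ζ - η‖ₑ * p (ζ - η)) * q η) ζ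

theorem measurable_schurKernel {a p q : Sp n → ℝ≥0∞} (ha : Measurable a) (hp : Measurable p)
    (hq : Measurable q) : Measurable (Function.uncurry (schurKernel a p q)) := by
  have hB : MeasurableSet {z : Sp n × Sp n | z.1 ∈ Metric.closedBall z.2 ‖z.2‖} := by
    simp only [Metric.mem_closedBall]
    exact measurableSet_le (measurable_fst.dist measurable_snd) measurable_snd.norm
  have h1 : Measurable fun z : Sp n × Sp n => ‖z.1 - z.2‖ₑ :=
    (measurable_fst.sub measurable_snd).enorm
  have h2 : Measurable fun z : Sp n × Sp n => p (z.1 - z.2) :=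
    hp.comp (measurable_fst.sub measurable_snd)
  have h3 : Measurable fun z : Sp n × Sp n =>
      a z.1 * (‖z.1 - z.2‖ₑ * p (z.1 - z.2)) * q z.2 :=
    ((ha.comp measurable_fst).mul (h1.mul h2)).mul (hq.comp measurable_snd)
  exact h3.indicator hB

/-- One of `|ζ - η| ≤ |η|` and `|η| ≤ |ζ - η|` holds. The second case is the first with `p` and `q`
exchanged and `η` replaced by `ζ - η`. -/
theorem mul_min_le_schurKernel (a p q : Sp n → ℝ≥0∞) (ζ η : Sp n) :
    a ζ * p (ζ - η) * q η * min ‖η‖ₑ ‖ζ - η‖ₑ ≤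
      schurKernel a p q ζ η + schurKernel a q p ζ (ζ - η) := by
  rcases le_total ‖ζ - η‖ ‖η‖ with hle | hle
  · have h1 : ζ ∈ Metric.closedBall η ‖η‖ := by
      rw [Metric.mem_closedBall, dist_eq_norm]; exact hle
    refine le_trans ?_ le_self_add
    rw [schurKernel, Set.indicator_of_mem h1]
    calc _ ≤ a ζ * p (ζ - η) * q η * ‖ζ - η‖ₑ := by gcongr; exact min_le_right _ _
      _ = _ := by ring
  · have h1 : ζ ∈ Metric.closedBall (ζ - η) ‖ζ - η‖ := by
      rw [Metric.mem_closedBall, dist_eq_norm]; simpa using hle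
    refine le_trans ?_ le_add_self
    rw [schurKernel, Set.indicator_of_mem h1, sub_sub_cancel]
    calc _ ≤ a ζ * p (ζ - η) * q η * ‖η‖ₑ := by gcongr; exact min_le_left _ _
      _ = _ := by ring

/-- The convolution estimate behind the smallness of the Coulomb cross term. -/
theorem exists_lintegral_min_le (hn : 2 ≤ n) {s : ℝ} (hs : (n : ℝ) / 2 < s) :
    ∃ C : ℝ≥0∞, C ≠ ⊤ ∧ ∀ {a p q : Sp n → ℝ≥0∞}, Measurable a → Measurable p → Measurable q →
      ∫⁻ ζ, ∫⁻ η, a ζ * p (ζ - η) * q η * min ‖η‖ₑ ‖ζ - η‖ₑ ≤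
      C * (∫⁻ ζ, (sobolevWeight s ζ * a ζ) ^ 2) ^ (1 / 2 : ℝ) *
        (∫⁻ ξ, (‖ξ‖ₑ * p ξ) ^ 2) ^ (1 / 2 : ℝ) * (∫⁻ ξ, (‖ξ‖ₑ * q ξ) ^ 2) ^ (1 / 2 : ℝ) := by
  obtain ⟨C, hC, h⟩ := exists_lintegral_ball_le hn hs
  refine ⟨2 * C ^ (1 / 2 : ℝ), ENNReal.mul_ne_top (by simp)
    (ENNReal.rpow_ne_top_of_nonneg (by norm_num) hC), fun {a p q} ha hp hq => ?_⟩
  have h1 : ∫⁻ ζ, ∫⁻ η, schurKernel a p q ζ η ≤ _ := lintegral_lintegral_half_le h ha hp hq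
  have h2 : ∫⁻ ζ, ∫⁻ η, schurKernel a q p ζ η ≤ _ := lintegral_lintegral_half_le h ha hq hp
  generalize (∫⁻ ζ, (sobolevWeight s ζ * a ζ) ^ 2) ^ (1 / 2 : ℝ) = x at h1 h2 ⊢
  generalize (∫⁻ ξ, (‖ξ‖ₑ * p ξ) ^ 2) ^ (1 / 2 : ℝ) = y at h1 h2 ⊢
  generalize (∫⁻ ξ, (‖ξ‖ₑ * q ξ) ^ 2) ^ (1 / 2 : ℝ) = z at h1 h2 ⊢
  generalize C ^ (1 / 2 : ℝ) = c at h1 h2 ⊢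
  have h3 : ∫⁻ ζ, ∫⁻ η, a ζ * p (ζ - η) * q η * min ‖η‖ₑ ‖ζ - η‖ₑ ≤
      ∫⁻ ζ, ∫⁻ η, (schurKernel a p q ζ η + schurKernel a q p ζ (ζ - η)) :=
    lintegral_mono fun ζ => lintegral_mono fun η => mul_min_le_schurKernel a p q ζ η
  -- The substitution `η ↦ ζ - η` preserves Lebesgue measure, so both halves obey the same bound.
  -- This is the origin of the factor `2` in the constant.
  have h4 : ∫⁻ ζ, ∫⁻ η, (schurKernel a p q ζ η + schurKernel a q p ζ (ζ - η)) =
      (∫⁻ ζ, ∫⁻ η, schurKernel a p q ζ η) + ∫⁻ ζ, ∫⁻ η, schurKernel a q p ζ η := by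
    have hm' : Measurable fun ζ => ∫⁻ η, schurKernel a p q ζ η :=
      (measurable_schurKernel ha hp hq).lintegral_prod_right
    refine Eq.trans (lintegral_congr fun ζ => ?_)
      (lintegral_add_left hm' fun ζ => ∫⁻ η, schurKernel a q p ζ η)
    have hm : Measurable fun η => schurKernel a p q ζ η :=
      (measurable_schurKernel ha hp hq).of_uncurry_left
    rw [lintegral_add_left hm, lintegral_sub_left_eq_self (fun η => schurKernel a q p ζ η) ζ]
  refine h3.trans (h4.le.trans ((add_le_add h1 h2).trans (le_of_eq ?_)))
  ring

end SchurBound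

/-! ### The Fourier transform on `L²`, Parseval's identity and convolutions. -/

section FourierL2

/-- The space of complex `L²` functions. -/
noncomputable abbrev CL2 (n : ℕ) := Lp ℂ 2 (volume : Measure (Sp n))

theorem integral_smul_fourier (F : CL2 n) (g : SchwartzMap (Sp n) ℂ) :
    ∫ x, g x • (𝓕 F : CL2 n) x = ∫ x, (𝓕 g : SchwartzMap (Sp n) ℂ) x • F x := by
  have h := congrArg (fun D => D g) (Lp.fourier_toTemperedDistribution_eq F)
  simp only [TemperedDistribution.fourier_apply, Lp.toTemperedDistribution_apply] at h
  exact h.symm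

theorem integral_smul_fourierInv (F : CL2 n) (g : SchwartzMap (Sp n) ℂ) :
    ∫ x, g x • (𝓕⁻ F : CL2 n) x = ∫ x, (𝓕⁻ g : SchwartzMap (Sp n) ℂ) x • F x := by
  have h := congrArg (fun D => D g) (Lp.fourierInv_toTemperedDistribution_eq F)
  simp only [TemperedDistribution.fourierInv_apply, Lp.toTemperedDistribution_apply] at h
  exact h.symm

theorem integral_fourier_smul {f g : Sp n → ℂ} (hf : Integrable f) (hg : Integrable g) :
    ∫ x, 𝓕 f x • g x = ∫ x, f x • 𝓕 g x := by
  have := VectorFourier.integral_fourierIntegral_smul_eq_flip (μ := volume) (ν := volume)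
    (L := innerₗ (Sp n)) Real.continuous_fourierChar (by
      exact continuous_inner) hf hg
  rwa [flip_innerₗ] at this

theorem integral_fourierInv_smul {f g : Sp n → ℂ} (hf : Integrable f) (hg : Integrable g) :
    ∫ x, 𝓕⁻ f x • g x = ∫ x, f x • 𝓕⁻ g x := by
  have := VectorFourier.integral_fourierIntegral_smul_eq_flip (μ := volume) (ν := volume)
    (L := -innerₗ (Sp n)) Real.continuous_fourierChar (by
      exact continuous_inner.neg) hf hg
  have h2 : (-innerₗ (Sp n)).flip = -innerₗ (Sp n) := by
    ext x y
    simp [real_inner_comm]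
  rwa [h2] at this

/-- A complex function is determined by its integrals against real test functions. -/
theorem ae_eq_of_integral_schwartz {f g : Sp n → ℂ} (hf : LocallyIntegrable f)
    (hg : LocallyIntegrable g)
    (h : ∀ φ : SchwartzMap (Sp n) ℂ, ∫ x, φ x • f x = ∫ x, φ x • g x) : f =ᵐ[volume] g := by
  refine ae_eq_of_integral_contDiff_smul_eq hf hg fun φ hφ hs => ?_
  have hs' : HasCompactSupport (Complex.ofRealCLM ∘ φ) := hs.comp_left rfl
  have hφ' : ContDiff ℝ (⊤ : ℕ∞) (Complex.ofRealCLM ∘ φ) := Complex.ofRealCLM.contDiff.comp hφ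
  simpa using h (hs'.toSchwartzMap hφ')

/-- The `L²` and the `L¹` Fourier transforms agree. -/
theorem fourier_toLp_ae {f : Sp n → ℂ} (h1 : Integrable f) (h2 : MemLp f 2 volume) :
    (𝓕 (h2.toLp f) : CL2 n) =ᵐ[volume] 𝓕 f := by
  have hc : Continuous (𝓕 f) :=
    VectorFourier.fourierIntegral_continuous Real.continuous_fourierChar
      (by exact continuous_inner) h1
  refine ae_eq_of_integral_schwartz ((Lp.memLp _).locallyIntegrable (by norm_num))
    hc.locallyIntegrable fun φ => ?_
  rw [integral_smul_fourier, ← integral_fourier_smul φ.integrable h1]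
  refine integral_congr_ae ?_
  filter_upwards [h2.coeFn_toLp] with x hx
  rw [hx, SchwartzMap.fourier_coe]

theorem fourierInv_ae {F : CL2 n} (h1 : Integrable F) :
    (𝓕⁻ F : CL2 n) =ᵐ[volume] 𝓕⁻ (F : Sp n → ℂ) := by
  have hc : Continuous (𝓕⁻ (F : Sp n → ℂ)) :=
    VectorFourier.fourierIntegral_continuous Real.continuous_fourierChar
      (by exact continuous_inner.neg) h1
  refine ae_eq_of_integral_schwartz ((Lp.memLp _).locallyIntegrable (by norm_num))
    hc.locallyIntegrable fun φ => ?_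
  rw [integral_smul_fourierInv, ← integral_fourierInv_smul φ.integrable h1,
    SchwartzMap.fourierInv_coe]

theorem inner_toLp {f g : Sp n → ℂ} (hf : MemLp f 2 volume) (hg : MemLp g 2 volume) :
    inner ℂ (hf.toLp f) (hg.toLp g) = ∫ x, starRingEnd ℂ (f x) * g x := by
  rw [L2.inner_def]
  refine integral_congr_ae ?_
  filter_upwards [hf.coeFn_toLp, hg.coeFn_toLp] with x h1 h2
  rw [h1, h2, RCLike.inner_apply, mul_comm]

/-- Parseval's identity with an integrable second factor. -/
theorem integral_conj_mul_eq {f g : Sp n → ℂ} (hf : MemLp f 2 volume) (hg : MemLp g 2 volume)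
    (hg1 : Integrable g) : ∫ x, starRingEnd ℂ (f x) * g x =
      ∫ ξ, starRingEnd ℂ ((𝓕 (hf.toLp f) : CL2 n) ξ) * 𝓕 g ξ := by
  rw [← inner_toLp hf hg, ← Lp.inner_fourier_eq, L2.inner_def]
  refine integral_congr_ae ?_
  filter_upwards [fourier_toLp_ae hg1 hg] with x h1
  rw [h1, RCLike.inner_apply, mul_comm]

theorem integral_conj_mul_eq' {f g : Sp n → ℂ} (hf : MemLp f 2 volume) (hg : MemLp g 2 volume)
    (hf1 : Integrable f) (hg1 : Integrable g) : ∫ x, starRingEnd ℂ (f x) * g x =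
      ∫ ξ, starRingEnd ℂ (𝓕 f ξ) * 𝓕 g ξ := by
  rw [integral_conj_mul_eq hf hg hg1]
  refine integral_congr_ae ?_
  filter_upwards [fourier_toLp_ae hf1 hf] with x h1
  rw [h1]

theorem IsTest.integrable {V : Type*} [NormedAddCommGroup V] [NormedSpace ℝ V] {ψ : Sp n → V}
    (h : IsTest ψ) : Integrable ψ := memLp_one_iff_integrable.1 (h.memLp 1)

theorem IsTest.integrable_fderiv {V : Type*} [NormedAddCommGroup V] [NormedSpace ℝ V]
    {ψ : Sp n → V} (h : IsTest ψ) (v : Sp n) : Integrable fun x => fderiv ℝ ψ x v :=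
  memLp_one_iff_integrable.1 (h.memLp_fderiv v 1)

theorem fourier_fderiv_apply {ψ : Sp n → ℂ} (h : IsTest ψ) (i : Fin n) (ξ : Sp n) :
    𝓕 (fun x => fderiv ℝ ψ x (e i)) ξ = 2 * Real.pi * Complex.I * (ξ i : ℂ) * 𝓕 ψ ξ := by
  have h1 : Integrable (fderiv ℝ ψ) :=
    (h.1.continuous_fderiv (by simp)).integrable_of_hasCompactSupport (h.2.fderiv (𝕜 := ℝ))
  rw [← Real.fourier_continuousLinearMap_apply h1,
    Real.fourier_fderiv h.integrable (h.1.differentiable (by simp)) h1]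
  have h2 : innerSL ℝ ξ (e i) = ξ i := by
    change inner ℝ ξ (e i) = ξ i
    simp [e, EuclideanSpace.inner_single_right]
  simp [VectorFourier.fourierSMulRight_apply, h2]
  ring

theorem fderiv_ofReal {φ : Sp n → ℝ} (h : IsTest φ) (x v : Sp n) :
    fderiv ℝ (fun y => (φ y : ℂ)) x v = (fderiv ℝ φ x v : ℂ) := by
  have h1 : HasFDerivAt φ (fderiv ℝ φ x) x := (h.1.differentiable (by simp) x).hasFDerivAt
  have h2 := Complex.ofRealCLM.hasFDerivAt.comp x h1
  have h3 : fderiv ℝ (fun y => (φ y : ℂ)) x = Complex.ofRealCLM.comp (fderiv ℝ φ x) := h2.fderiv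
  rw [h3]
  rfl

theorem IsTest.ofReal {φ : Sp n → ℝ} (h : IsTest φ) : IsTest fun x => (φ x : ℂ) :=
  h.clm Complex.ofRealCLM

/-- The Fourier transform of a product is the convolution of the Fourier transforms. -/
theorem fourier_mul_eq {φ w : Sp n → ℂ} (hφ : IsTest φ) (hw : Continuous w)
    (hw' : HasCompactSupport w) (ζ : Sp n) :
    𝓕 (fun x => φ x * w x) ζ = ∫ η, 𝓕 φ (ζ - η) * 𝓕 w η := by
  -- The convolution formula is Parseval's identity for `w` and the modulated conjugate `g` of `φ`,
  -- whose Fourier transform at `η` is the conjugate of `φ̂(ζ - η)`.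
  let χ : Sp n → ℂ := fun x => (Real.fourierChar (inner ℝ x ζ) : ℂ)
  have hχ : Continuous χ := by
    have : Continuous fun x : Sp n => Real.fourierChar (inner ℝ x ζ) :=
      Real.continuous_fourierChar.comp (by fun_prop)
    exact continuous_subtype_val.comp this
  let g : Sp n → ℂ := fun x => χ x * starRingEnd ℂ (φ x)
  have hg : Continuous g := hχ.mul (Complex.continuous_conj.comp hφ.1.continuous)
  have hgs : HasCompactSupport g :=
    HasCompactSupport.mul_left (hφ.2.comp_left (g := starRingEnd ℂ) (map_zero _))
  have hgF : ∀ η, 𝓕 g η = starRingEnd ℂ (𝓕 φ (ζ - η)) := by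
    intro η
    rw [Real.fourier_eq, Real.fourier_eq, ← integral_conj]
    refine integral_congr_ae (Eventually.of_forall fun x => ?_)
    simp only [g, χ, Circle.smul_def, smul_eq_mul, map_mul, ← Circle.coe_inv_eq_conj,
      ← AddChar.map_neg_eq_inv, neg_neg]
    rw [← mul_assoc, ← Circle.coe_mul, ← AddChar.map_add_eq_mul]
    congr 3
    rw [inner_sub_right]
    ring
  have h1 := integral_conj_mul_eq' (hg.memLp_of_hasCompactSupport hgs)
    (hw.memLp_of_hasCompactSupport hw') (hg.integrable_of_hasCompactSupport hgs)
    (hw.integrable_of_hasCompactSupport hw')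
  simp only [hgF, Complex.conj_conj] at h1
  rw [← h1, Real.fourier_eq]
  refine integral_congr_ae (Eventually.of_forall fun x => ?_)
  simp only [g, χ, Circle.smul_def, smul_eq_mul, map_mul, ← Circle.coe_inv_eq_conj,
      ← AddChar.map_neg_eq_inv, Complex.conj_conj]
  ring

end FourierL2

/-! ### Weak derivatives and boundedness of Sobolev functions. -/

section Sobolev

variable {s : ℝ}

theorem memLp_of_sobolevNorm_lt_top {f : Sp n → ℝ} (h : sobolevNorm s f < ⊤) :
    MemLp (fun x => (f x : ℂ)) 2 volume := by
  unfold sobolevNorm at h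
  split_ifs at h with h2
  · exact h2
  · exact absurd h (lt_irrefl _)

/-- The `L²` Fourier transform of a real function. -/
noncomputable def ft {f : Sp n → ℝ} (hf : MemLp (fun x => (f x : ℂ)) 2 volume) : CL2 n :=
  𝓕 (hf.toLp fun x => (f x : ℂ))

theorem sobolevNorm_eq {f : Sp n → ℝ} (hf : MemLp (fun x => (f x : ℂ)) 2 volume) :
    sobolevNorm s f = eLpNorm (fun ξ : Sp n => (((1 + ‖ξ‖ ^ 2) ^ (s / 2) : ℝ) : ℂ) * ft hf ξ)
      2 volume := by
  rw [sobolevNorm, dif_pos hf, ft]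

theorem enorm_weight (ξ : Sp n) (z : ℂ) :
    ‖(((1 + ‖ξ‖ ^ 2) ^ (s / 2) : ℝ) : ℂ) * z‖ₑ = sobolevWeight s ξ * ‖z‖ₑ := by
  rw [enorm_mul, sobolevWeight, ← ofReal_norm (E := ℂ), Complex.norm_real, Real.norm_eq_abs,
    abs_of_nonneg (by positivity)]

theorem sobolevNorm_eq_lintegral {f : Sp n → ℝ} (hf : MemLp (fun x => (f x : ℂ)) 2 volume) :
    sobolevNorm s f = (∫⁻ ξ, (sobolevWeight s ξ * ‖ft hf ξ‖ₑ) ^ 2) ^ (1 / 2 : ℝ) := by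
  rw [sobolevNorm_eq hf, eLpNorm_eq_lintegral_rpow_enorm_toReal (by norm_num) (by norm_num)]
  simp only [enorm_weight]
  simp

theorem continuous_weight : Continuous fun ξ : Sp n => (((1 + ‖ξ‖ ^ 2) ^ (s / 2) : ℝ) : ℂ) :=
  Complex.continuous_ofReal.comp
    (Continuous.rpow_const (by fun_prop) fun x => Or.inl (by positivity))

theorem memLp_weight_mul {f : Sp n → ℝ} (hf : MemLp (fun x => (f x : ℂ)) 2 volume)
    (h : sobolevNorm s f < ⊤) :
    MemLp (fun ξ : Sp n => (((1 + ‖ξ‖ ^ 2) ^ (s / 2) : ℝ) : ℂ) * ft hf ξ) 2 volume :=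
  ⟨continuous_weight.aestronglyMeasurable.mul (Lp.aestronglyMeasurable _),
    by rwa [← sobolevNorm_eq hf]⟩

theorem norm_coord_le (ξ : Sp n) (i : Fin n) : |ξ i| ≤ ‖ξ‖ := by
  simpa using PiLp.norm_apply_le ξ i

theorem norm_le_weight (hs : 1 ≤ s) (ξ : Sp n) : ‖ξ‖ ≤ (1 + ‖ξ‖ ^ 2) ^ (s / 2) := by
  calc ‖ξ‖ = (‖ξ‖ ^ 2) ^ (1 / 2 : ℝ) := by
        rw [← Real.sqrt_eq_rpow, Real.sqrt_sq (norm_nonneg _)]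
    _ ≤ (1 + ‖ξ‖ ^ 2) ^ (1 / 2 : ℝ) := by gcongr; linarith
    _ ≤ _ := Real.rpow_le_rpow_of_exponent_le (by nlinarith [sq_nonneg ‖ξ‖]) (by linarith)

/-- The symbol of `∂_i`. -/
noncomputable def derivSymbol (i : Fin n) (ξ : Sp n) : ℂ :=
  2 * Real.pi * Complex.I * (ξ i : ℂ)

theorem continuous_derivSymbol (i : Fin n) : Continuous (derivSymbol (n := n) i) := by
  unfold derivSymbol
  fun_prop

theorem memLp_derivSymbol_mul (hs : 1 ≤ s) {f : Sp n → ℝ}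
    (hf : MemLp (fun x => (f x : ℂ)) 2 volume) (h : sobolevNorm s f < ⊤) (i : Fin n) :
    MemLp (fun ξ => derivSymbol i ξ * ft hf ξ) 2 volume := by
  refine ((memLp_weight_mul hf h).norm.const_mul (2 * Real.pi)).mono
    ((continuous_derivSymbol i).aestronglyMeasurable.mul (Lp.aestronglyMeasurable _))
    (Eventually.of_forall fun ξ => ?_)
  have h1 : ‖derivSymbol i ξ‖ = 2 * Real.pi * |ξ i| := by
    simp [derivSymbol, abs_of_pos Real.pi_pos]
  have h2 : ‖(((1 + ‖ξ‖ ^ 2) ^ (s / 2) : ℝ) : ℂ)‖ = (1 + ‖ξ‖ ^ 2) ^ (s / 2) := by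
    rw [Complex.norm_real, Real.norm_eq_abs, abs_of_nonneg (by positivity)]
  rw [norm_mul, h1, Real.norm_eq_abs, abs_mul, abs_norm, norm_mul, h2,
    abs_of_pos (by positivity : (0 : ℝ) < 2 * Real.pi), ← mul_assoc]
  gcongr
  exact (norm_coord_le ξ i).trans (norm_le_weight hs ξ)

/-- The weak derivative of a Sobolev function (as a complex function). -/
noncomputable def sobolevDeriv (hs : 1 ≤ s) {f : Sp n → ℝ}
    (hf : MemLp (fun x => (f x : ℂ)) 2 volume) (h : sobolevNorm s f < ⊤) (i : Fin n) : CL2 n :=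
  𝓕⁻ ((memLp_derivSymbol_mul hs hf h i).toLp _ : CL2 n)

/-- Parseval's identity on both sides. The minus sign comes from conjugating the imaginary symbol
`2πi ξ_i`. The conjugate on the right remains because the derivative is constructed as a complex
function and is not shown to be real. -/
theorem integral_mul_fderiv (hs : 1 ≤ s) {f : Sp n → ℝ}
    (hf : MemLp (fun x => (f x : ℂ)) 2 volume) (h : sobolevNorm s f < ⊤) (i : Fin n)
    {η : Sp n → ℝ} (hη : IsTest η) :
    ∫ x, (f x : ℂ) * (fderiv ℝ η x (e i) : ℂ) =
      -∫ x, starRingEnd ℂ (sobolevDeriv hs hf h i x) * (η x : ℂ) := by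
  have hm := memLp_derivSymbol_mul hs hf h i
  have h1 : ∫ x, starRingEnd ℂ (f x : ℂ) * fderiv ℝ (fun y => (η y : ℂ)) x (e i) =
      ∫ ξ, starRingEnd ℂ (ft hf ξ) * 𝓕 (fun x => fderiv ℝ (fun y => (η y : ℂ)) x (e i)) ξ :=
    integral_conj_mul_eq hf (hη.ofReal.memLp_fderiv _ 2) (hη.ofReal.integrable_fderiv _)
  have h2 : ∫ x, starRingEnd ℂ (sobolevDeriv hs hf h i x) * (η x : ℂ) =
      ∫ ξ, starRingEnd ℂ (derivSymbol i ξ * ft hf ξ) * 𝓕 (fun y => (η y : ℂ)) ξ := by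
    have := integral_conj_mul_eq (Lp.memLp (sobolevDeriv hs hf h i)) (hη.ofReal.memLp 2)
      hη.ofReal.integrable
    rw [Lp.toLp_coeFn, sobolevDeriv, FourierTransform.fourier_fourierInv_eq] at this
    rw [sobolevDeriv, this]
    refine integral_congr_ae ?_
    filter_upwards [hm.coeFn_toLp] with ξ hξ
    rw [hξ]
  simp only [Complex.conj_ofReal, fderiv_ofReal hη] at h1
  rw [h1, h2, ← integral_neg]
  refine integral_congr_ae (Eventually.of_forall fun ξ => ?_)
  have h3 := fourier_fderiv_apply hη.ofReal i ξ
  simp only [fderiv_ofReal hη] at h3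
  simp only [h3, derivSymbol, map_mul, Complex.conj_I, Complex.conj_ofReal, map_ofNat]
  ring

theorem InHs.exists_hasWeakDeriv (hs : 1 ≤ s) {A : Form n d} (hA : InHs s A) (i j : Fin n) :
    ∃ v, HasWeakDeriv i (A j) v ∧ MemLp v 2 volume := by
  have hf : ∀ P, MemLp (fun x => (A j x P : ℂ)) 2 volume := fun P =>
    memLp_of_sobolevNorm_lt_top (hA j P)
  let g : Fin d → CL2 n := fun P => sobolevDeriv hs (hf P) (hA j P) i
  -- Only the real part of the complex derivative is needed, since the function and the test
  -- functions are real.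
  have hv : MemLp (fun x => WithLp.toLp 2 fun P => (g P x).re : Section' n d) 2 volume :=
    MemLp.of_eval_piLp fun P => (Lp.memLp (g P)).re
  refine ⟨_, ⟨(hA.formL2 j).locallyIntegrable (by norm_num), hv.locallyIntegrable (by norm_num),
    fun ψ hψ => ?_⟩, hv⟩
  have hL : LocallyIntegrable (A j) := (hA.formL2 j).locallyIntegrable (by norm_num)
  have hL' := hv.locallyIntegrable (by norm_num)
  ext P
  have h1 := integral_mul_fderiv hs (hf P) (hA j P) i hψ
  have h2 := congrArg Complex.re h1
  have hint : Integrable fun x => starRingEnd ℂ (g P x) * (ψ x : ℂ) := by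
    have : MemLp (fun x => starRingEnd ℂ (g P x)) 2 volume :=
      (Lp.memLp (g P)).star
    exact memLp_one_iff_integrable.1 ((hψ.ofReal.memLp 2).mul this)
  have h3 : ∫ x, fderiv ℝ ψ x (e i) * A j x P = -∫ x, ψ x * (g P x).re := by
    have h4 : (∫ x, starRingEnd ℂ (g P x) * (ψ x : ℂ)).re = ∫ x, ψ x * (g P x).re := by
      rw [← RCLike.re_eq_complex_re, ← integral_re hint]
      refine integral_congr_ae (Eventually.of_forall fun x => ?_)
      simp [mul_comm]
    rw [Complex.neg_re, h4] at h2
    rw [← h2]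
    simp only [← Complex.ofReal_mul]
    rw [integral_complex_ofReal, Complex.ofReal_re]
    simp only [mul_comm]
  have h5 := (EuclideanSpace.proj P : Alg d →L[ℝ] ℝ).integral_comp_comm
    (integrable_test_smul (hψ.continuous_fderiv (e i)) (hψ.hasCompactSupport_fderiv (e i)) hL)
  have h6 := (EuclideanSpace.proj P : Alg d →L[ℝ] ℝ).integral_comp_comm
    (integrable_test_smul hψ.1.continuous hψ.2 hL')
  simp only [EuclideanSpace.coe_proj, PiLp.smul_apply, smul_eq_mul] at h5 h6
  rw [← h5, h3, PiLp.neg_apply, ← h6]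

/-- Cauchy-Schwarz between `w_{-s}`, which is square integrable for `s > n/2`, and `w_s f̂`. -/
theorem integrable_ft (hs : (n : ℝ) / 2 < s) {f : Sp n → ℝ}
    (hf : MemLp (fun x => (f x : ℂ)) 2 volume) (h : sobolevNorm s f < ⊤) :
    Integrable (ft hf) := by
  refine ⟨Lp.aestronglyMeasurable _, ?_⟩
  have h1 : ∀ ξ, ‖ft hf ξ‖ₑ = sobolevWeight (-s) ξ * (sobolevWeight s ξ * ‖ft hf ξ‖ₑ) := by
    intro ξ
    rw [← mul_assoc, mul_comm (sobolevWeight (-s) ξ), sobolevWeight_mul_inv, one_mul]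
  have hm : AEMeasurable (fun ξ => sobolevWeight s ξ * ‖ft hf ξ‖ₑ) volume :=
    (continuous_sobolevWeight s).aemeasurable.mul (Lp.aestronglyMeasurable (ft hf)).enorm
  calc ∫⁻ ξ, ‖ft hf ξ‖ₑ = ∫⁻ ξ, sobolevWeight (-s) ξ * (sobolevWeight s ξ * ‖ft hf ξ‖ₑ) :=
        lintegral_congr h1
    _ ≤ _ := lintegral_mul_le_sqrt _ (continuous_sobolevWeight (-s)).aemeasurable hm
    _ < ⊤ := by
        rw [← sobolevNorm_eq_lintegral hf]
        exact ENNReal.mul_lt_top (ENNReal.rpow_lt_top_of_nonneg (by norm_num)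
          (lintegral_sobolevWeight_lt_top hs).ne) h

theorem memLp_top_of_sobolevNorm (hs : (n : ℝ) / 2 < s) {f : Sp n → ℝ}
    (h : sobolevNorm s f < ⊤) : MemLp f ⊤ volume := by
  have hf := memLp_of_sobolevNorm_lt_top h
  have h1 := fourierInv_ae (integrable_ft hs hf h)
  rw [ft, FourierTransform.fourierInv_fourier_eq] at h1
  have hr : MemLp f 2 volume := by simpa using hf.re
  refine memLp_top_of_bound hr.1 (∫ ξ, ‖ft hf ξ‖) ?_
  filter_upwards [h1, hf.coeFn_toLp] with x h2 h3
  rw [h3] at h2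
  rw [← Complex.norm_real, h2, Real.fourierInv_eq]
  refine (norm_integral_le_integral_norm _).trans (le_of_eq ?_)
  simp [ft]

theorem InHs.memLp_top (hs : (n : ℝ) / 2 < s) {A : Form n d} (hA : InHs s A) (i : Fin n) :
    MemLp (A i) ⊤ volume :=
  MemLp.of_eval_piLp fun P => memLp_top_of_sobolevNorm hs (hA i P)

end Sobolev

/-! ### The Coulomb condition on the Fourier side. -/

section DivergenceFree

variable {s : ℝ}

/-- The divergence free condition in Fourier space. -/
theorem sum_mul_ft_eq_zero (hs : 1 ≤ s) {a : Fin n → Sp n → ℝ}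
    (ha : ∀ i, MemLp (fun x => (a i x : ℂ)) 2 volume) (h : ∀ i, sobolevNorm s (a i) < ⊤)
    (hdiv : ∀ η : Sp n → ℝ, IsTest η → ∑ i, ∫ x, fderiv ℝ η x (e i) * a i x = 0) :
    ∀ᵐ ξ : Sp n, ∑ i, (ξ i : ℂ) * ft (ha i) ξ = 0 := by
  let g : Fin n → CL2 n := fun i => sobolevDeriv hs (ha i) (h i) i
  have hint : ∀ {η : Sp n → ℝ}, IsTest η → ∀ i,
      Integrable fun x => starRingEnd ℂ (g i x) * (η x : ℂ) := by
    intro η hη i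
    have : MemLp (fun x => starRingEnd ℂ (g i x)) 2 volume := (Lp.memLp (g i)).star
    exact memLp_one_iff_integrable.1 ((hη.ofReal.memLp 2).mul this)
  -- The weak divergence vanishes against all test functions, hence almost everywhere. It is tested
  -- in conjugated form, as `integral_mul_fderiv` provides it.
  have h0 : ∀ᵐ x, starRingEnd ℂ (∑ i, g i x) = 0 := by
    have hL : LocallyIntegrable fun x => starRingEnd ℂ (∑ i, g i x) := by
      have : MemLp (fun x => starRingEnd ℂ (∑ i, g i x)) 2 volume :=
        (memLp_finsetSum _ fun i _ => Lp.memLp (g i)).star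
      exact this.locallyIntegrable (by norm_num)
    refine ae_eq_zero_of_integral_contDiff_smul_eq_zero hL fun η hη hs' => ?_
    have hη' : IsTest η := ⟨hη.of_le (by simp), hs'⟩
    have h1 : ∀ x, η x • starRingEnd ℂ (∑ i, g i x) =
        ∑ i, starRingEnd ℂ (g i x) * (η x : ℂ) := by
      intro x
      rw [map_sum, ← Finset.sum_mul, mul_comm, Complex.real_smul]
    simp_rw [h1]
    rw [integral_finsetSum _ fun i _ => hint hη' i]
    have h2 : ∀ i, ∫ x, starRingEnd ℂ (g i x) * (η x : ℂ) =
        -((∫ x, fderiv ℝ η x (e i) * a i x : ℝ) : ℂ) := by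
      intro i
      rw [← integral_complex_ofReal, eq_neg_iff_add_eq_zero, add_comm,
        ← eq_neg_iff_add_eq_zero, ← integral_mul_fderiv hs (ha i) (h i) i hη']
      simp only [Complex.ofReal_mul, mul_comm]
    simp_rw [h2]
    rw [Finset.sum_neg_distrib, ← Complex.ofReal_sum, hdiv η hη']
    simp
  have h1 : ∑ i, g i = 0 := by
    rw [Lp.eq_zero_iff_ae_eq_zero]
    filter_upwards [h0, Lp.coeFn_finsetSum (s := Finset.univ) g] with x hx h2
    rw [h2, Finset.sum_apply]
    exact (map_eq_zero_iff _ (RingHom.injective _)).1 hx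
  -- Transforming back, each derivative becomes its symbol times the transform. The common factor
  -- `2πi` is cancelled at the end.
  have h2 : ∑ i, ((memLp_derivSymbol_mul hs (ha i) (h i) i).toLp _ : CL2 n) = 0 := by
    have h3 := congrArg (Lp.fourierTransformₗᵢ (Sp n) ℂ) h1
    rw [map_zero, map_sum] at h3
    rw [← h3]
    refine Finset.sum_congr rfl fun i _ => ?_
    exact ((Lp.fourierTransformₗᵢ (Sp n) ℂ).apply_symm_apply _).symm
  rw [Lp.eq_zero_iff_ae_eq_zero] at h2
  have h3 : ∀ᵐ ξ, ∀ i, ((memLp_derivSymbol_mul hs (ha i) (h i) i).toLp _ : CL2 n) ξ =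
      derivSymbol i ξ * ft (ha i) ξ :=
    ae_all_iff.2 fun i => (memLp_derivSymbol_mul hs (ha i) (h i) i).coeFn_toLp
  filter_upwards [h2, h3, Lp.coeFn_finsetSum (s := Finset.univ)
    fun i => ((memLp_derivSymbol_mul hs (ha i) (h i) i).toLp _ : CL2 n)] with ξ h4 h5 h6
  rw [h6] at h4
  rw [Finset.sum_apply, Finset.sum_congr rfl fun i _ => h5 i] at h4
  simp only [derivSymbol, mul_assoc, ← Finset.mul_sum, Pi.zero_apply] at h4
  simpa [Real.pi_ne_zero] using h4

end DivergenceFree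

/-! ### The trilinear estimate for divergence free fields. -/

section Trilinear

variable {s : ℝ}

/-- The `L²` norm of the gradient of a scalar function. -/
noncomputable def gradNorm (φ : Sp n → ℝ) : ℝ≥0∞ :=
  (∑ i, eLpNorm (fun x => fderiv ℝ φ x (e i)) 2 volume ^ 2) ^ (1 / 2 : ℝ)

theorem IsTest.continuous_fourier {φ : Sp n → ℂ} (h : IsTest φ) : Continuous (𝓕 φ) :=
  VectorFourier.fourierIntegral_continuous Real.continuous_fourierChar
    (by exact continuous_inner) h.integrable

theorem memLp_fourier {f : Sp n → ℂ} (h1 : Integrable f) (h2 : MemLp f 2 volume) :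
    MemLp (𝓕 f) 2 volume :=
  (memLp_congr_ae (fourier_toLp_ae h1 h2)).1 (Lp.memLp _)

theorem lintegral_fourier_sq {f : Sp n → ℂ} (h1 : Integrable f) (h2 : MemLp f 2 volume) :
    ∫⁻ ξ, ‖𝓕 f ξ‖ₑ ^ 2 = eLpNorm f 2 volume ^ 2 := by
  have h3 : eLpNorm (𝓕 f) 2 volume = eLpNorm f 2 volume := by
    have h4 : ‖(𝓕 (h2.toLp f) : CL2 n)‖ = ‖h2.toLp f‖ := Lp.norm_fourier_eq _
    rw [Lp.norm_def, Lp.norm_def, ENNReal.toReal_eq_toReal_iff' (Lp.eLpNorm_ne_top _)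
      (Lp.eLpNorm_ne_top _), eLpNorm_congr_ae (fourier_toLp_ae h1 h2),
      eLpNorm_congr_ae h2.coeFn_toLp] at h4
    exact h4
  rw [← h3, eLpNorm_eq_lintegral_rpow_enorm_toReal (by norm_num) (by norm_num),
    ← ENNReal.rpow_natCast, ← ENNReal.rpow_mul]
  simp

theorem enorm_sq_eq_sum (ξ : Sp n) : ‖ξ‖ₑ ^ 2 = ∑ i, ‖ξ i‖ₑ ^ 2 := by
  have h : ‖ξ‖ ^ 2 = ∑ i, ‖ξ i‖ ^ 2 := EuclideanSpace.norm_sq_eq ξ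
  simp only [← ofReal_norm, ← ENNReal.ofReal_pow (norm_nonneg _)]
  rw [h, ENNReal.ofReal_sum_of_nonneg fun i _ => by positivity]

theorem enorm_two_pi_I : (1 : ℝ≥0∞) ≤ ‖2 * (Real.pi : ℂ) * Complex.I‖ₑ := by
  rw [← ofReal_norm, ENNReal.one_le_ofReal]
  simp only [norm_mul, Complex.norm_I, mul_one, Complex.norm_real, Real.norm_eq_abs,
    abs_of_pos Real.pi_pos, Complex.norm_ofNat]
  linarith [Real.pi_gt_three]

/-- Plancherel for each partial derivative. The factor `2π ≥ 1` of the symbol is discarded. -/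
theorem lintegral_mul_fourier_le {φ : Sp n → ℝ} (hφ : IsTest φ) :
    (∫⁻ ξ, (‖ξ‖ₑ * ‖𝓕 (fun x => (φ x : ℂ)) ξ‖ₑ) ^ 2) ^ (1 / 2 : ℝ) ≤ gradNorm φ := by
  refine ENNReal.rpow_le_rpow ?_ (by norm_num)
  have hc := hφ.ofReal.continuous_fourier
  simp_rw [mul_pow, enorm_sq_eq_sum, Finset.sum_mul]
  rw [lintegral_finsetSum']
  · refine Finset.sum_le_sum fun i _ => ?_
    have h1 := lintegral_fourier_sq (hφ.ofReal.integrable_fderiv (e i))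
      (hφ.ofReal.memLp_fderiv (e i) 2)
    have h2 : eLpNorm (fun x => fderiv ℝ (fun y => (φ y : ℂ)) x (e i)) 2 volume =
        eLpNorm (fun x => fderiv ℝ φ x (e i)) 2 volume := by
      simp_rw [fderiv_ofReal hφ]
      refine eLpNorm_congr_norm_ae (Eventually.of_forall fun x => ?_)
      simp
    rw [← h2, ← h1]
    refine lintegral_mono fun ξ => ?_
    rw [fourier_fderiv_apply hφ.ofReal, enorm_mul, enorm_mul, mul_pow, mul_pow]
    have h3 : ‖((ξ i : ℝ) : ℂ)‖ₑ = ‖ξ i‖ₑ := by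
      rw [← ofReal_norm, ← ofReal_norm, Complex.norm_real]
    rw [h3]
    gcongr
    exact le_mul_of_one_le_left zero_le (one_le_pow₀ enorm_two_pi_I)
  · intro i _
    have h4 : Continuous fun ξ : Sp n => ξ i := by fun_prop
    exact (h4.enorm.measurable.pow_const 2).aemeasurable.mul (hc.enorm.measurable.pow_const 2).aemeasurable

/-- This is the gain from the Coulomb condition: `z` is orthogonal to `ζ`, so pairing it with `η`
is, up to sign, pairing it with `ζ - η`. The smaller of the two frequencies can be used. -/
theorem norm_sum_conj_le {z : Fin n → ℂ} {ζ η : Sp n} (h : ∑ i, (ζ i : ℂ) * z i = 0) :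
    ‖∑ i, starRingEnd ℂ (z i) * (η i : ℂ)‖ₑ ≤ (∑ i, ‖z i‖ₑ) * min ‖η‖ₑ ‖ζ - η‖ₑ := by
  have key : ∀ θ : Sp n, ‖∑ i, starRingEnd ℂ (z i) * (θ i : ℂ)‖ₑ ≤ (∑ i, ‖z i‖ₑ) * ‖θ‖ₑ := by
    intro θ
    refine (enorm_sum_le _ _).trans ?_
    rw [Finset.sum_mul]
    refine Finset.sum_le_sum fun i _ => ?_
    rw [enorm_mul]
    refine mul_le_mul' (le_of_eq ?_) ?_
    · rw [← ofReal_norm, ← ofReal_norm, RCLike.norm_conj]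
    · rw [← ofReal_norm, ← ofReal_norm, Complex.norm_real]
      exact ENNReal.ofReal_le_ofReal (norm_coord_le θ i)
  rw [mul_min]
  refine le_min (key η) ?_
  have h1 : ∑ i, starRingEnd ℂ (z i) * (η i : ℂ) =
      -∑ i, starRingEnd ℂ (z i) * ((ζ - η) i : ℂ) := by
    have h2 := congrArg (starRingEnd ℂ) h
    simp only [map_sum, map_mul, Complex.conj_ofReal, map_zero] at h2
    simp only [PiLp.sub_apply, Complex.ofReal_sub, mul_sub, Finset.sum_sub_distrib]
    rw [Finset.sum_congr rfl fun i _ => mul_comm (starRingEnd ℂ (z i)) (ζ i : ℂ), h2]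
    ring
  rw [h1, enorm_neg]
  exact key _

/-- Parseval pairs `â_i(ζ)` with the convolution of `φ̂` and the transform of `∂_i χ`, which carries
the factor `2πi η_i`. Summing over `i` before taking absolute values produces `â(ζ)·η`, to which
`norm_sum_conj_le` applies. -/
theorem enorm_sum_integral_le (hs : 1 ≤ s) {a : Fin n → Sp n → ℝ}
    (ha : ∀ i, MemLp (fun x => (a i x : ℂ)) 2 volume) (h : ∀ i, sobolevNorm s (a i) < ⊤)
    (hdiv : ∀ η : Sp n → ℝ, IsTest η → ∑ i, ∫ x, fderiv ℝ η x (e i) * a i x = 0)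
    {φ χ : Sp n → ℝ} (hφ : IsTest φ) (hχ : IsTest χ) :
    ‖∑ i, ∫ x, a i x * (φ x * fderiv ℝ χ x (e i))‖ₑ ≤ ‖2 * (Real.pi : ℂ) * Complex.I‖ₑ *
      ∫⁻ ζ, ∫⁻ η, (∑ i, ‖ft (ha i) ζ‖ₑ) * ‖𝓕 (fun x => (φ x : ℂ)) (ζ - η)‖ₑ *
        ‖𝓕 (fun x => (χ x : ℂ)) η‖ₑ * min ‖η‖ₑ ‖ζ - η‖ₑ := by
  let φ' : Sp n → ℂ := fun x => (φ x : ℂ)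
  let χ' : Sp n → ℂ := fun x => (χ x : ℂ)
  have hφ' : IsTest φ' := hφ.ofReal
  have hχ' : IsTest χ' := hχ.ofReal
  let w : Fin n → Sp n → ℂ := fun i x => fderiv ℝ χ' x (e i)
  have hw : ∀ i, Continuous (w i) := fun i => hχ'.continuous_fderiv (e i)
  have hw' : ∀ i, HasCompactSupport (w i) := fun i => hχ'.hasCompactSupport_fderiv (e i)
  have hpc : ∀ i, Continuous fun x => φ' x * w i x := fun i => hφ'.1.continuous.mul (hw i)
  have hps : ∀ i, HasCompactSupport fun x => φ' x * w i x := fun i => (hw' i).mul_left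
  have hp1 : ∀ i, Integrable fun x => φ' x * w i x := fun i =>
    (hpc i).integrable_of_hasCompactSupport (hps i)
  have hp2 : ∀ i, MemLp (fun x => φ' x * w i x) 2 volume := fun i =>
    (hpc i).memLp_of_hasCompactSupport (hps i)
  have h1 : ∀ i, ((∫ x, a i x * (φ x * fderiv ℝ χ x (e i)) : ℝ) : ℂ) =
      ∫ ζ, starRingEnd ℂ (ft (ha i) ζ) * 𝓕 (fun x => φ' x * w i x) ζ := by
    intro i
    have h2 : ∫ x, starRingEnd ℂ (a i x : ℂ) * (φ' x * w i x) =
        ∫ ζ, starRingEnd ℂ (ft (ha i) ζ) * 𝓕 (fun x => φ' x * w i x) ζ :=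
      integral_conj_mul_eq (ha i) (hp2 i) (hp1 i)
    rw [← h2, ← integral_complex_ofReal]
    refine integral_congr_ae (Eventually.of_forall fun x => ?_)
    simp only [φ', w, χ', fderiv_ofReal hχ, Complex.conj_ofReal, Complex.ofReal_mul]
  have h2 : ∀ i, Integrable fun ζ =>
      starRingEnd ℂ (ft (ha i) ζ) * 𝓕 (fun x => φ' x * w i x) ζ := by
    intro i
    have : MemLp (fun ζ => starRingEnd ℂ (ft (ha i) ζ)) 2 volume := (Lp.memLp _).star
    exact memLp_one_iff_integrable.1 ((memLp_fourier (hp1 i) (hp2 i)).mul this)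
  have h3 : ‖∑ i, ∫ x, a i x * (φ x * fderiv ℝ χ x (e i))‖ₑ =
      ‖∫ ζ, ∑ i, starRingEnd ℂ (ft (ha i) ζ) * 𝓕 (fun x => φ' x * w i x) ζ‖ₑ := by
    rw [integral_finsetSum _ fun i _ => h2 i, ← Finset.sum_congr rfl fun i _ => h1 i,
      ← Complex.ofReal_sum, ← ofReal_norm, ← ofReal_norm, Complex.norm_real]
  rw [h3, ← lintegral_const_mul' _ _ enorm_ne_top]
  refine (enorm_integral_le_lintegral_enorm _).trans (lintegral_mono_ae ?_)
  filter_upwards [sum_mul_ft_eq_zero hs ha h hdiv] with ζ hζ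
  have h4 : ∀ i, Integrable fun η =>
      starRingEnd ℂ (ft (ha i) ζ) * (𝓕 φ' (ζ - η) * 𝓕 (w i) η) := by
    intro i
    have h5 : MemLp (fun η => 𝓕 φ' (ζ - η)) 2 volume :=
      (memLp_fourier hφ'.integrable (hφ'.memLp 2)).comp_measurePreserving
        (Measure.measurePreserving_sub_left volume ζ)
    have h6 : MemLp (𝓕 (w i)) 2 volume :=
      memLp_fourier (hχ'.integrable_fderiv _) (hχ'.memLp_fderiv _ 2)
    exact (memLp_one_iff_integrable.1 (h6.mul h5)).const_mul _
  have h5 : ∑ i, starRingEnd ℂ (ft (ha i) ζ) * 𝓕 (fun x => φ' x * w i x) ζ =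
      ∫ η, 2 * (Real.pi : ℂ) * Complex.I * (𝓕 φ' (ζ - η) * 𝓕 χ' η *
        ∑ i, starRingEnd ℂ (ft (ha i) ζ) * (η i : ℂ)) := by
    simp_rw [fourier_mul_eq hφ' (hw _) (hw' _), ← integral_const_mul]
    rw [← integral_finsetSum _ fun i _ => h4 i]
    refine integral_congr_ae (Eventually.of_forall fun η => ?_)
    simp only [w, fourier_fderiv_apply hχ', Finset.mul_sum]
    exact Finset.sum_congr rfl fun i _ => by ring
  rw [h5, integral_const_mul, enorm_mul]
  gcongr
  refine (enorm_integral_le_lintegral_enorm _).trans (lintegral_mono fun η => ?_)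
  rw [enorm_mul, enorm_mul]
  calc _ ≤ ‖𝓕 φ' (ζ - η)‖ₑ * ‖𝓕 χ' η‖ₑ * ((∑ i, ‖ft (ha i) ζ‖ₑ) * min ‖η‖ₑ ‖ζ - η‖ₑ) := by
        gcongr
        exact norm_sum_conj_le hζ
    _ = _ := by ring

/-- The trilinear estimate for divergence free fields. -/
theorem exists_trilinear_bound (hn : 2 ≤ n) (hs : (n : ℝ) / 2 < s) :
    ∃ C : ℝ≥0∞, C ≠ ⊤ ∧ ∀ {a : Fin n → Sp n → ℝ}, (∀ i, sobolevNorm s (a i) < ⊤) →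
      (∀ η : Sp n → ℝ, IsTest η → ∑ i, ∫ x, fderiv ℝ η x (e i) * a i x = 0) →
      ∀ {φ χ : Sp n → ℝ}, IsTest φ → IsTest χ →
        ‖∑ i, ∫ x, a i x * (φ x * fderiv ℝ χ x (e i))‖ₑ ≤
          C * (∑ i, sobolevNorm s (a i)) * gradNorm φ * gradNorm χ := by
  have hs1 : 1 ≤ s := by
    have : (2 : ℝ) ≤ n := by exact_mod_cast hn
    linarith
  obtain ⟨C, hC, hb⟩ := exists_lintegral_min_le hn hs
  refine ⟨‖2 * (Real.pi : ℂ) * Complex.I‖ₑ * C, ENNReal.mul_ne_top enorm_ne_top hC,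
    fun {a} h hdiv {φ χ} hφ hχ => ?_⟩
  have ha : ∀ i, MemLp (fun x => (a i x : ℂ)) 2 volume := fun i =>
    memLp_of_sobolevNorm_lt_top (h i)
  refine (enorm_sum_integral_le hs1 ha h hdiv hφ hχ).trans ?_
  simp only [mul_assoc (‖2 * (Real.pi : ℂ) * Complex.I‖ₑ)]
  gcongr ‖2 * (Real.pi : ℂ) * Complex.I‖ₑ * ?_
  have hp : Measurable fun ξ => ‖𝓕 (fun x => (φ x : ℂ)) ξ‖ₑ :=
    hφ.ofReal.continuous_fourier.measurable.enorm
  have hq : Measurable fun ξ => ‖𝓕 (fun x => (χ x : ℂ)) ξ‖ₑ :=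
    hχ.ofReal.continuous_fourier.measurable.enorm
  have hF : ∀ i, Measurable fun ξ => ‖ft (ha i) ξ‖ₑ := fun i =>
    (Lp.stronglyMeasurable (ft (ha i))).measurable.enorm
  have hk : ∀ i, Measurable (Function.uncurry fun ζ η : Sp n => ‖ft (ha i) ζ‖ₑ *
      ‖𝓕 (fun x => (φ x : ℂ)) (ζ - η)‖ₑ * ‖𝓕 (fun x => (χ x : ℂ)) η‖ₑ *
        min ‖η‖ₑ ‖ζ - η‖ₑ) := by
    intro i
    have h1 : Measurable fun z : Sp n × Sp n => ‖ft (ha i) z.1‖ₑ := (hF i).comp measurable_fst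
    have h2 : Measurable fun z : Sp n × Sp n => ‖𝓕 (fun x => (φ x : ℂ)) (z.1 - z.2)‖ₑ :=
      hp.comp (measurable_fst.sub measurable_snd)
    have h3 : Measurable fun z : Sp n × Sp n => ‖𝓕 (fun x => (χ x : ℂ)) z.2‖ₑ :=
      hq.comp measurable_snd
    have h4 : Measurable fun z : Sp n × Sp n => min ‖z.2‖ₑ ‖z.1 - z.2‖ₑ :=
      measurable_snd.enorm.min (measurable_fst.sub measurable_snd).enorm
    exact ((h1.mul h2).mul h3).mul h4
  have hsum : ∫⁻ ζ, ∫⁻ η, (∑ i, ‖ft (ha i) ζ‖ₑ) * ‖𝓕 (fun x => (φ x : ℂ)) (ζ - η)‖ₑ *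
        ‖𝓕 (fun x => (χ x : ℂ)) η‖ₑ * min ‖η‖ₑ ‖ζ - η‖ₑ =
      ∑ i, ∫⁻ ζ, ∫⁻ η, ‖ft (ha i) ζ‖ₑ * ‖𝓕 (fun x => (φ x : ℂ)) (ζ - η)‖ₑ *
        ‖𝓕 (fun x => (χ x : ℂ)) η‖ₑ * min ‖η‖ₑ ‖ζ - η‖ₑ := by
    rw [← lintegral_finsetSum _ fun i _ => (hk i).lintegral_prod_right]
    refine lintegral_congr fun ζ => ?_
    rw [← lintegral_finsetSum _ fun i _ => (hk i).of_uncurry_left]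
    simp only [Finset.sum_mul]
  rw [hsum, Finset.mul_sum, Finset.sum_mul, Finset.sum_mul]
  refine Finset.sum_le_sum fun i _ => (hb (hF i) hp hq).trans ?_
  rw [← sobolevNorm_eq_lintegral (ha i)]
  gcongr
  · exact lintegral_mul_fourier_le hφ
  · exact lintegral_mul_fourier_le hχ

end Trilinear

/-! ### Coercivity of the covariant derivative near the flat connection. -/

section Coulomb

/-- The gradient of a function as a one-form. -/
noncomputable def gradForm (ψ : Section' n d) : Form n d := fun i x => fderiv ℝ ψ x (e i)

/-- The one-form `[A_i, u]`. -/
noncomputable def brForm (S : GaugeGroup N d) (A : Form n d) (u : Section' n d) : Form n d :=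
  fun i x => S.br (A i x) (u x)

theorem IsTest.formL2_gradForm {ψ : Section' n d} (hψ : IsTest ψ) : FormL2 (gradForm ψ) :=
  fun i => hψ.memLp_fderiv (e i) 2

theorem FormL2.brForm (S : GaugeGroup N d) {A : Form n d} (hA : FormL2 A) {ψ : Section' n d}
    (hψ : IsTest ψ) : FormL2 (brForm S A ψ) :=
  fun i => memLp_br S (hA i) (hψ.memLp ⊤)

theorem toH_covDC (S : GaugeGroup N d) {A : Form n d} (hA : FormL2 A) {ψ : Section' n d}
    (hψ : IsTest ψ) : toH (covDC S A ψ) (hA.covDC S hψ) =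
      toH (gradForm ψ) hψ.formL2_gradForm + toH (brForm S A ψ) (hA.brForm S hψ) :=
  toH_add hψ.formL2_gradForm (hA.brForm S hψ)

theorem IsTest.coord {ψ : Section' n d} (hψ : IsTest ψ) (P : Fin d) :
    IsTest fun x => ψ x P :=
  hψ.clm (EuclideanSpace.proj P : Alg d →L[ℝ] ℝ)

theorem fderiv_coord {ψ : Section' n d} (hψ : IsTest ψ) (P : Fin d) (x v : Sp n) :
    fderiv ℝ (fun y => ψ y P) x v = fderiv ℝ ψ x v P := by
  have h1 : HasFDerivAt ψ (fderiv ℝ ψ x) x := (hψ.1.differentiable (by simp) x).hasFDerivAt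
  have h2 : HasFDerivAt (fun y => ψ y P)
      ((EuclideanSpace.proj P : Alg d →L[ℝ] ℝ).comp (fderiv ℝ ψ x)) x :=
    (EuclideanSpace.proj P : Alg d →L[ℝ] ℝ).hasFDerivAt.comp x h1
  rw [h2.fderiv]
  rfl

theorem IsCoulomb.coord {X : Form n d} (hX : FormL2 X) (h : IsCoulomb X) (P : Fin d)
    {η : Sp n → ℝ} (hη : IsTest η) : ∑ i, ∫ x, fderiv ℝ η x (e i) * X i x P = 0 := by
  have h1 := congrArg (fun v : Alg d => v P) (h η hη)
  simp only [WithLp.ofLp_sum, Finset.sum_apply, PiLp.zero_apply] at h1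
  rw [← h1]
  refine Finset.sum_congr rfl fun i _ => ?_
  have := (EuclideanSpace.proj P : Alg d →L[ℝ] ℝ).integral_comp_comm
    (integrable_test_smul (hη.continuous_fderiv (e i)) (hη.hasCompactSupport_fderiv (e i))
      ((hX i).locallyIntegrable (by norm_num)))
  simpa using this

/-- Divergence free forms are orthogonal to gradients of test functions. -/
theorem IsCoulomb.inner_gradForm {X : Form n d} (hX : FormL2 X) (h : IsCoulomb X)
    {ψ : Section' n d} (hψ : IsTest ψ) :
    inner ℝ (toH X hX) (toH (gradForm ψ) hψ.formL2_gradForm) = 0 := by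
  rw [inner_toH]
  have hint : ∀ i P, Integrable fun x => fderiv ℝ (fun y => ψ y P) x (e i) * X i x P := by
    intro i P
    exact memLp_one_iff_integrable.1
      (((hX i).eval_piLp P).mul ((hψ.coord P).memLp_fderiv (e i) 2))
  have h1 : ∀ i, ∫ x, inner ℝ (X i x) (gradForm ψ i x) =
      ∑ P, ∫ x, fderiv ℝ (fun y => ψ y P) x (e i) * X i x P := by
    intro i
    rw [← integral_finsetSum _ fun P _ => hint i P]
    refine integral_congr_ae (Eventually.of_forall fun x => ?_)
    simp only [PiLp.inner_apply, gradForm, fderiv_coord hψ]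
    simp
  simp_rw [h1]
  rw [Finset.sum_comm]
  exact Finset.sum_eq_zero fun P _ => h.coord hX P (hψ.coord P)

theorem norm_sq_toH {X : Form n d} (hX : FormL2 X) :
    ENNReal.ofReal (‖toH X hX‖ ^ 2) = ∑ i, eLpNorm (X i) 2 volume ^ 2 := by
  rw [PiLp.norm_sq_eq_of_L2, ENNReal.ofReal_sum_of_nonneg fun i _ => by positivity]
  refine Finset.sum_congr rfl fun i _ => ?_
  change ENNReal.ofReal (‖(hX i).toLp (X i)‖ ^ 2) = _
  rw [Lp.norm_toLp, ENNReal.ofReal_pow ENNReal.toReal_nonneg, ENNReal.ofReal_toReal (hX i).2.ne]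

theorem gradNorm_coord_le {ψ : Section' n d} (hψ : IsTest ψ) (P : Fin d) :
    gradNorm (fun x => ψ x P) ≤ ENNReal.ofReal ‖toH (gradForm ψ) hψ.formL2_gradForm‖ := by
  have h1 : ENNReal.ofReal ‖toH (gradForm ψ) hψ.formL2_gradForm‖ =
      (ENNReal.ofReal (‖toH (gradForm ψ) hψ.formL2_gradForm‖ ^ 2)) ^ (1 / 2 : ℝ) := by
    rw [ENNReal.ofReal_rpow_of_nonneg (by positivity) (by norm_num), ← Real.sqrt_eq_rpow,
      Real.sqrt_sq (norm_nonneg _)]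
  rw [h1, norm_sq_toH, gradNorm]
  refine ENNReal.rpow_le_rpow (Finset.sum_le_sum fun i _ => ?_) (by norm_num)
  gcongr
  refine eLpNorm_mono fun x => ?_
  rw [fderiv_coord hψ]
  exact PiLp.norm_apply_le _ P

/-- Expanding the bracket in coordinates leaves finitely many scalar trilinear integrals. When `A`
is in Coulomb gauge, each coordinate field `A^Q` is divergence free, so the trilinear estimate
bounds each of them. -/
theorem inner_gradForm_brForm (S : GaugeGroup N d) {A : Form n d} (hA : FormL2 A)
    {ψ : Section' n d} (hψ : IsTest ψ) :
    inner ℝ (toH (gradForm ψ) hψ.formL2_gradForm) (toH (brForm S A ψ) (hA.brForm S hψ)) =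
      ∑ P, ∑ Q, ∑ R, S.f P Q R *
        ∑ i, ∫ x, A i x Q * (ψ x R * fderiv ℝ (fun y => ψ y P) x (e i)) := by
  have hint : ∀ i P Q R, Integrable fun x => S.f P Q R *
      (A i x Q * (ψ x R * fderiv ℝ (fun y => ψ y P) x (e i))) := by
    intro i P Q R
    have h1 : MemLp (fun x => ψ x R * fderiv ℝ (fun y => ψ y P) x (e i)) 2 volume :=
      ((hψ.coord P).memLp_fderiv (e i) 2).mul ((hψ.coord R).memLp ⊤)
    have h2 := memLp_one_iff_integrable.1 (h1.mul ((hA i).eval_piLp Q))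
    exact h2.const_mul _
  rw [inner_toH]
  have h1 : ∀ i, ∫ x, inner ℝ (gradForm ψ i x) (brForm S A ψ i x) =
      ∑ P, ∑ Q, ∑ R, S.f P Q R *
        ∫ x, A i x Q * (ψ x R * fderiv ℝ (fun y => ψ y P) x (e i)) := by
    intro i
    simp_rw [← integral_const_mul]
    rw [Finset.sum_congr rfl fun P _ => Finset.sum_congr rfl fun Q _ =>
      (integral_finsetSum _ fun R _ => hint i P Q R).symm,
      Finset.sum_congr rfl fun P _ => (integral_finsetSum _ fun Q _ =>
        integrable_finsetSum _ fun R _ => hint i P Q R).symm,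
      ← integral_finsetSum _ fun P _ => integrable_finsetSum _ fun Q _ =>
        integrable_finsetSum _ fun R _ => hint i P Q R]
    refine integral_congr_ae (Eventually.of_forall fun x => ?_)
    simp only [PiLp.inner_apply, gradForm, brForm, GaugeGroup.br_apply, fderiv_coord hψ]
    refine Finset.sum_congr rfl fun P _ => ?_
    simp only [RCLike.inner_apply, conj_trivial, Finset.sum_mul]
    exact Finset.sum_congr rfl fun Q _ => Finset.sum_congr rfl fun R _ => by ring
  simp_rw [h1]
  rw [Finset.sum_comm]
  refine Finset.sum_congr rfl fun P _ => ?_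
  rw [Finset.sum_comm]
  refine Finset.sum_congr rfl fun Q _ => ?_
  rw [Finset.sum_comm]
  exact Finset.sum_congr rfl fun R _ => (Finset.mul_sum _ _ _).symm

theorem NearFlat.inHs {s ε : ℝ} {A : Form n d} (h : NearFlat s ε A) : InHs s A :=
  fun i P => (h i P).trans ENNReal.ofReal_lt_top

/-- The hypothesis gives `‖g + b‖² ≥ ‖g‖²/2 + ‖b‖²`. Only the gradient appears on its right, so `b`
needs no a priori bound by `g`. -/
theorem norm_sq_add_norm_sq_le {E : Type*} [NormedAddCommGroup E] [InnerProductSpace ℝ E]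
    {g b : E} (h : |inner ℝ g b| ≤ 1 / 4 * ‖g‖ ^ 2) :
    ‖g‖ ^ 2 + ‖b‖ ^ 2 ≤ 2 * ‖g + b‖ ^ 2 := by
  rw [norm_add_sq_real]
  have h5 := (abs_le.1 h).1
  nlinarith [sq_nonneg ‖b‖]

theorem abs_inner_gradForm_brForm_le (S : GaugeGroup N d) {A : Form n d} (hA : FormL2 A)
    {ψ : Section' n d} (hψ : IsTest ψ) {c : ℝ}
    (h : ∀ P Q R, |∑ i, ∫ x, A i x Q * (ψ x R * fderiv ℝ (fun y => ψ y P) x (e i))| ≤ c) :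
    |inner ℝ (toH (gradForm ψ) hψ.formL2_gradForm) (toH (brForm S A ψ) (hA.brForm S hψ))| ≤
      (∑ P, ∑ Q, ∑ R, |S.f P Q R|) * c := by
  rw [inner_gradForm_brForm S hA hψ, Finset.sum_mul]
  refine (Finset.abs_sum_le_sum_abs _ _).trans (Finset.sum_le_sum fun P _ => ?_)
  rw [Finset.sum_mul]
  refine (Finset.abs_sum_le_sum_abs _ _).trans (Finset.sum_le_sum fun Q _ => ?_)
  rw [Finset.sum_mul]
  refine (Finset.abs_sum_le_sum_abs _ _).trans (Finset.sum_le_sum fun R _ => ?_)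
  rw [abs_mul]
  exact mul_le_mul_of_nonneg_left (h P Q R) (abs_nonneg _)

theorem abs_le_of_enorm_le {C : ℝ≥0∞} (hC : C ≠ ⊤) {m : ℕ} {x ε g : ℝ} (hε : 0 ≤ ε)
    (hg : 0 ≤ g)
    (h : ‖x‖ₑ ≤ C * (m * ENNReal.ofReal ε) * ENNReal.ofReal g * ENNReal.ofReal g) :
    |x| ≤ C.toReal * m * ε * g ^ 2 := by
  have h5 := ENNReal.toReal_mono (by
    refine ENNReal.mul_ne_top (ENNReal.mul_ne_top (ENNReal.mul_ne_top hC ?_)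
      ENNReal.ofReal_ne_top) ENNReal.ofReal_ne_top
    exact ENNReal.mul_ne_top (ENNReal.natCast_ne_top m) ENNReal.ofReal_ne_top) h
  simp only [ENNReal.toReal_mul, toReal_enorm, Real.norm_eq_abs, ENNReal.toReal_natCast,
    ENNReal.toReal_ofReal hε, ENNReal.toReal_ofReal hg] at h5
  refine h5.trans (le_of_eq ?_)
  ring

theorem exists_pos_mul_le {K c : ℝ} (hK : 0 ≤ K) (hc : 0 ≤ c) :
    ∃ ε : ℝ, 0 < ε ∧ K * (c * ε) ≤ 1 / 4 := by
  refine ⟨1 / (4 * (K * c + 1)), by positivity, ?_⟩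
  rw [← mul_assoc, mul_one_div, div_le_div_iff₀ (by positivity) (by norm_num)]
  nlinarith [mul_nonneg hK hc]

/-- Near the flat connection, in the Coulomb gauge, the covariant derivative of a test function
controls its gradient and its commutator with the connection. -/
theorem exists_coercive (S : GaugeGroup N d) (hn : 2 ≤ n) {s : ℝ} (hs : (n : ℝ) / 2 < s) :
    ∃ ε : ℝ, 0 < ε ∧ ∀ A : Form n d, NearFlat s ε A → IsCoulomb A → ∀ (hA : FormL2 A)
      (ψ : Section' n d) (hψ : IsTest ψ),
      ‖toH (gradForm ψ) hψ.formL2_gradForm‖ ^ 2 + ‖toH (brForm S A ψ) (hA.brForm S hψ)‖ ^ 2 ≤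
        2 * ‖toH (covDC S A ψ) (hA.covDC S hψ)‖ ^ 2 := by
  obtain ⟨C, hC, hb⟩ := exists_trilinear_bound hn hs
  -- The radius makes the sum of the `|f^{PQR}|`, times the trilinear constant, times the bound `n
  -- ε` for the sum of the `n` Sobolev norms, at most `1/4`.
  obtain ⟨ε, hε0, hε⟩ := exists_pos_mul_le (K := ∑ P, ∑ Q, ∑ R, |S.f P Q R|)
    (c := C.toReal * n) (by positivity) (by positivity)
  refine ⟨ε, hε0, fun A hflat hcoul hA ψ hψ => ?_⟩
  have h1 : ∀ P Q R, |∑ i, ∫ x, A i x Q * (ψ x R * fderiv ℝ (fun y => ψ y P) x (e i))| ≤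
      C.toReal * n * ε * ‖toH (gradForm ψ) hψ.formL2_gradForm‖ ^ 2 := by
    intro P Q R
    have h2 := hb (a := fun i x => A i x Q) (fun i => hflat.inHs i Q)
      (fun η hη => hcoul.coord hA Q hη) (hψ.coord R) (hψ.coord P)
    have h3 : (∑ i, sobolevNorm s fun x => A i x Q) ≤ n * ENNReal.ofReal ε := by
      refine (Finset.sum_le_sum fun i _ => (hflat i Q).le).trans ?_
      simp
    refine abs_le_of_enorm_le hC hε0.le (norm_nonneg _) (h2.trans ?_)
    exact mul_le_mul' (mul_le_mul' (mul_le_mul' le_rfl h3) (gradNorm_coord_le hψ R))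
      (gradNorm_coord_le hψ P)
  have h2 := abs_inner_gradForm_brForm_le S hA hψ h1
  rw [toH_covDC S hA hψ]
  refine norm_sq_add_norm_sq_le (h2.trans ?_)
  rw [← mul_assoc]
  exact mul_le_mul_of_nonneg_right hε (sq_nonneg _)

end Coulomb

/-! ### A Poincaré inequality with the mean over the unit ball. -/

section Poincare

theorem norm_fderiv_sq_le {ψ : Section' n d} (x h : Sp n) :
    ‖fderiv ℝ ψ x h‖ₑ ^ 2 ≤ n * ‖h‖ₑ ^ 2 * ∑ i, ‖gradForm ψ i x‖ₑ ^ 2 := by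
  have h1 : h = ∑ i, h i • (e i : Sp n) := by
    ext j
    simp [e, Finset.sum_apply, Pi.single_apply]
  have h2 : ‖fderiv ℝ ψ x h‖ ≤ ‖h‖ * ∑ i, ‖gradForm ψ i x‖ := by
    conv_lhs => rw [h1, map_sum]
    rw [Finset.mul_sum]
    refine (norm_sum_le _ _).trans (Finset.sum_le_sum fun i _ => ?_)
    rw [map_smul, norm_smul]
    exact mul_le_mul_of_nonneg_right (norm_coord_le h i) (norm_nonneg _)
  have h3 : ‖fderiv ℝ ψ x h‖ ^ 2 ≤ n * ‖h‖ ^ 2 * ∑ i, ‖gradForm ψ i x‖ ^ 2 := by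
    have h4 := sq_sum_le_card_mul_sum_sq (s := (Finset.univ : Finset (Fin n)))
      (f := fun i => ‖gradForm ψ i x‖)
    rw [Finset.card_univ, Fintype.card_fin] at h4
    calc ‖fderiv ℝ ψ x h‖ ^ 2 ≤ (‖h‖ * ∑ i, ‖gradForm ψ i x‖) ^ 2 := by gcongr
      _ = ‖h‖ ^ 2 * (∑ i, ‖gradForm ψ i x‖) ^ 2 := by ring
      _ ≤ ‖h‖ ^ 2 * (n * ∑ i, ‖gradForm ψ i x‖ ^ 2) := by gcongr
      _ = _ := by ring
  have h4 := ENNReal.ofReal_le_ofReal h3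
  rw [ENNReal.ofReal_mul (by positivity), ENNReal.ofReal_mul (by positivity),
    ENNReal.ofReal_sum_of_nonneg fun i _ => by positivity] at h4
  simpa only [ENNReal.ofReal_pow (norm_nonneg _), ofReal_norm, ENNReal.ofReal_natCast] using h4

/-- The fundamental theorem of calculus along the segment from `x` to `x + h`, followed by
Cauchy-Schwarz on the unit interval. -/
theorem enorm_sub_sq_le {ψ : Section' n d} (hψ : IsTest ψ) (x h : Sp n) :
    ‖ψ (x + h) - ψ x‖ₑ ^ 2 ≤ ∫⁻ t in Set.Ioc (0 : ℝ) 1, ‖fderiv ℝ ψ (x + t • h) h‖ₑ ^ 2 := by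
  have hd : ∀ t : ℝ, HasDerivAt (fun t : ℝ => ψ (x + t • h)) (fderiv ℝ ψ (x + t • h) h) t := by
    intro t
    have h1 : HasDerivAt (fun t : ℝ => x + t • h) h t := by
      simpa using ((hasDerivAt_id t).smul_const h).const_add x
    exact ((hψ.1.differentiable (by simp) _).hasFDerivAt).comp_hasDerivAt t h1
  have hc : Continuous fun t : ℝ => fderiv ℝ ψ (x + t • h) h :=
    (hψ.continuous_fderiv h).comp (by fun_prop)
  have h1 := intervalIntegral.integral_eq_sub_of_hasDerivAt (fun t _ => hd t)
    (hc.intervalIntegrable 0 1)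
  simp only [one_smul, zero_smul, add_zero] at h1
  rw [← h1, intervalIntegral.integral_of_le zero_le_one]
  have h2 : ‖∫ t in Set.Ioc (0 : ℝ) 1, fderiv ℝ ψ (x + t • h) h‖ₑ ≤
      (∫⁻ t in Set.Ioc (0 : ℝ) 1, ‖fderiv ℝ ψ (x + t • h) h‖ₑ ^ 2) ^ (1 / 2 : ℝ) := by
    refine (enorm_integral_le_lintegral_enorm _).trans ?_
    have h3 := lintegral_mul_le_sqrt (volume.restrict (Set.Ioc (0 : ℝ) 1))
      (f := fun t => ‖fderiv ℝ ψ (x + t • h) h‖ₑ) (g := fun _ => 1)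
      hc.enorm.measurable.aemeasurable aemeasurable_const
    simpa using h3
  calc _ ≤ _ := pow_le_pow_left' h2 2
    _ = _ := by
      rw [← ENNReal.rpow_natCast, ← ENNReal.rpow_mul]
      norm_num

theorem ofReal_norm_gradForm_sq {ψ : Section' n d} (hψ : IsTest ψ) :
    ENNReal.ofReal (‖toH (gradForm ψ) hψ.formL2_gradForm‖ ^ 2) =
      ∑ i, ∫⁻ x, ‖gradForm ψ i x‖ₑ ^ 2 := by
  rw [norm_sq_toH]
  refine Finset.sum_congr rfl fun i _ => ?_
  rw [eLpNorm_eq_lintegral_rpow_enorm_toReal (by norm_num) (by norm_num),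
    ← ENNReal.rpow_natCast, ← ENNReal.rpow_mul]
  simp

/-- Integrate `enorm_sub_sq_le` over `x`. After exchanging the integrals, translation invariance
makes the integrand independent of `t`. -/
theorem lintegral_translate_sub_sq_le {ψ : Section' n d} (hψ : IsTest ψ) (h : Sp n) :
    ∫⁻ x, ‖ψ (x + h) - ψ x‖ₑ ^ 2 ≤ n * ‖h‖ₑ ^ 2 *
      ENNReal.ofReal (‖toH (gradForm ψ) hψ.formL2_gradForm‖ ^ 2) := by
  have hc : Continuous fun x => ‖fderiv ℝ ψ x h‖ₑ := (hψ.continuous_fderiv h).enorm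
  calc ∫⁻ x, ‖ψ (x + h) - ψ x‖ₑ ^ 2
      ≤ ∫⁻ x, ∫⁻ t in Set.Ioc (0 : ℝ) 1, ‖fderiv ℝ ψ (x + t • h) h‖ₑ ^ 2 :=
        lintegral_mono fun x => enorm_sub_sq_le hψ x h
    _ = ∫⁻ t in Set.Ioc (0 : ℝ) 1, ∫⁻ x, ‖fderiv ℝ ψ (x + t • h) h‖ₑ ^ 2 := by
        refine lintegral_lintegral_swap ?_
        have h1 : Continuous fun z : Sp n × ℝ => ‖fderiv ℝ ψ (z.1 + z.2 • h) h‖ₑ :=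
          hc.comp (by fun_prop)
        exact (h1.measurable.pow_const 2).aemeasurable
    _ = ∫⁻ _t in Set.Ioc (0 : ℝ) 1, ∫⁻ x, ‖fderiv ℝ ψ x h‖ₑ ^ 2 := by
        refine lintegral_congr fun t => ?_
        exact lintegral_add_right_eq_self (fun x => ‖fderiv ℝ ψ x h‖ₑ ^ 2) (t • h)
    _ = ∫⁻ x, ‖fderiv ℝ ψ x h‖ₑ ^ 2 := by simp
    _ ≤ ∫⁻ x, n * ‖h‖ₑ ^ 2 * ∑ i, ‖gradForm ψ i x‖ₑ ^ 2 :=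
        lintegral_mono fun x => norm_fderiv_sq_le x h
    _ = _ := by
        have hm : ∀ i, Measurable fun x => ‖gradForm ψ i x‖ₑ ^ 2 := fun i =>
          (hψ.continuous_fderiv (e i)).enorm.measurable.pow_const 2
        rw [lintegral_const_mul _ (Finset.measurable_sum _ fun i _ => hm i),
          lintegral_finsetSum _ fun i _ => hm i, ofReal_norm_gradForm_sq hψ]

/-- The double integral over balls in the Poincaré inequality. -/
theorem lintegral_ball_ball_le {ψ : Section' n d} (hψ : IsTest ψ) (R : ℝ) :
    ∫⁻ x in Metric.ball 0 R, ∫⁻ y in Metric.ball (0 : Sp n) 1, ‖ψ x - ψ y‖ₑ ^ 2 ≤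
      volume (Metric.ball (0 : Sp n) (R + 1)) * (n * ENNReal.ofReal (R + 1) ^ 2 *
        ENNReal.ofReal (‖toH (gradForm ψ) hψ.formL2_gradForm‖ ^ 2)) := by
  have hc : Continuous fun z : Sp n × Sp n => ‖ψ (z.1 + z.2) - ψ z.1‖ₑ :=
    ((hψ.1.continuous.comp (by fun_prop)).sub (hψ.1.continuous.comp continuous_fst)).enorm
  -- Substitute `y = x + h`. With `|x| < R` and `|y| < 1` the increment lies in the ball of radius
  -- `R + 1`, so the translation estimate applies for each `h`.
  calc _ ≤ ∫⁻ x in Metric.ball 0 R, ∫⁻ h in Metric.ball (0 : Sp n) (R + 1),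
        ‖ψ (x + h) - ψ x‖ₑ ^ 2 := by
        refine setLIntegral_mono' Metric.isOpen_ball.measurableSet fun x hx => ?_
        rw [← lintegral_indicator Metric.isOpen_ball.measurableSet,
          ← lintegral_indicator Metric.isOpen_ball.measurableSet,
          ← lintegral_add_left_eq_self _ x]
        refine lintegral_mono fun h => ?_
        by_cases h1 : x + h ∈ Metric.ball (0 : Sp n) 1
        · have h2 : h ∈ Metric.ball (0 : Sp n) (R + 1) := by
            rw [mem_ball_zero_iff] at h1 hx ⊢
            calc ‖h‖ = ‖(x + h) - x‖ := by rw [add_sub_cancel_left]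
              _ ≤ ‖x + h‖ + ‖x‖ := norm_sub_le _ _
              _ < R + 1 := by linarith
          rw [Set.indicator_of_mem h1, Set.indicator_of_mem h2, ← enorm_neg, neg_sub]
        · rw [Set.indicator_of_notMem h1]
          exact zero_le
    _ ≤ ∫⁻ x, ∫⁻ h in Metric.ball (0 : Sp n) (R + 1), ‖ψ (x + h) - ψ x‖ₑ ^ 2 :=
        setLIntegral_le_lintegral _ _
    _ = ∫⁻ h in Metric.ball (0 : Sp n) (R + 1), ∫⁻ x, ‖ψ (x + h) - ψ x‖ₑ ^ 2 :=
        lintegral_lintegral_swap (hc.measurable.pow_const 2).aemeasurable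
    _ ≤ ∫⁻ _h in Metric.ball (0 : Sp n) (R + 1), (n * ENNReal.ofReal (R + 1) ^ 2 *
        ENNReal.ofReal (‖toH (gradForm ψ) hψ.formL2_gradForm‖ ^ 2)) := by
        refine setLIntegral_mono' Metric.isOpen_ball.measurableSet fun h hh => ?_
        refine (lintegral_translate_sub_sq_le hψ h).trans ?_
        gcongr
        rw [← ofReal_norm]
        exact ENNReal.ofReal_le_ofReal (mem_ball_zero_iff.1 hh).le
    _ = _ := by rw [setLIntegral_const, mul_comm]

theorem enorm_smul_sub_integral_sq_le {ψ : Section' n d} (hψ : IsTest ψ) (x : Sp n) :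
    ‖volume.real (Metric.ball (0 : Sp n) 1) • ψ x - ∫ y in Metric.ball (0 : Sp n) 1, ψ y‖ₑ ^ 2 ≤
      volume (Metric.ball (0 : Sp n) 1) *
        ∫⁻ y in Metric.ball (0 : Sp n) 1, ‖ψ x - ψ y‖ₑ ^ 2 := by
  have hfin : volume (Metric.ball (0 : Sp n) 1) ≠ ⊤ := measure_ball_lt_top.ne
  have h1 : volume.real (Metric.ball (0 : Sp n) 1) • ψ x - ∫ y in Metric.ball (0 : Sp n) 1, ψ y =
      ∫ y in Metric.ball (0 : Sp n) 1, (ψ x - ψ y) := by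
    have hk : IntegrableOn (fun _ => ψ x) (Metric.ball (0 : Sp n) 1) :=
      integrableOn_const hfin (by simp)
    rw [integral_sub hk hψ.integrable.integrableOn, setIntegral_const]
  have h2 : ‖∫ y in Metric.ball (0 : Sp n) 1, (ψ x - ψ y)‖ₑ ≤
      (∫⁻ y in Metric.ball (0 : Sp n) 1, ‖ψ x - ψ y‖ₑ ^ 2) ^ (1 / 2 : ℝ) *
        (volume (Metric.ball (0 : Sp n) 1)) ^ (1 / 2 : ℝ) := by
    refine (enorm_integral_le_lintegral_enorm _).trans ?_
    have h3 := lintegral_mul_le_sqrt (volume.restrict (Metric.ball (0 : Sp n) 1))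
      (f := fun y => ‖ψ x - ψ y‖ₑ) (g := fun _ => 1)
      (continuous_const.sub hψ.1.continuous).enorm.measurable.aemeasurable aemeasurable_const
    simpa using h3
  rw [h1]
  calc _ ≤ _ := pow_le_pow_left' h2 2
    _ = _ := by
      rw [mul_pow, ← ENNReal.rpow_natCast, ← ENNReal.rpow_mul, ← ENNReal.rpow_natCast,
        ← ENNReal.rpow_mul, mul_comm]
      norm_num

/-- Poincaré's inequality: the `L²` norm on a ball is controlled by the gradient and the integral
over the unit ball. -/
theorem exists_poincare (n d : ℕ) (R : ℝ) :
    ∃ C : ℝ≥0∞, C ≠ ⊤ ∧ ∀ (ψ : Section' n d) (hψ : IsTest ψ),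
    eLpNorm ψ 2 (volume.restrict (Metric.ball 0 R)) ≤
      C * (ENNReal.ofReal ‖toH (gradForm ψ) hψ.formL2_gradForm‖ +
        ‖∫ y in Metric.ball (0 : Sp n) 1, ψ y‖ₑ) := by
  set M := volume (Metric.ball (0 : Sp n) 1) with hM
  have hMtop : M ≠ ⊤ := measure_ball_lt_top.ne
  have hM0 : M ≠ 0 := (Metric.measure_ball_pos volume _ one_pos).ne'
  set m := volume.real (Metric.ball (0 : Sp n) 1) with hm
  have hm0 : 0 < m := ENNReal.toReal_pos hM0 hMtop
  set B := M * (volume (Metric.ball (0 : Sp n) (R + 1)) * (n * ENNReal.ofReal (R + 1) ^ 2))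
  have hB : B ≠ ⊤ := ENNReal.mul_ne_top hMtop (ENNReal.mul_ne_top measure_ball_lt_top.ne
    (ENNReal.mul_ne_top (by simp) (by simp)))
  set V := volume (Metric.ball (0 : Sp n) R) with hV
  have hVtop : V ≠ ⊤ := measure_ball_lt_top.ne
  refine ⟨ENNReal.ofReal m⁻¹ * (B ^ (1 / 2 : ℝ) + V ^ (1 / 2 : ℝ)),
    ENNReal.mul_ne_top (by simp) (ENNReal.add_ne_top.2
      ⟨ENNReal.rpow_ne_top_of_nonneg (by norm_num) hB,
        ENNReal.rpow_ne_top_of_nonneg (by norm_num) hVtop⟩), fun ψ hψ => ?_⟩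
  set c := ∫ y in Metric.ball (0 : Sp n) 1, ψ y
  set g := ‖toH (gradForm ψ) hψ.formL2_gradForm‖ with hg
  -- The integral `c` is not divided by the volume `m` of the unit ball. It is compared with `m ψ`,
  -- and `m⁻¹` enters only the final constant.
  have h1 : eLpNorm (fun x => m • ψ x - c) 2 (volume.restrict (Metric.ball 0 R)) ≤
      B ^ (1 / 2 : ℝ) * ENNReal.ofReal g := by
    have hgg : ENNReal.ofReal g = (ENNReal.ofReal (g ^ 2)) ^ (1 / 2 : ℝ) := by
      rw [ENNReal.ofReal_rpow_of_nonneg (by positivity) (by norm_num), ← Real.sqrt_eq_rpow,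
        Real.sqrt_sq (norm_nonneg _)]
    rw [eLpNorm_eq_lintegral_rpow_enorm_toReal (by norm_num) (by norm_num), hgg,
      ← ENNReal.mul_rpow_of_nonneg _ _ (by norm_num)]
    simp only [ENNReal.toReal_ofNat, ENNReal.rpow_ofNat]
    refine ENNReal.rpow_le_rpow ?_ (by norm_num)
    calc ∫⁻ x in Metric.ball 0 R, ‖m • ψ x - c‖ₑ ^ 2
        ≤ ∫⁻ x in Metric.ball 0 R, M * ∫⁻ y in Metric.ball (0 : Sp n) 1, ‖ψ x - ψ y‖ₑ ^ 2 :=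
          lintegral_mono fun x => enorm_smul_sub_integral_sq_le hψ x
      _ = M * ∫⁻ x in Metric.ball 0 R, ∫⁻ y in Metric.ball (0 : Sp n) 1, ‖ψ x - ψ y‖ₑ ^ 2 :=
          lintegral_const_mul' _ _ hMtop
      _ ≤ _ := mul_le_mul_right (lintegral_ball_ball_le hψ R) _
      _ = B * ENNReal.ofReal (g ^ 2) := by simp only [B]; ring
  have h2 : eLpNorm (fun _ : Sp n => c) 2 (volume.restrict (Metric.ball 0 R)) ≤
      V ^ (1 / 2 : ℝ) * ‖c‖ₑ := by
    rw [eLpNorm_const' _ (by norm_num) (by norm_num), Measure.restrict_apply_univ, mul_comm]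
    simp [hV]
  have hcont : Continuous fun x => m • ψ x - c := (hψ.1.continuous.const_smul m).sub continuous_const
  have h3 : ψ = m⁻¹ • ((fun x => m • ψ x - c) + fun _ => c) := by
    ext1 x
    simp [smul_smul, hm0.ne']
  have h4 : eLpNorm ψ 2 (volume.restrict (Metric.ball 0 R)) ≤ ENNReal.ofReal m⁻¹ *
      (B ^ (1 / 2 : ℝ) * ENNReal.ofReal g + V ^ (1 / 2 : ℝ) * ‖c‖ₑ) := by
    conv_lhs => rw [h3]
    rw [eLpNorm_const_smul, ← ofReal_norm, Real.norm_of_nonneg (by positivity)]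
    gcongr
    exact (eLpNorm_add_le hcont.aestronglyMeasurable aestronglyMeasurable_const
      (by norm_num)).trans (add_le_add h1 h2)
  refine h4.trans ?_
  rw [mul_assoc]
  gcongr
  rw [add_mul, mul_add, mul_add]
  exact add_le_add le_self_add le_add_self

end Poincare

/-! ### Limits in `L²_loc`. -/

section LocalLimits

/-- Local `L²` convergence of a sequence. -/
def TendstoL2Loc (f : ℕ → Section' n d) (u : Section' n d) : Prop :=
  ∀ r : ℝ, Tendsto (fun k => eLpNorm (fun x => f k x - u x) 2
    (volume.restrict (Metric.ball 0 r))) atTop (𝓝 0)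

theorem exists_local_limit {f : ℕ → Section' n d}
    (hf : ∀ k (R : ℝ), MemLp (f k) 2 (volume.restrict (Metric.ball 0 R)))
    (hC : ∀ R : ℝ, CauchySeq fun k => (hf k R).toLp (f k)) :
    ∃ u : Section' n d, (∀ R : ℝ, MemLp u 2 (volume.restrict (Metric.ball 0 R))) ∧
      TendstoL2Loc f u := by
  choose g hg using fun m : ℕ => cauchySeq_tendsto_of_complete (hC m)
  have hmono : ∀ {r R : ℝ}, r ≤ R → volume.restrict (Metric.ball (0 : Sp n) r) ≤
      volume.restrict (Metric.ball 0 R) := fun h =>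
    Measure.restrict_mono (Metric.ball_subset_ball h) le_rfl
  have hg' : ∀ m : ℕ, Tendsto (fun k => eLpNorm (fun x => f k x - g m x) 2
      (volume.restrict (Metric.ball 0 (m : ℝ)))) atTop (𝓝 0) := by
    intro m
    have := hg m
    rw [← Lp.toLp_coeFn (g m) (Lp.memLp _)] at this
    exact (Lp.tendsto_Lp_iff_tendsto_eLpNorm'' _ (fun k => hf k m) _ (Lp.memLp (g m))).1 this
  -- The limits on different balls agree almost everywhere on the smaller one, by uniqueness of `L²`
  -- limits.
  have hcompat : ∀ j m : ℕ, j ≤ m → ∀ᵐ x ∂(volume : Measure (Sp n)),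
      x ∈ Metric.ball (0 : Sp n) (j : ℝ) → g m x = g j x := by
    intro j m hjm
    have hle : (j : ℝ) ≤ m := by exact_mod_cast hjm
    have hm : MemLp (g m) 2 (volume.restrict (Metric.ball (0 : Sp n) (j : ℝ))) :=
      (Lp.memLp (g m)).mono_measure (hmono hle)
    have h1 : Tendsto (fun k => (hf k j).toLp (f k)) atTop (𝓝 (hm.toLp (g m))) := by
      refine (Lp.tendsto_Lp_iff_tendsto_eLpNorm'' _ (fun k => hf k j) _ hm).2 ?_
      exact tendsto_of_tendsto_of_tendsto_of_le_of_le tendsto_const_nhds (hg' m)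
        (fun _ => zero_le) fun k => eLpNorm_mono_measure _ (hmono hle)
    have h2 := tendsto_nhds_unique h1 (hg j)
    rw [← ae_restrict_iff' Metric.isOpen_ball.measurableSet]
    have h3 := hm.coeFn_toLp
    rw [h2] at h3
    filter_upwards [h3] with x hx using hx.symm
  -- The limits are glued by using at `x` the smallest integer radius exceeding `|x|`. The `+ 1` is
  -- needed because the balls are open.
  let u : Section' n d := fun x => g (⌊‖x‖⌋₊ + 1) x
  have hu : ∀ m : ℕ, u =ᵐ[volume.restrict (Metric.ball (0 : Sp n) (m : ℝ))] g m := by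
    intro m
    have h1 : ∀ᵐ x ∂(volume : Measure (Sp n)), ∀ j : ℕ, j ≤ m →
        x ∈ Metric.ball (0 : Sp n) (j : ℝ) → g m x = g j x := by
      rw [ae_all_iff]
      intro j
      by_cases hj : j ≤ m
      · filter_upwards [hcompat j m hj] with x hx _ using hx
      · exact Eventually.of_forall fun x h => absurd h hj
    rw [EventuallyEq, ae_restrict_iff' Metric.isOpen_ball.measurableSet]
    filter_upwards [h1] with x hx hxm
    rw [mem_ball_zero_iff] at hxm
    have h2 : ⌊‖x‖⌋₊ < m := (Nat.floor_lt (norm_nonneg _)).2 hxm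
    refine (hx (⌊‖x‖⌋₊ + 1) h2 ?_).symm
    rw [mem_ball_zero_iff]
    exact_mod_cast Nat.lt_floor_add_one ‖x‖
  refine ⟨u, fun R => ?_, fun R => ?_⟩
  · have hle := Nat.le_ceil R
    exact ((memLp_congr_ae (hu ⌈R⌉₊)).2 (Lp.memLp (g ⌈R⌉₊))).mono_measure (hmono hle)
  · have hle := Nat.le_ceil R
    refine tendsto_of_tendsto_of_tendsto_of_le_of_le tendsto_const_nhds (hg' ⌈R⌉₊)
      (fun _ => zero_le) fun k => ?_
    refine (eLpNorm_mono_measure _ (hmono hle)).trans (le_of_eq (eLpNorm_congr_ae ?_))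
    filter_upwards [hu ⌈R⌉₊] with x hx
    rw [hx]

theorem tendsto_integral_compactSupport {E G : Type*} [NormedAddCommGroup E] [NormedSpace ℝ E]
    [NormedAddCommGroup G] [NormedSpace ℝ G] [CompleteSpace G] (B : E →L[ℝ] Alg d →L[ℝ] G)
    {w : Sp n → E} (hw : MemLp w 2 volume) (hw' : HasCompactSupport w)
    {f : ℕ → Section' n d} (hf : ∀ k, MemLp (f k) 2 volume) {u : Section' n d}
    (hu : ∀ R : ℝ, MemLp u 2 (volume.restrict (Metric.ball 0 R))) (h : TendstoL2Loc f u) :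
    Tendsto (fun k => ∫ x, B (w x) (f k x)) atTop (𝓝 (∫ x, B (w x) (u x))) := by
  obtain ⟨r, -, hr⟩ := exists_ball_of_hasCompactSupport hw'
  have h0 : ∀ v : Section' n d, ∫ x in Metric.ball 0 r, B (w x) (v x) = ∫ x, B (w x) (v x) := by
    intro v
    refine setIntegral_eq_integral_of_forall_compl_eq_zero fun x hx => ?_
    rw [image_eq_zero_of_notMem_tsupport fun hx' => hx (hr hx'), map_zero, zero_apply]
  have h1 := tendsto_integral_bilin B (hw.restrict (Metric.ball 0 r))
    (fun k => (hf k).restrict (Metric.ball 0 r)) (hu r) (h r)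
  rw [h0] at h1
  exact h1.congr fun k => h0 (f k)

end LocalLimits

/-! ### Closedness of the range of the covariant derivative, and solution of the Gauss law. -/

section Completeness

variable (S : GaugeGroup N d) {A : Form n d}

/-- The integral over the unit ball, as a linear map. -/
noncomputable def avgLin (n d : ℕ) : testSpace n d →ₗ[ℝ] Alg d where
  toFun ψ := ∫ x in Metric.ball (0 : Sp n) 1, (ψ : Section' n d) x
  map_add' ψ χ := integral_add ψ.2.integrable.integrableOn χ.2.integrable.integrableOn
  map_smul' c _ := integral_smul c _

/-- The commutator with the connection as a linear map into the Hilbert space of forms. -/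
noncomputable def brLin (hA : FormL2 A) : testSpace n d →ₗ[ℝ] FormH n d where
  toFun ψ := toH (brForm S A ψ) (hA.brForm S ψ.2)
  map_add' ψ χ := by
    rw [← toH_add, toH_eq_iff]
    refine fun i => Eventually.of_forall fun x => ?_
    simp only [brForm, Submodule.coe_add, Pi.add_apply, ← S.brL_apply, map_add]
  map_smul' c ψ := by
    rw [RingHom.id_apply, ← toH_const_smul, toH_eq_iff]
    refine fun i => Eventually.of_forall fun x => ?_
    simp only [brForm, Submodule.coe_smul, Pi.smul_apply, ← S.brL_apply, map_smul]

/-- The inequality of `exists_coercive`. -/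
def Coercive (hA : FormL2 A) : Prop := ∀ (ψ : Section' n d) (hψ : IsTest ψ),
  ‖toH (gradForm ψ) hψ.formL2_gradForm‖ ^ 2 + ‖toH (brForm S A ψ) (hA.brForm S hψ)‖ ^ 2 ≤
    2 * ‖toH (covDC S A ψ) (hA.covDC S hψ)‖ ^ 2

variable {S}

/-- Drop the other square from the coercive inequality and round `√2` up to `2`. -/
theorem Coercive.norm_gradForm_le {hA : FormL2 A} (h : Coercive S hA) (ψ : testSpace n d) :
    ‖toH (gradForm (ψ : Section' n d)) (IsTest.formL2_gradForm ψ.2)‖ ≤ 2 * ‖covLin S hA ψ‖ := by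
  have h1 : _ ≤ 2 * ‖covLin S hA ψ‖ ^ 2 := h ψ ψ.2
  refine abs_le_of_sq_le_sq' ?_ (by positivity) |>.2
  nlinarith [sq_nonneg ‖toH (brForm S A (ψ : Section' n d)) (hA.brForm S ψ.2)‖,
    sq_nonneg ‖covLin S hA ψ‖]

theorem Coercive.norm_brLin_le {hA : FormL2 A} (h : Coercive S hA) (ψ : testSpace n d) :
    ‖brLin S hA ψ‖ ≤ 2 * ‖covLin S hA ψ‖ := by
  have h1 : _ + ‖brLin S hA ψ‖ ^ 2 ≤ 2 * ‖covLin S hA ψ‖ ^ 2 := h ψ ψ.2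
  refine abs_le_of_sq_le_sq' ?_ (by positivity) |>.2
  nlinarith [sq_nonneg ‖toH (gradForm (ψ : Section' n d)) (IsTest.formL2_gradForm ψ.2)‖,
    sq_nonneg ‖covLin S hA ψ‖]

/-- Every element of the closure is a limit of covariant derivatives of test functions with
convergent integrals over the unit ball. -/
theorem exists_seq_of_mem_covClosure (hA : FormL2 A) {F : FormH n d} (hF : F ∈ covClosure S hA) :
    ∃ (ψ : ℕ → testSpace n d) (c : Alg d),
      Tendsto (fun k => covLin S hA (ψ k)) atTop (𝓝 F) ∧
        Tendsto (fun k => avgLin n d (ψ k)) atTop (𝓝 c) := by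
  let Λ : testSpace n d →ₗ[ℝ] Alg d × FormH n d := (avgLin n d).prod (covLin S hA)
  let M : Submodule ℝ (Alg d × FormH n d) := (LinearMap.range Λ).topologicalClosure
  let T : Submodule ℝ (Alg d × FormH n d) :=
    LinearMap.range (LinearMap.inl ℝ (Alg d) (FormH n d))
  -- A closed subspace plus a finite-dimensional one is closed. Allowing an arbitrary correction of
  -- the mean therefore still gives a closed space, which contains `(0, F)`, and so some `(c, F)` is
  -- a limit of pairs of mean and covariant derivative. A given sequence tending to `F` need not
  -- have convergent means.
  have hcl : IsClosed ((M ⊔ T : Submodule ℝ (Alg d × FormH n d)) : Set (Alg d × FormH n d)) :=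
    Submodule.isClosed_sup_finiteDimensional _ _ (Submodule.isClosed_topologicalClosure _)
  have hmem : ((0 : Alg d), F) ∈ M ⊔ T := by
    obtain ⟨y, hy, hyF⟩ := mem_closure_iff_seq_limit.1 hF
    have h1 : Tendsto (fun k => ((0 : Alg d), y k)) atTop (𝓝 ((0 : Alg d), F)) :=
      tendsto_const_nhds.prodMk_nhds hyF
    refine hcl.mem_of_tendsto h1 (Eventually.of_forall fun k => ?_)
    obtain ⟨ψ, hψ⟩ := hy k
    have h2 : ((0 : Alg d), y k) = Λ ψ + LinearMap.inl ℝ (Alg d) (FormH n d) (-avgLin n d ψ) := by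
      simp [Λ, hψ]
    rw [h2]
    exact Submodule.add_mem_sup (Submodule.le_topologicalClosure _ ⟨ψ, rfl⟩) ⟨_, rfl⟩
  obtain ⟨m, hm, t, ⟨c, rfl⟩, hsum⟩ := Submodule.mem_sup.1 hmem
  obtain ⟨y, hy, hym⟩ := mem_closure_iff_seq_limit.1 hm
  choose ψ hψ using hy
  have h3 : m.2 = F := by simpa using congrArg Prod.snd hsum
  refine ⟨ψ, m.1, ?_, ?_⟩
  · rw [← h3]
    refine ((continuous_snd.tendsto m).comp hym).congr fun k => ?_
    simp [← hψ k, Λ]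
  · refine ((continuous_fst.tendsto m).comp hym).congr fun k => ?_
    simp [← hψ k, Λ]

/-- Apply the Poincaré inequality to differences; coercivity bounds their gradients by their
covariant derivatives. -/
theorem Coercive.cauchySeq_local {hA : FormL2 A} (h : Coercive S hA) {ψ : ℕ → testSpace n d}
    (h1 : CauchySeq fun k => covLin S hA (ψ k)) (h2 : CauchySeq fun k => avgLin n d (ψ k))
    (R : ℝ) : CauchySeq fun k => (((ψ k).2.memLp 2).restrict (Metric.ball 0 R)).toLp
      (ψ k : Section' n d) := by
  obtain ⟨C, hC, hP⟩ := exists_poincare n d R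
  have h3 : ∀ k l, dist ((((ψ k).2.memLp 2).restrict (Metric.ball 0 R)).toLp (ψ k : Section' n d))
      ((((ψ l).2.memLp 2).restrict (Metric.ball 0 R)).toLp (ψ l : Section' n d)) ≤
      C.toReal * (2 * dist (covLin S hA (ψ k)) (covLin S hA (ψ l)) +
        dist (avgLin n d (ψ k)) (avgLin n d (ψ l))) := by
    intro k l
    rw [dist_eq_norm, dist_eq_norm, dist_eq_norm, ← map_sub, ← map_sub, ← MemLp.toLp_sub,
      Lp.norm_toLp]
    have h4 := hP _ (ψ k - ψ l).2
    have h5 := ENNReal.toReal_mono (ENNReal.mul_ne_top hC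
      (ENNReal.add_ne_top.2 ⟨ENNReal.ofReal_ne_top, enorm_ne_top⟩)) h4
    rw [ENNReal.toReal_mul, ENNReal.toReal_add ENNReal.ofReal_ne_top enorm_ne_top,
      ENNReal.toReal_ofReal (norm_nonneg _), toReal_enorm] at h5
    refine h5.trans (mul_le_mul_of_nonneg_left ?_ ENNReal.toReal_nonneg)
    exact add_le_add (h.norm_gradForm_le (ψ k - ψ l)) le_rfl
  rw [Metric.cauchySeq_iff] at h1 h2 ⊢
  intro ε hε
  set K := C.toReal with hK
  have hK0 : 0 ≤ K := ENNReal.toReal_nonneg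
  obtain ⟨n1, hn1⟩ := h1 (ε / (4 * (K + 1))) (by positivity)
  obtain ⟨n2, hn2⟩ := h2 (ε / (4 * (K + 1))) (by positivity)
  refine ⟨max n1 n2, fun k hk l hl => (h3 k l).trans_lt ?_⟩
  have h4 := hn1 k (le_trans (le_max_left _ _) hk) l (le_trans (le_max_left _ _) hl)
  have h5 := hn2 k (le_trans (le_max_right _ _) hk) l (le_trans (le_max_right _ _) hl)
  calc K * (2 * dist (covLin S hA (ψ k)) (covLin S hA (ψ l)) +
        dist (avgLin n d (ψ k)) (avgLin n d (ψ l)))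
      ≤ K * (2 * (ε / (4 * (K + 1))) + ε / (4 * (K + 1))) := by gcongr
    _ = (3 * ε / 4) * (K / (K + 1)) := by field_simp; ring
    _ ≤ (3 * ε / 4) * 1 := by
        gcongr
        rw [div_le_one (by positivity)]
        linarith
    _ < ε := by linarith

theorem memLp_test_smul {η : Sp n → ℝ} (hη : IsTest η) {X : Section' n d}
    (hX : MemLp X 2 volume) : MemLp (fun x => η x • X x) 2 volume :=
  MemLp.smul (p := ⊤) (q := 2) (r := 2) hX (hη.memLp ⊤)

/-- The weak derivative of a limit of test functions with convergent covariant derivatives. -/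
theorem hasWeakDeriv_of_tendsto (hA : FormL2 A) {ψ : ℕ → testSpace n d} {u : Section' n d}
    (hu : ∀ R : ℝ, MemLp u 2 (volume.restrict (Metric.ball 0 R)))
    (hloc : TendstoL2Loc (fun k => (ψ k : Section' n d)) u) {F : FormH n d}
    (hF : Tendsto (fun k => covLin S hA (ψ k)) atTop (𝓝 F)) (i : Fin n) :
    HasWeakDeriv i u fun x => F i x - S.br (A i x) (u x) := by
  have hFi : LocallyIntegrable (F i) := (Lp.memLp (F i)).locallyIntegrable (by norm_num)
  have huL : LocallyIntegrable u :=
    locallyIntegrable_of_ball fun r => integrableOn_ball_of_memLp (hu r)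
  have hbr : LocallyIntegrable fun x => S.br (A i x) (u x) :=
    locallyIntegrable_of_ball fun r => integrable_bilin S.brL ((hA i).restrict _) (hu r)
  refine ⟨huL, hFi.sub hbr, fun η hη => ?_⟩
  have h1 : Tendsto (fun k => ∫ x, fderiv ℝ η x (e i) • (ψ k : Section' n d) x) atTop
      (𝓝 (∫ x, fderiv ℝ η x (e i) • u x)) :=
    tendsto_integral_compactSupport (ContinuousLinearMap.lsmul ℝ ℝ) (hη.memLp_fderiv (e i) 2)
      (hη.hasCompactSupport_fderiv (e i)) (fun k => (ψ k).2.memLp 2) hu hloc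
  have h2 : Tendsto (fun k => ∫ x, S.br (η x • A i x) ((ψ k : Section' n d) x)) atTop
      (𝓝 (∫ x, S.br (η x • A i x) (u x))) :=
    tendsto_integral_compactSupport S.brL (memLp_test_smul hη (hA i)) hη.2.smul_right
      (fun k => (ψ k).2.memLp 2) hu hloc
  have hF' : Tendsto (fun k => eLpNorm (fun x => covDC S A (ψ k) i x - F i x) 2 volume)
      atTop (𝓝 0) := by
    have h3 := ((PiLp.continuous_apply 2 _ i).tendsto F).comp hF
    rw [← Lp.toLp_coeFn (F i) (Lp.memLp _)] at h3
    exact (Lp.tendsto_Lp_iff_tendsto_eLpNorm'' _ (fun k => hA.covDC S (ψ k).2 i) _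
      (Lp.memLp (F i))).1 h3
  have h3 : Tendsto (fun k => ∫ x, η x • covDC S A (ψ k) i x) atTop
      (𝓝 (∫ x, η x • F i x)) :=
    tendsto_integral_bilin (ContinuousLinearMap.lsmul ℝ ℝ) (hη.memLp 2)
      (fun k => hA.covDC S (ψ k).2 i) (Lp.memLp (F i)) hF'
  have hsm : ∀ (v : Section' n d) x, S.br (η x • A i x) (v x) = η x • S.br (A i x) (v x) := by
    intro v x
    rw [← S.brL_apply, map_smul, smul_apply, S.brL_apply]
  -- For test functions `∂_i ψ = D_i ψ - [A_i, ψ]`. The first term converges in `L²`; in the second,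
  -- `η A_i` is square integrable with compact support, so `L²_loc` convergence of `ψ_k` is enough.
  have h4 : ∀ k, ∫ x, fderiv ℝ η x (e i) • (ψ k : Section' n d) x =
      -((∫ x, η x • covDC S A (ψ k) i x) -
        ∫ x, S.br (η x • A i x) ((ψ k : Section' n d) x)) := by
    intro k
    rw [integral_smul_fderiv_eq_neg hη (ψ k).2.1, ← integral_sub]
    · congr 1
      refine integral_congr_ae (Eventually.of_forall fun x => ?_)
      simp only [hsm, covDC, smul_add, add_sub_cancel_right]
    · exact integrable_bilin (ContinuousLinearMap.lsmul ℝ ℝ) (hη.memLp 2) (hA.covDC S (ψ k).2 i)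
    · exact integrable_bilin S.brL (memLp_test_smul hη (hA i)) ((ψ k).2.memLp 2)
  have h5 := tendsto_nhds_unique h1 (((h3.sub h2).neg).congr fun k => (h4 k).symm)
  rw [h5, ← integral_sub]
  · congr 1
    refine integral_congr_ae (Eventually.of_forall fun x => ?_)
    simp only [hsm, smul_sub]
  · exact integrable_bilin (ContinuousLinearMap.lsmul ℝ ℝ) (hη.memLp 2) (Lp.memLp (F i))
  · simp_rw [hsm]
    exact integrable_test_smul hη.1.continuous hη.2 hbr

/-- Every element of the closure is the covariant derivative of a finite energy function. -/
theorem Coercive.exists_finiteEnergy {hA : FormL2 A} (h : Coercive S hA) {F : FormH n d}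
    (hF : F ∈ covClosure S hA) :
    ∃ (u : Section' n d) (hu : FiniteEnergy S A u), toH (covD S A u) (hu.covD hA) = F := by
  obtain ⟨ψ, c, h1, h2⟩ := exists_seq_of_mem_covClosure hA hF
  obtain ⟨u, hu, hloc⟩ := exists_local_limit
    (fun k R => ((ψ k).2.memLp 2).restrict (Metric.ball 0 R))
    (h.cauchySeq_local h1.cauchySeq h2.cauchySeq)
  have hw := hasWeakDeriv_of_tendsto hA hu hloc h1
  have hcov : ∀ i, covD S A u i =ᵐ[volume] F i := by
    intro i
    filter_upwards [(hw i).weakDeriv_ae] with x hx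
    simp [covD, hx]
  have hFE : FiniteEnergy S A u := by
    refine ⟨hu, fun i => ⟨_, hw i⟩, fun k => ψ k, fun k => (ψ k).2, hloc, fun i => ?_⟩
    have h3 := ((PiLp.continuous_apply 2 _ i).tendsto F).comp h1
    rw [← Lp.toLp_coeFn (F i) (Lp.memLp _)] at h3
    have h4 := (Lp.tendsto_Lp_iff_tendsto_eLpNorm'' _ (fun k => hA.covDC S (ψ k).2 i) _
      (Lp.memLp (F i))).1 h3
    refine h4.congr fun k => eLpNorm_congr_ae ?_
    filter_upwards [hcov i] with x hx
    rw [hx]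
    rfl
  refine ⟨u, hFE, ?_⟩
  ext1 i
  rw [← Lp.toLp_coeFn (F i) (Lp.memLp _)]
  exact (MemLp.toLp_eq_toLp_iff (hFE.covD hA i) _).2 (hcov i)

/-- The projection of `V` lies in the closure and is therefore the covariant derivative of an energy
function, which solves the Gauss law by `solvesGauss_iff`. -/
theorem Coercive.exists_solvesGauss {hA : FormL2 A} (h : Coercive S hA) {V : Form n d}
    (hV : FormL2 V) : ∃ u, SolvesGauss S A V u := by
  obtain ⟨u, hu, h1⟩ := h.exists_finiteEnergy
    (Submodule.starProjection_apply_mem (covClosure S hA) (toH V hV))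
  exact ⟨u, (solvesGauss_iff hA hV hu).2 h1⟩

/-- The commutator of the connection with a finite energy function is square integrable, and it is
the limit of those with an approximating sequence of test functions. -/
theorem Coercive.tendsto_brLin {hA : FormL2 A} (h : Coercive S hA) {u : Section' n d}
    (hu : FiniteEnergy S A u) : ∃ (hb : FormL2 (brForm S A u)) (ψ : ℕ → testSpace n d),
      Tendsto (fun k => covLin S hA (ψ k)) atTop (𝓝 (toH (covD S A u) (hu.covD hA))) ∧
      Tendsto (fun k => brLin S hA (ψ k)) atTop (𝓝 (toH (brForm S A u) hb)) := by
  obtain ⟨χ, hχ, hloc, hD⟩ := hu.2.2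
  let ψ : ℕ → testSpace n d := fun k => ⟨χ k, hχ k⟩
  have h1 : Tendsto (fun k => covLin S hA (ψ k)) atTop
      (𝓝 (toH (covD S A u) (hu.covD hA))) :=
    tendsto_toH (fun k => hA.covDC S (hχ k)) (hu.covD hA) hD
  -- Coercivity carries the Cauchy property from the covariant derivatives to the commutators,
  -- giving some `L²` limit.
  have h2 : CauchySeq fun k => brLin S hA (ψ k) := by
    have h3 := h1.cauchySeq
    rw [Metric.cauchySeq_iff] at h3 ⊢
    intro ε hε
    obtain ⟨m, hm⟩ := h3 (ε / 2) (by positivity)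
    refine ⟨m, fun k hk l hl => ?_⟩
    have h4 := hm k hk l hl
    rw [dist_eq_norm, ← map_sub] at h4 ⊢
    linarith [h.norm_brLin_le (ψ k - ψ l)]
  obtain ⟨B, hB⟩ := cauchySeq_tendsto_of_complete h2
  -- Testing identifies that limit: against compactly supported `η`, the integrals also converge to
  -- those of `[A_i, u]` by `L²_loc` convergence.
  have hae : ∀ i, B i =ᵐ[volume] brForm S A u i := by
    intro i
    have hbr : LocallyIntegrable fun x => S.br (A i x) (u x) :=
      locallyIntegrable_of_ball fun r => integrable_bilin S.brL ((hA i).restrict _) (hu.1 r)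
    refine ae_eq_of_integral_contDiff_smul_eq ((Lp.memLp (B i)).locallyIntegrable (by norm_num))
      hbr fun η hη hs => ?_
    have hη' : IsTest η := ⟨hη.of_le (by simp), hs⟩
    have h3 := ((PiLp.continuous_apply 2 _ i).tendsto B).comp hB
    rw [← Lp.toLp_coeFn (B i) (Lp.memLp _)] at h3
    have h4 := (Lp.tendsto_Lp_iff_tendsto_eLpNorm'' _ (fun k => hA.brForm S (hχ k) i) _
      (Lp.memLp (B i))).1 h3
    have h5 : Tendsto (fun k => ∫ x, η x • brForm S A (χ k) i x) atTop
        (𝓝 (∫ x, η x • B i x)) :=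
      tendsto_integral_bilin (ContinuousLinearMap.lsmul ℝ ℝ) (hη'.memLp 2)
        (fun k => hA.brForm S (hχ k) i) (Lp.memLp (B i)) h4
    have h6 : Tendsto (fun k => ∫ x, S.br (η x • A i x) (χ k x)) atTop
        (𝓝 (∫ x, S.br (η x • A i x) (u x))) :=
      tendsto_integral_compactSupport S.brL (memLp_test_smul hη' (hA i)) hs.smul_right
        (fun k => (hχ k).memLp 2) hu.1 hloc
    have hsm : ∀ (v : Section' n d) x, S.br (η x • A i x) (v x) = η x • S.br (A i x) (v x) := by
      intro v x
      rw [← S.brL_apply, map_smul, smul_apply, S.brL_apply]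
    simp_rw [hsm] at h6
    exact tendsto_nhds_unique h5 h6
  have hb : FormL2 (brForm S A u) := fun i => (memLp_congr_ae (hae i)).1 (Lp.memLp (B i))
  refine ⟨hb, ψ, h1, ?_⟩
  have hBe : toH (brForm S A u) hb = B := by
    ext1 i
    rw [← Lp.toLp_coeFn (B i) (Lp.memLp _)]
    exact (MemLp.toLp_eq_toLp_iff (hb i) _).2 (hae i).symm
  rw [hBe]
  exact hB

end Completeness

/-! ### Invariance under gauge transformations. -/

section GaugeCovariance

variable {S : GaugeGroup N d} {φ : Sp n → Matrix (Fin N) (Fin N) ℂ}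

theorem IsGaugeTransf.inv_apply (hφ : IsGaugeTransf S φ) (x : Sp n) : (φ x)⁻¹ = star (φ x) := by
  obtain ⟨g, -, hg⟩ := hφ.1 x
  rw [← hg, GaugeGroup.unitary_inv]

theorem IsGaugeTransf.mul_inv (hφ : IsGaugeTransf S φ) (x : Sp n) : φ x * (φ x)⁻¹ = 1 := by
  obtain ⟨g, -, hg⟩ := hφ.1 x
  rw [← hg, GaugeGroup.unitary_inv]
  exact Unitary.coe_mul_star_self g

theorem IsGaugeTransf.inv_mul (hφ : IsGaugeTransf S φ) (x : Sp n) : (φ x)⁻¹ * φ x = 1 := by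
  obtain ⟨g, -, hg⟩ := hφ.1 x
  rw [← hg, GaugeGroup.unitary_inv]
  exact Unitary.coe_star_mul_self g

theorem IsGaugeTransf.inv_inv (hφ : IsGaugeTransf S φ) : (fun x => ((φ x)⁻¹)⁻¹) = φ :=
  funext fun x => Matrix.inv_eq_left_inv (hφ.mul_inv x)

theorem IsGaugeTransf.inv (hφ : IsGaugeTransf S φ) : IsGaugeTransf S fun x => (φ x)⁻¹ := by
  refine ⟨fun x => ?_, fun a b => ?_⟩
  · obtain ⟨g, hg, he⟩ := hφ.1 x
    refine ⟨g⁻¹, S.G.inv_mem hg, ?_⟩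
    change _ = (φ x)⁻¹
    rw [hφ.inv_apply, ← he]
    rfl
  · simp_rw [hφ.inv_apply]
    exact Complex.conjCLE.contDiff.comp (hφ.2 b a)

theorem IsGaugeTransf.isTangentTransform_inv (hφ : IsGaugeTransf S φ) {X X' : Form n d}
    (h : IsTangentTransform S φ X X') : IsTangentTransform S (fun x => (φ x)⁻¹) X' X := by
  intro i
  filter_upwards [h i] with x hx
  rw [hx, congrFun hφ.inv_inv x]
  simp only [mul_assoc, hφ.inv_mul, mul_one]
  rw [← mul_assoc, hφ.inv_mul, one_mul]

section
attribute [local instance] Matrix.linftyOpNormedRing Matrix.linftyOpNormedAlgebra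

theorem contDiff_matrix {M : Sp n → Matrix (Fin N) (Fin N) ℂ}
    (h : ∀ a b, ContDiff ℝ 1 fun x => M x a b) : ContDiff ℝ 1 M := by
  have h1 : M = fun x => ∑ a, ∑ b,
      (LinearMap.toContinuousLinearMap (Matrix.singleLinearMap ℝ a b)) (M x a b) := by
    funext x
    exact Matrix.matrix_eq_sum_single (M x)
  rw [h1]
  exact ContDiff.sum fun a _ => ContDiff.sum fun b _ => (ContinuousLinearMap.contDiff _).comp (h a b)

theorem matDeriv_eq {M : Sp n → Matrix (Fin N) (Fin N) ℂ} (h : ContDiff ℝ 1 M) (i : Fin n)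
    (x : Sp n) : matDeriv i M x = fderiv ℝ M x (e i) := by
  ext a b
  let E : Matrix (Fin N) (Fin N) ℂ →L[ℝ] ℂ :=
    LinearMap.toContinuousLinearMap (Matrix.entryLinearMap ℝ ℂ a b)
  have h1 := E.hasFDerivAt.comp x (h.differentiable (by simp) x).hasFDerivAt
  change fderiv ℝ (E ∘ M) x (e i) = _
  rw [h1.fderiv]
  rfl

/-- The derivative of the inverse of a gauge transformation. -/
theorem IsGaugeTransf.fderiv_mul_inv (hφ : IsGaugeTransf S φ) (x v : Sp n) :
    fderiv ℝ φ x v * (φ x)⁻¹ + φ x * fderiv ℝ (fun y => (φ y)⁻¹) x v = 0 := by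
  have h1 := ((contDiff_matrix hφ.2).differentiable (by simp) x).hasFDerivAt
  have h2 := ((contDiff_matrix hφ.inv.2).differentiable (by simp) x).hasFDerivAt
  have h3 := h1.mul' h2
  have h4 : HasFDerivAt (𝕜 := ℝ) (fun y => φ y * (φ y)⁻¹) 0 x := by
    simp_rw [hφ.mul_inv]
    exact hasFDerivAt_const _ _
  have h5 := congrArg (fun L : Sp n →L[ℝ] Matrix (Fin N) (Fin N) ℂ => L v) (h3.unique h4)
  rw [add_comm]
  exact h5

/-- Conjugating back leaves `A + d(φ⁻¹) φ`, and the inhomogeneous term `φ⁻¹ dφ` of the inverse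
transformation cancels the second summand. Reversibility is needed to transfer insolubility of the
Gauss law. -/
theorem IsGaugeTransf.isTransform_inv (hφ : IsGaugeTransf S φ) {A A' : Form n d}
    (h : IsTransform S φ A A') : IsTransform S (fun x => (φ x)⁻¹) A' A := by
  intro i
  filter_upwards [h i] with x hx
  have h1 := hφ.inv.fderiv_mul_inv x (e i)
  rw [hφ.inv_inv, congrFun hφ.inv_inv x] at h1
  rw [hx, hφ.inv_inv, congrFun hφ.inv_inv x, matDeriv_eq (contDiff_matrix hφ.2),
    matDeriv_eq (contDiff_matrix hφ.inv.2)]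
  have h2 : (φ x)⁻¹ * (φ x * S.toMat (A i x) * (φ x)⁻¹ +
      φ x * fderiv ℝ (fun y => (φ y)⁻¹) x (e i)) * φ x = ((φ x)⁻¹ * φ x) *
      (S.toMat (A i x) * ((φ x)⁻¹ * φ x) + fderiv ℝ (fun y => (φ y)⁻¹) x (e i) * φ x) := by
    noncomm_ring
  rw [h2, hφ.inv_mul, one_mul, mul_one, add_assoc, h1, add_zero]

/-- The adjoint action of a gauge transformation, in coordinates. -/
theorem IsGaugeTransf.exists_ad (hφ : IsGaugeTransf S φ) :
    ∃ Φ : Sp n → Alg d →L[ℝ] Alg d, ContDiff ℝ 1 Φ ∧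
      ∀ x u, S.toMat (Φ x u) = φ x * S.toMat u * (φ x)⁻¹ := by
  obtain ⟨L, hL⟩ := S.matL.exists_leftInverse_of_injective
    (LinearMap.ker_eq_bot.2 S.matL_injective)
  have hL' : ∀ u, L (S.toMat u) = u := fun u => LinearMap.congr_fun hL u
  let Lc : Matrix (Fin N) (Fin N) ℂ →L[ℝ] Alg d := LinearMap.toContinuousLinearMap L
  let Mc : Alg d →L[ℝ] Matrix (Fin N) (Fin N) ℂ := LinearMap.toContinuousLinearMap S.matL
  let B := ContinuousLinearMap.mul ℝ (Matrix (Fin N) (Fin N) ℂ)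
  refine ⟨fun x => Lc.comp (((B.flip (φ x)⁻¹).comp (B (φ x))).comp Mc), ?_, fun x u => ?_⟩
  · exact contDiff_const.clm_comp (((B.flip.contDiff.comp (contDiff_matrix hφ.inv.2)).clm_comp
      (B.contDiff.comp (contDiff_matrix hφ.2))).clm_comp contDiff_const)
  · obtain ⟨g, hg, he⟩ := hφ.1 x
    obtain ⟨v, hv⟩ := S.exists_conj hg u
    rw [he] at hv
    rw [← hv]
    -- The left inverse `L` recovers coordinates only on the Lie algebra, so `exists_conj` is needed
    -- to know that the conjugate lies there.
    change S.toMat (L (φ x * S.toMat u * (φ x)⁻¹)) = _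
    rw [← hv, hL']

/-- The covariant derivative intertwines the adjoint action. -/
theorem IsGaugeTransf.covDC_ad (hφ : IsGaugeTransf S φ) {Φ : Sp n → Alg d →L[ℝ] Alg d}
    (hΦ : ContDiff ℝ 1 Φ) (hΦm : ∀ x u, S.toMat (Φ x u) = φ x * S.toMat u * (φ x)⁻¹)
    {A A' : Form n d} (h : IsTransform S φ A A') {ψ : Section' n d} (hψ : IsTest ψ) (i : Fin n) :
    covDC S A' (fun x => Φ x (ψ x)) i =ᵐ[volume] fun x => Φ x (covDC S A ψ i x) := by
  filter_upwards [h i] with x hx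
  let Mc : Alg d →L[ℝ] Matrix (Fin N) (Fin N) ℂ := LinearMap.toContinuousLinearMap S.matL
  have h1 := ((contDiff_matrix hφ.2).differentiable (by simp) x).hasFDerivAt
  have h2 := ((contDiff_matrix hφ.inv.2).differentiable (by simp) x).hasFDerivAt
  have h3 := Mc.hasFDerivAt.comp x (hψ.1.differentiable (by simp) x).hasFDerivAt
  have h4 := Mc.hasFDerivAt.comp x
    ((hΦ.clm_apply hψ.1).differentiable (by simp) x).hasFDerivAt
  have h5 : (Mc ∘ fun y => Φ y (ψ y)) = fun y => φ y * Mc (ψ y) * (φ y)⁻¹ :=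
    funext fun y => hΦm y (ψ y)
  rw [h5] at h4
  have h6 := congrArg (fun L : Sp n →L[ℝ] Matrix (Fin N) (Fin N) ℂ => L (e i)) (h4.unique ((h1.mul' h3).mul' h2))
  have h7 : S.toMat (fderiv ℝ (fun y => Φ y (ψ y)) x (e i)) =
      φ x * S.toMat (ψ x) * fderiv ℝ (fun y => (φ y)⁻¹) x (e i) +
      (φ x * S.toMat (fderiv ℝ ψ x (e i)) + fderiv ℝ φ x (e i) * S.toMat (ψ x)) * (φ x)⁻¹ := by
    exact h6
  have h8 := hφ.fderiv_mul_inv x (e i)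
  -- Writing `dφ` through `d(φ⁻¹)` expresses all derivative terms in the form occurring in the
  -- transformation law, where they cancel.
  have h9 : fderiv ℝ φ x (e i) = -(φ x * fderiv ℝ (fun y => (φ y)⁻¹) x (e i) * φ x) := by
    have : fderiv ℝ φ x (e i) * (φ x)⁻¹ * φ x =
        -(φ x * fderiv ℝ (fun y => (φ y)⁻¹) x (e i)) * φ x := by
      rw [eq_neg_of_add_eq_zero_left h8]
    rwa [mul_assoc, hφ.inv_mul, mul_one, neg_mul] at this
  apply S.matL_injective
  simp only [covDC, map_add]
  simp only [S.matL_apply, S.toMat_br, hΦm, hx, h7, h9,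
    matDeriv_eq (contDiff_matrix hφ.inv.2)]
  have hc : ∀ Z : Matrix (Fin N) (Fin N) ℂ, (φ x)⁻¹ * (φ x * Z) = Z := fun Z => by
    rw [← mul_assoc, hφ.inv_mul, one_mul]
  simp only [add_mul, mul_add, mul_sub, sub_mul, neg_mul, mul_assoc, hc]
  abel

end

/-- The adjoint action is isometric. -/
theorem IsGaugeTransf.norm_ad (hφ : IsGaugeTransf S φ) {Φ : Sp n → Alg d →L[ℝ] Alg d}
    (hΦm : ∀ x u, S.toMat (Φ x u) = φ x * S.toMat u * (φ x)⁻¹) (x : Sp n) (u : Alg d) :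
    ‖Φ x u‖ = ‖u‖ := by
  obtain ⟨g, hg, he⟩ := hφ.1 x
  refine (S.ad_invariant g hg u (Φ x u) ?_).symm
  rw [he]
  exact (hΦm x u).symm

theorem IsTest.clm_family {Φ : Sp n → Alg d →L[ℝ] Alg d} (hΦ : ContDiff ℝ 1 Φ)
    {ψ : Section' n d} (hψ : IsTest ψ) : IsTest fun x => Φ x (ψ x) := by
  refine ⟨hΦ.clm_apply hψ.1, hψ.2.mono' fun x hx => ?_⟩
  by_contra h
  refine hx ?_
  change Φ x (ψ x) = 0
  rw [image_eq_zero_of_notMem_tsupport h, map_zero]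

theorem eLpNorm_ad_sub {Φ : Sp n → Alg d →L[ℝ] Alg d} (hΦn : ∀ x u, ‖Φ x u‖ = ‖u‖)
    (u v : Section' n d) (p : ℝ≥0∞) (μ : Measure (Sp n)) :
    eLpNorm (fun x => Φ x (u x) - Φ x (v x)) p μ = eLpNorm (fun x => u x - v x) p μ :=
  eLpNorm_congr_norm_ae (Eventually.of_forall fun x => by rw [← map_sub, hΦn])

theorem memLp_ad {Φ : Sp n → Alg d →L[ℝ] Alg d} (hΦ : Continuous Φ)
    (hΦn : ∀ x u, ‖Φ x u‖ = ‖u‖) {u : Section' n d} {p : ℝ≥0∞} {μ : Measure (Sp n)}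
    (hu : MemLp u p μ) : MemLp (fun x => Φ x (u x)) p μ :=
  hu.congr_norm ((ContinuousLinearMap.id ℝ (Alg d →L[ℝ] Alg d)).aestronglyMeasurable_comp₂
    hΦ.aestronglyMeasurable hu.1) (Eventually.of_forall fun x => (hΦn x (u x)).symm)

theorem inner_ad {Φ : Sp n → Alg d →L[ℝ] Alg d} (hΦn : ∀ x u, ‖Φ x u‖ = ‖u‖) (x : Sp n)
    (u v : Alg d) : inner ℝ (Φ x u) (Φ x v) = inner ℝ u v :=
  LinearIsometry.inner_map_map ⟨(Φ x : Alg d →ₗ[ℝ] Alg d), hΦn x⟩ u v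

theorem IsGaugeTransf.finiteEnergy_ad (hφ : IsGaugeTransf S φ) {Φ : Sp n → Alg d →L[ℝ] Alg d}
    (hΦ : ContDiff ℝ 1 Φ) (hΦm : ∀ x u, S.toMat (Φ x u) = φ x * S.toMat u * (φ x)⁻¹)
    {A A' : Form n d} (hA : FormL2 A) (hA' : FormL2 A') (h : IsTransform S φ A A')
    {u : Section' n d} (hu : FiniteEnergy S A u) :
    FiniteEnergy S A' (fun x => Φ x (u x)) ∧
      ∀ i, covD S A' (fun x => Φ x (u x)) i =ᵐ[volume] fun x => Φ x (covD S A u i x) := by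
  have hΦn := hφ.norm_ad hΦm
  obtain ⟨ψ, hψ, hloc, hD⟩ := hu.2.2
  let χ : ℕ → testSpace n d := fun k => ⟨fun x => Φ x (ψ k x), (hψ k).clm_family hΦ⟩
  have hF : FormL2 fun i x => Φ x (covD S A u i x) :=
    fun i => memLp_ad hΦ.continuous hΦn (hu.covD hA i)
  have hm : ∀ R : ℝ, MemLp (fun x => Φ x (u x)) 2 (volume.restrict (Metric.ball 0 R)) :=
    fun R => memLp_ad hΦ.continuous hΦn (hu.1 R)
  have hloc' : TendstoL2Loc (fun k => (χ k : Section' n d)) fun x => Φ x (u x) := fun R =>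
    (hloc R).congr fun k => (eLpNorm_ad_sub hΦn (ψ k) u 2 _).symm
  have hD' : ∀ i, Tendsto (fun k => eLpNorm
      (fun x => covDC S A' (χ k) i x - Φ x (covD S A u i x)) 2 volume) atTop (𝓝 0) := by
    intro i
    refine (hD i).congr fun k => ?_
    rw [← eLpNorm_ad_sub hΦn]
    refine eLpNorm_congr_ae ?_
    filter_upwards [hφ.covDC_ad hΦ hΦm h (hψ k) i] with x hx
    exact congrArg (· - Φ x (covD S A u i x)) hx.symm
  have hlim : Tendsto (fun k => covLin S hA' (χ k)) atTop (𝓝 (toH _ hF)) :=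
    tendsto_toH (fun k => hA'.covDC S (χ k).2) hF hD'
  -- The weak derivative of `Φu` is obtained from the transformed test functions, for which the
  -- classical product rule has been used. No product rule for weak derivatives is required.
  have hw := hasWeakDeriv_of_tendsto hA' hm hloc' hlim
  have hcov : ∀ i, covD S A' (fun x => Φ x (u x)) i =ᵐ[volume] fun x => Φ x (covD S A u i x) := by
    intro i
    filter_upwards [(hw i).weakDeriv_ae, (hF i).coeFn_toLp] with x hx hx'
    rw [covD, hx, sub_add_cancel]
    exact hx'
  refine ⟨⟨hm, fun i => ⟨_, hw i⟩, fun k => χ k, fun k => (χ k).2, hloc', fun i => ?_⟩, hcov⟩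
  refine (hD' i).congr fun k => eLpNorm_congr_ae ?_
  filter_upwards [hcov i] with x hx
  rw [hx]

/-- Solutions of the Gauss law are mapped to solutions by gauge transformations. -/
theorem IsGaugeTransf.exists_solvesGauss (hφ : IsGaugeTransf S φ) {A A' V V' : Form n d}
    (hA : FormL2 A) (hA' : FormL2 A') (h : IsTransform S φ A A')
    (hV : IsTangentTransform S φ V V') {u : Section' n d} (hu : SolvesGauss S A V u) :
    ∃ u', SolvesGauss S A' V' u' ∧ kinetic S u' A' V' = kinetic S u A V := by
  obtain ⟨Φ, hΦ, hΦm⟩ := hφ.exists_ad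
  obtain ⟨Ψ, hΨ, hΨm⟩ := hφ.inv.exists_ad
  have hΦn := hφ.norm_ad hΦm
  obtain ⟨h1, h2⟩ := hφ.finiteEnergy_ad hΦ hΦm hA hA' h hu.1
  have hE : ∀ i, electric S (fun x => Φ x (u x)) A' V' i =ᵐ[volume]
      fun x => Φ x (electric S u A V i x) := by
    intro i
    filter_upwards [h2 i, hV i] with x hx hx'
    have h3 : V' i x = Φ x (V i x) := S.matL_injective (hx'.trans (hΦm x _).symm)
    rw [electric_eq, electric_eq, Pi.sub_apply, Pi.sub_apply, Pi.sub_apply, Pi.sub_apply, hx, h3,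
      map_sub]
  have hinv : ∀ x v, Φ x (Ψ x v) = v := by
    intro x v
    apply S.matL_injective
    rw [S.matL_apply, S.matL_apply, hΦm, hΨm, congrFun hφ.inv_inv x]
    simp only [mul_assoc, hφ.mul_inv, mul_one]
    rw [← mul_assoc, hφ.mul_inv, one_mul]
  refine ⟨fun x => Φ x (u x), ⟨h1, fun ψ hψ => ?_⟩, ?_⟩
  -- Every test function `ψ` is `Φ(Ψψ)` with `Ψψ` again a test function. The isometry then reduces
  -- the Gauss law at `A'` tested on `ψ` to the one at `A` tested on `Ψψ`.
  · rw [← hu.2 _ (hψ.clm_family hΨ)]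
    refine Finset.sum_congr rfl fun i _ => integral_congr_ae ?_
    have h4 := hφ.covDC_ad hΦ hΦm h (hψ.clm_family hΨ) i
    simp_rw [hinv] at h4
    filter_upwards [hE i, h4] with x hx hx'
    rw [hx, hx', inner_ad hΦn]
  · rw [kinetic, kinetic]
    congr 1
    refine integral_congr_ae ?_
    filter_upwards [ae_all_iff.2 hE] with x hx
    simp only [hx, inner_ad hΦn]

theorem IsGaugeTransf.reducedKinetic_eq (hφ : IsGaugeTransf S φ) {A A' V V' : Form n d}
    (hA : FormL2 A) (hA' : FormL2 A') (h : IsTransform S φ A A') (hVL : FormL2 V')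
    (hV : IsTangentTransform S φ V V') : reducedKinetic S A' V' = reducedKinetic S A V := by
  by_cases hex : ∃ u, SolvesGauss S A V u
  · obtain ⟨u', hu', hk⟩ := hφ.exists_solvesGauss hA hA' h hV hex.choose_spec
    rw [← hu'.kinetic_eq_reducedKinetic hA' hVL, hk, reducedKinetic, dif_pos hex]
  · have hex' : ¬ ∃ u, SolvesGauss S A' V' u := by
      rintro ⟨u, hu⟩
      obtain ⟨u', hu', -⟩ := hφ.inv.exists_solvesGauss hA' hA (hφ.isTransform_inv h)
        (hφ.isTangentTransform_inv hV) hu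
      exact hex ⟨u', hu'⟩
    rw [reducedKinetic, reducedKinetic, dif_neg hex, dif_neg hex']

theorem IsTangentTransform.add {X X' Y Y' : Form n d} (hX : IsTangentTransform S φ X X')
    (hY : IsTangentTransform S φ Y Y') : IsTangentTransform S φ (X + Y) (X' + Y') := by
  intro i
  filter_upwards [hX i, hY i] with x hx hy
  rw [Pi.add_apply, Pi.add_apply, Pi.add_apply, Pi.add_apply, ← S.matL_apply, ← S.matL_apply,
    map_add, map_add, S.matL_apply, S.matL_apply, S.matL_apply, S.matL_apply, hx, hy, mul_add,
    add_mul]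

/-- The induced metric is invariant under gauge transformations. -/
theorem IsGaugeTransf.inducedMetric_eq (hφ : IsGaugeTransf S φ) {A A' X X' Y Y' : Form n d}
    (hA : FormL2 A) (hA' : FormL2 A') (h : IsTransform S φ A A') (hXL : FormL2 X')
    (hX : IsTangentTransform S φ X X') (hYL : FormL2 Y') (hY : IsTangentTransform S φ Y Y') :
    inducedMetric S A' X' Y' = inducedMetric S A X Y := by
  rw [inducedMetric, inducedMetric, hφ.reducedKinetic_eq hA hA' h (hXL.add hYL) (hX.add hY),
    hφ.reducedKinetic_eq hA hA' h hXL hX, hφ.reducedKinetic_eq hA hA' h hYL hY]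

end GaugeCovariance

/-! ### The Lagrangian as kinetic minus potential energy. -/

section Lagrangian

variable (S : GaugeGroup N d)

/-- The electric components appear twice, as `F_{0i}` and `F_{i0}`, each time with the Minkowski
sign `-1`. -/
theorem sum_curvature (A₀ : Section' n d) (A V : Form n d) (x : Sp n) :
    ∑ α, ∑ β, minkowski α * minkowski β *
      inner ℝ (curvature S A₀ A V α β x) (curvature S A₀ A V α β x) =
      (∑ i, ∑ j, inner ℝ (magnetic S A i j x) (magnetic S A i j x)) -
        2 * ∑ i, inner ℝ (electric S A₀ A V i x) (electric S A₀ A V i x) := by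
  simp only [Fin.sum_univ_succ, minkowski, curvature, Fin.cons_zero, Fin.cons_succ,
    Fin.cases_zero, Fin.cases_succ, Pi.neg_apply, inner_neg_neg, Pi.zero_apply, inner_zero_left,
    Finset.sum_add_distrib, one_mul, mul_one, mul_zero, neg_one_mul, Finset.sum_neg_distrib]
  ring

/-- The derivatives are square integrable by `s ≥ 1`, and the bracket is a product of an `L²` and an
`L^∞` function by `s > n/2`. Integrability is needed to split the integral of the Lagrangian. -/
theorem InHs.memLp_magnetic {s : ℝ} (h1 : 1 ≤ s) (hs : (n : ℝ) / 2 < s) {A : Form n d}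
    (hA : InHs s A) (i j : Fin n) : MemLp (magnetic S A i j) 2 volume := by
  have hd : ∀ i j, MemLp (weakDeriv i (A j)) 2 volume := by
    intro i j
    obtain ⟨v, hv, hv2⟩ := hA.exists_hasWeakDeriv h1 i j
    exact (memLp_congr_ae hv.weakDeriv_ae).2 hv2
  exact ((hd i j).sub (hd j i)).add (memLp_br S (hA.formL2 i) (hA.memLp_top hs j))

theorem lagrangian_eq {A₀ : Section' n d} {A V : Form n d} (hE : FormL2 (electric S A₀ A V))
    (hB : ∀ i j, MemLp (magnetic S A i j) 2 volume) :
    lagrangian S A₀ A V = kinetic S A₀ A V - potential S A := by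
  rw [lagrangian, kinetic, potential]
  simp_rw [sum_curvature]
  rw [integral_sub, integral_const_mul]
  · ring
  · exact integrable_finsetSum _ fun i _ => integrable_finsetSum _ fun j _ =>
      integrable_inner (hB i j) (hB i j)
  · exact (integrable_finsetSum _ fun i _ => integrable_inner (hE i) (hE i)).const_mul 2

variable {S}

/-- The reduced energy is quadratic, so the polarisation is `4T - T - T = 2T`. -/
theorem SolvesGauss.inducedMetric_self {A V : Form n d} (hA : FormL2 A) (hV : FormL2 V)
    {u : Section' n d} (hu : SolvesGauss S A V u) :
    inducedMetric S A V V = 2 * kinetic S u A V := by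
  have h2 : V + V = (2 : ℝ) • V := (two_smul ℝ V).symm
  rw [inducedMetric, (hu.add hA hV hV hu).reducedKinetic_eq hA (hV.add hV), toH_add hV hV, map_add,
    hu.reducedKinetic_eq hA hV, hu.kinetic_eq hA hV, add_sub_add_comm, ← two_smul ℝ, norm_smul]
  norm_num
  ring

theorem SolvesGauss.lagrangian_eq {s : ℝ} (h1 : 1 ≤ s) (hs : (n : ℝ) / 2 < s) {A V : Form n d}
    (hA : InHs s A) (hV : InHs s V) {u : Section' n d} (hu : SolvesGauss S A V u) :
    lagrangian S u A V = 1 / 2 * inducedMetric S A V V - potential S A := by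
  have hE : FormL2 (electric S u A V) := by
    rw [electric_eq]
    exact hV.formL2.sub (hu.1.covD hA.formL2)
  rw [YM.lagrangian_eq S hE (hA.memLp_magnetic S h1 hs),
    hu.inducedMetric_self hA.formL2 hV.formL2]
  ring

end Lagrangian

/-! ### The Gauss law and the metric on the Coulomb slice. -/

section CoulombSlice

variable (S : GaugeGroup N d) {A : Form n d}

theorem source_eq (A Y : Form n d) (x : Sp n) : source S A Y x = ∑ j, S.br (A j x) (Y j x) := by
  ext R
  simp only [source, WithLp.ofLp_sum, Finset.sum_apply, GaugeGroup.br_apply]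

theorem IsCoulomb.inner_covDC (hA : FormL2 A) {X : Form n d} (hX : FormL2 X) (h : IsCoulomb X)
    {ψ : Section' n d} (hψ : IsTest ψ) : inner ℝ (toH X hX) (toH (covDC S A ψ) (hA.covDC S hψ)) =
      inner ℝ (toH X hX) (toH (brForm S A ψ) (hA.brForm S hψ)) := by
  rw [toH_covDC S hA hψ, inner_add_right, h.inner_gradForm hX hψ, zero_add]

theorem inner_brForm (hA : FormL2 A) {X : Form n d} (hX : FormL2 X) {ψ : Section' n d}
    (hψ : IsTest ψ) : inner ℝ (toH X hX) (toH (brForm S A ψ) (hA.brForm S hψ)) =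
      -∫ x, inner ℝ (source S A X x) (ψ x) := by
  rw [inner_toH, ← integral_finsetSum _ fun i _ => integrable_inner (hX i) (hA.brForm S hψ i),
    ← integral_neg]
  refine integral_congr_ae (Eventually.of_forall fun x => ?_)
  simp only [source_eq, sum_inner, ← Finset.sum_neg_distrib, S.inner_br_left, neg_neg, brForm]

/-- The Gauss law in the Coulomb gauge. -/
theorem IsCoulomb.solvesGauss_iff (hA : FormL2 A) {V : Form n d} (hV : FormL2 V)
    (h : IsCoulomb V) (u : Section' n d) :
    SolvesGauss S A V u ↔ IsInvLap S A (source S A V) u := by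
  refine and_congr_right fun hu => forall₂_congr fun ψ hψ => ?_
  have hE : FormL2 (electric S u A V) := by
    rw [electric_eq]
    exact hV.sub (hu.covD hA)
  have h1 : toH (electric S u A V) hE = toH V hV - toH (covD S A u) (hu.covD hA) := by
    rw [← toH_sub, toH_eq_iff]
    exact fun i => Eventually.of_forall fun x => by rw [electric_eq]
  -- Since `V` is orthogonal to gradients, `⟨V, Dψ⟩ = ⟨V, [A, ψ]⟩ = -∫⟨[A_i, V_i], ψ⟩`. Thus the
  -- vanishing of `⟨V - Du, Dψ⟩` is the weak form of `Δ_A u = [A_i, V_i]`.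
  rw [← inner_toH hE (hA.covDC S hψ), ← inner_toH (hu.covD hA) (hA.covDC S hψ), h1,
    inner_sub_left, h.inner_covDC S hA hV hψ, inner_brForm S hA hV hψ, sub_eq_zero, eq_comm]

variable {S}

/-- In the kernel formula the indices of `f^{PRV}` are ordered as in `[u, A]`, opposite to the
covariant derivative. This sign turns `-⟨X, [A, u]⟩` into the `+` of the formula. -/
theorem inner_br_eq_sum (S : GaugeGroup N d) (w a u : Alg d) :
    inner ℝ w (S.br a u) = -∑ P, ∑ R, ∑ V, w P * S.f P R V * a V * u R := by
  rw [S.br_antisymm, inner_neg_right, PiLp.inner_apply]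
  congr 1
  refine Finset.sum_congr rfl fun P _ => ?_
  simp only [GaugeGroup.br_apply, RCLike.inner_apply, conj_trivial, Finset.sum_mul]
  exact Finset.sum_congr rfl fun R _ => Finset.sum_congr rfl fun V _ => by ring

theorem sum_delta_eq (X Y : Form n d) (x : Sp n) :
    ∑ i, ∑ j, ∑ P, ∑ Q, delta i j * delta P Q * X i x P * Y j x Q =
      ∑ i, inner ℝ (X i x) (Y i x) := by
  refine Finset.sum_congr rfl fun i _ => ?_
  rw [Finset.sum_eq_single i]
  · rw [PiLp.inner_apply]
    refine Finset.sum_congr rfl fun P _ => ?_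
    rw [Finset.sum_eq_single P]
    · simp [delta, mul_comm]
    · intro Q _ hQ
      simp [delta, hQ.symm]
    · simp
  · intro j _ hj
    simp [delta, hj.symm]
  · simp

/-- Test functions satisfy the identity because `X` is orthogonal to gradients. Coercivity makes
both the covariant derivatives and the commutators converge in `L²`, so it survives the limit. -/
theorem Coercive.inner_covD {hA : FormL2 A} (h : Coercive S hA) {X : Form n d} (hX : FormL2 X)
    (hXC : IsCoulomb X) {u : Section' n d} (hu : FiniteEnergy S A u) :
    ∃ hb : FormL2 (brForm S A u), inner ℝ (toH X hX) (toH (covD S A u) (hu.covD hA)) =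
      inner ℝ (toH X hX) (toH (brForm S A u) hb) := by
  obtain ⟨hb, ψ, h1, h2⟩ := h.tendsto_brLin hu
  refine ⟨hb, tendsto_nhds_unique (tendsto_const_nhds.inner h1)
    ((tendsto_const_nhds.inner h2).congr fun k => ?_)⟩
  exact (hXC.inner_covDC S hA hX (ψ k).2).symm

/-- The metric on the Coulomb slice. -/
theorem Coercive.inducedMetric_eq {hA : FormL2 A} (h : Coercive S hA) {X Y : Form n d}
    (hX : FormL2 X) (hXC : IsCoulomb X) (hY : FormL2 Y) (hYC : IsCoulomb Y) {u : Section' n d}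
    (hu : IsInvLap S A (source S A Y) u) :
    Integrable (fun x => ∑ i, ∑ P, ∑ R, ∑ V, X i x P * S.f P R V * A i x V * u x R) ∧
      inducedMetric S A X Y =
        (∫ x, ∑ i, ∑ j, ∑ P, ∑ Q, delta i j * delta P Q * X i x P * Y j x Q) +
          ∫ x, ∑ i, ∑ P, ∑ R, ∑ V, X i x P * S.f P R V * A i x V * u x R := by
  have hu' := (hYC.solvesGauss_iff S hA hY u).2 hu
  -- The Gauss law for `X` must be solvable as well, so that no term of the polarisation takes its
  -- default value.
  obtain ⟨v, hv⟩ := h.exists_solvesGauss hX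
  obtain ⟨hb, hbe⟩ := h.inner_covD hX hXC hu'.1
  have hpt : (fun x => ∑ i, ∑ P, ∑ R, ∑ V, X i x P * S.f P R V * A i x V * u x R) =
      fun x => ∑ i, -inner ℝ (X i x) (brForm S A u i x) := by
    funext x
    exact Finset.sum_congr rfl fun i _ => by rw [brForm, inner_br_eq_sum, neg_neg]
  have hint : ∀ i, Integrable fun x => -inner ℝ (X i x) (brForm S A u i x) :=
    fun i => (integrable_inner (hX i) (hb i)).neg
  simp_rw [hpt, sum_delta_eq]
  refine ⟨integrable_finsetSum _ fun i _ => hint i, ?_⟩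
  rw [hv.inducedMetric_eq hA hX hY hu', hbe, inner_toH, inner_toH,
    integral_finsetSum _ fun i _ => hint i,
    integral_finsetSum _ fun i _ => integrable_inner (hX i) (hY i), sub_eq_add_neg,
    ← Finset.sum_neg_distrib]
  simp_rw [integral_neg]

/-- The finite sums are regrouped so that `x'` enters only through `K` applied to the source. Only
that combination is assumed integrable. -/
theorem sum_kernel_eq (S : GaugeGroup N d) (A X Y : Form n d)
    (K : Sp n → Sp n → Matrix (Fin d) (Fin d) ℝ) (x x' : Sp n) :
    ∑ i, ∑ j, ∑ P, ∑ Q, X i x P * (∑ R, ∑ R', ∑ V, ∑ U, S.f P R V * A i x V * K x x' R R' *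
      S.f R' U Q * A j x' U) * Y j x' Q =
    ∑ i, ∑ P, ∑ R, (∑ V, X i x P * S.f P R V * A i x V) *
      ∑ R', K x x' R R' * source S A Y x' R' := by
  have h1 : ∀ i j P Q, X i x P * (∑ R, ∑ R', ∑ V, ∑ U, S.f P R V * A i x V * K x x' R R' *
      S.f R' U Q * A j x' U) * Y j x' Q = ∑ R, ∑ R', (∑ V, X i x P * S.f P R V * A i x V) *
      (K x x' R R' * ∑ U, S.f R' U Q * A j x' U * Y j x' Q) := by
    intro i j P Q
    simp only [Finset.mul_sum, Finset.sum_mul]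
    refine Finset.sum_congr rfl fun R _ => Finset.sum_congr rfl fun R' _ => ?_
    rw [Finset.sum_comm]
    exact Finset.sum_congr rfl fun U _ => Finset.sum_congr rfl fun V _ => by ring
  have h2 : ∀ R', source S A Y x' R' = ∑ j, ∑ Q, ∑ U, S.f R' U Q * A j x' U * Y j x' Q := by
    intro R'
    change ∑ j, ∑ U, ∑ Q, S.f R' U Q * A j x' U * Y j x' Q = _
    exact Finset.sum_congr rfl fun j _ => Finset.sum_comm
  simp_rw [h1, h2, Finset.mul_sum (s := (Finset.univ : Finset (Fin n)))]
  refine Finset.sum_congr rfl fun i _ => ?_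
  rw [Finset.sum_comm]
  refine Finset.sum_congr rfl fun P _ => ?_
  rw [Finset.sum_congr rfl fun j _ => Finset.sum_comm, Finset.sum_comm]
  refine Finset.sum_congr rfl fun R _ => ?_
  rw [Finset.sum_congr rfl fun j _ => Finset.sum_comm, Finset.sum_comm, Finset.mul_sum]
  refine Finset.sum_congr rfl fun R' _ => ?_
  rw [Finset.mul_sum]
  refine Finset.sum_congr rfl fun j _ => ?_
  rw [Finset.mul_sum, Finset.mul_sum]

/-- The double integral with a kernel. -/
theorem IsInvLapKernel.integral_eq {s : ℝ} {K : Sp n → Sp n → Matrix (Fin d) (Fin d) ℝ}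
    (hK : IsInvLapKernel S s A K) (X : Form n d) {Y : Form n d} (hY : InHs s Y)
    (hYC : IsCoulomb Y) :
    (∫ x, ∫ x', ∑ i, ∑ j, ∑ P, ∑ Q, X i x P * (∑ R, ∑ R', ∑ V, ∑ U, S.f P R V * A i x V *
      K x x' R R' * S.f R' U Q * A j x' U) * Y j x' Q) =
    ∫ x, ∑ i, ∑ P, ∑ R, ∑ V, X i x P * S.f P R V * A i x V *
      applyKernel K (source S A Y) x R := by
  refine integral_congr_ae ?_
  filter_upwards [(hK Y hY hYC).1] with x hx
  simp_rw [sum_kernel_eq]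
  rw [integral_finsetSum _ fun i _ => integrable_finsetSum _ fun P _ =>
    integrable_finsetSum _ fun R _ => (hx R).const_mul _]
  refine Finset.sum_congr rfl fun i _ => ?_
  rw [integral_finsetSum _ fun P _ => integrable_finsetSum _ fun R _ => (hx R).const_mul _]
  refine Finset.sum_congr rfl fun P _ => ?_
  rw [integral_finsetSum _ fun R _ => (hx R).const_mul _]
  refine Finset.sum_congr rfl fun R _ => ?_
  rw [integral_const_mul, Finset.sum_mul]
  rfl

end CoulombSlice

end YM

theorem lemma2p1 {N d n : ℕ} (hn : n = 2 ∨ n = 3) (S : YM.GaugeGroup N d)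
    (s : ℝ) (hs : (n : ℝ) / 2 < s) :
    -- the induced metric is defined on the orbit space: it does not see
    -- the directions tangent to the orbits, and it is invariant under gauge transformations
    (∀ A X Y : YM.Form n d, YM.InHs s A → YM.InHs s X → YM.InHs s Y →
      ∀ ξ : YM.Section' n d, YM.FiniteEnergy S A ξ → YM.InHs s (YM.covD S A ξ) →
        YM.inducedMetric S A (X + YM.covD S A ξ) Y = YM.inducedMetric S A X Y ∧
        YM.inducedMetric S A X (Y + YM.covD S A ξ) = YM.inducedMetric S A X Y) ∧
    (∀ A A' X X' Y Y' : YM.Form n d, YM.InHs s A → YM.InHs s A' →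
      YM.InHs s X → YM.InHs s X' → YM.InHs s Y → YM.InHs s Y' →
      ∀ φ : YM.Sp n → Matrix (Fin N) (Fin N) ℂ, YM.IsGaugeTransf S φ →
        YM.IsTransform S φ A A' → YM.IsTangentTransform S φ X X' →
        YM.IsTangentTransform S φ Y Y' →
        YM.inducedMetric S A' X' Y' = YM.inducedMetric S A X Y) ∧
    -- the Coulomb slice in a neighbourhood of the flat connection
    ∃ ε : ℝ, 0 < ε ∧
      (∀ A : YM.Form n d, YM.NearFlat s ε A → YM.IsCoulomb A →
        -- the Gauss law can be solved for `A₀`; the solution is unique up to covariantly constant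
        -- functions; the reduced Lagrangian is the kinetic energy of the metric minus the potential
        (∀ V : YM.Form n d, YM.InHs s V →
          (∃ A₀, YM.SolvesGauss S A V A₀) ∧
          (∀ A₀ A₀', YM.SolvesGauss S A V A₀ → YM.SolvesGauss S A V A₀' →
            ∀ i, YM.covD S A A₀ i =ᵐ[volume] YM.covD S A A₀' i) ∧
          (∀ A₀, YM.SolvesGauss S A V A₀ →
            YM.lagrangian S A₀ A V = 1 / 2 * YM.inducedMetric S A V V - YM.potential S A)) ∧
        -- in Coulomb coordinates the Gauss law reads `A₀ = Δ_A⁻¹ [A_i, ∂_t A_i]`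
        (∀ V : YM.Form n d, YM.InHs s V → YM.IsCoulomb V →
          ∀ A₀, YM.SolvesGauss S A V A₀ ↔ YM.IsInvLap S A (YM.source S A V) A₀) ∧
        -- the metric, with `Δ_A⁻¹` as an operator
        (∀ X Y : YM.Form n d, YM.InHs s X → YM.IsCoulomb X → YM.InHs s Y → YM.IsCoulomb Y →
          ∀ u, YM.IsInvLap S A (YM.source S A Y) u →
            Integrable (fun x => ∑ i, ∑ P, ∑ R, ∑ V, X i x P * S.f P R V * A i x V * u x R) ∧
            YM.inducedMetric S A X Y =
              (∫ x, ∑ i, ∑ j, ∑ P, ∑ Q, YM.delta i j * YM.delta P Q * X i x P * Y j x Q) +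
              ∫ x, ∑ i, ∑ P, ∑ R, ∑ V, X i x P * S.f P R V * A i x V * u x R) ∧
        -- the metric, with an integral kernel `Δ_A⁻¹(x, x')`
        (∀ K : YM.Sp n → YM.Sp n → Matrix (Fin d) (Fin d) ℝ, YM.IsInvLapKernel S s A K →
          ∀ X Y : YM.Form n d, YM.InHs s X → YM.IsCoulomb X → YM.InHs s Y → YM.IsCoulomb Y →
            YM.inducedMetric S A X Y =
              (∫ x, ∑ i, ∑ j, ∑ P, ∑ Q, YM.delta i j * YM.delta P Q * X i x P * Y j x Q) +
              ∫ x, ∫ x', ∑ i, ∑ j, ∑ P, ∑ Q, X i x P *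
                (∑ R, ∑ R', ∑ V, ∑ U, S.f P R V * A i x V * K x x' R R' *
                  S.f R' U Q * A j x' U) * Y j x' Q)) ∧
      -- the action of a time-dependent connection, after elimination of `A₀`
      (∀ (A : ℝ → YM.Form n d) (A₀ : ℝ → YM.Section' n d),
        (∀ t i x, DifferentiableAt ℝ (fun τ => A τ i x) t) →
        (∀ t, YM.NearFlat s ε (A t) ∧ YM.IsCoulomb (A t)) →
        (∀ t, YM.InHs s (YM.velocity A t) ∧ YM.IsCoulomb (YM.velocity A t)) →
        (∀ t, YM.SolvesGauss S (A t) (YM.velocity A t) (A₀ t)) →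
        ∀ J : Set ℝ, YM.ymAction S J A₀ A =
          ∫ t in J, (1 / 2 * YM.inducedMetric S (A t) (YM.velocity A t) (YM.velocity A t) -
            YM.potential S (A t))) := by
  have h2n : 2 ≤ n := by omega
  have h1s : 1 ≤ s := by
    have : (2 : ℝ) ≤ n := by exact_mod_cast h2n
    linarith
  refine ⟨fun A X Y hA hX hY ξ hξ _ => YM.inducedMetric_add_covD hA.formL2 hX.formL2 hY.formL2 hξ,
    fun A A' X X' Y Y' hA hA' _ hX' _ hY' φ hφ h hX hY =>
      hφ.inducedMetric_eq hA.formL2 hA'.formL2 h hX'.formL2 hX hY'.formL2 hY, ?_⟩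
  obtain ⟨ε, hε, hcoe⟩ := YM.exists_coercive (d := d) S h2n hs
  refine ⟨ε, hε, fun A hflat hcoul => ?_, fun A A₀ _ hA hV hG J => ?_⟩
  · have hAH := hflat.inHs
    have hA := hAH.formL2
    have hC : YM.Coercive S hA := hcoe A hflat hcoul hA
    refine ⟨fun V hV => ⟨hC.exists_solvesGauss hV.formL2,
      fun u v hu hv i => hu.covD_unique hA hV.formL2 hv i,
      fun u hu => hu.lagrangian_eq h1s hs hAH hV⟩,
      fun V hV hVC u => hVC.solvesGauss_iff S hA hV.formL2 u,
      fun X Y hX hXC hY hYC u hu => hC.inducedMetric_eq hX.formL2 hXC hY.formL2 hYC hu,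
      fun K hK X Y hX hXC hY hYC => ?_⟩
    rw [hK.integral_eq X hY hYC]
    exact (hC.inducedMetric_eq hX.formL2 hXC hY.formL2 hYC (hK Y hY hYC).2).2
  · rw [YM.ymAction]
    -- The two integrands agree at every time, so neither measurability nor integrability in `t`
    -- enters.
    congr 1
    funext t
    exact (hG t).lagrangian_eq h1s hs (hA t).1.inHs (hV t).1
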